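/- **Setting.** Let $n\ge 1$, $p\ge 0$. Consider the strict-feedback plant $$\dot x_i=x_{i+1}+\varphi_i(x_1,\dots,x_i)^T\theta\ (1\le i\le n-1),\qquad \dot x_n=u+\varphi_n(x)^T\theta,\qquad y=x_1,$$ with $\varphi_i:\mathbb R^i\to\mathbb R^p$ smooth and $\theta\in\mathbb R^p$ constant (unknown), i.e. $\dot x=f(x,u)+F(x)^T\theta$ with $f(x,u)=(x_2,\dots,x_n,u)^T$ and $F=[\varphi_1\ \cdots\ \varphi_n]\in\mathbb R^{p\times n}$. The reference $r:[0,\infty)\to\mathbb R$ is $C^{n-1}$, its derivatives $r^{(0)},\dots,r^{(n)}$ are bounded, and $r^{(n)}$ is piecewise continuous (it may fail to exist at points that are finitely many in every bounded interval, with one-sided limits there). Solutions are continuous signals satisfying the differential equations outside a set with finitely many points in every bounded interval. **Controller.** Let $c_i,\kappa_i,g_i>0$. With $\alpha_0=0$ define, for $i=1,\dots,n$, as functions of $x,\hat\theta,r,\dots,r^{(n)}$, $$h_i=x_i-\alpha_{i-1}-r^{(i-1)},\qquad w_i=\varphi_i-\sum_{j=1}^{i-1}\frac{\partial\alpha_{i-1}}{\partial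 x_j}\varphi_j,\qquad s_i=c_i+\kappa_i|w_i|^2+g_i\Big|\frac{\partial\alpha_{i-1}}{\partial\hat\theta}\Big|^2,$$ $$\alpha_i=-s_ih_i-w_i^T\hat\theta+\sum_{k=1}^{i-1}\Big(\frac{\partial\alpha_{i-1}}{\partial x_k}x_{k+1}+\frac{\partial\alpha_{i-1}}{\partial r^{(k-1)}}r^{(k)}\Big),$$ and apply $u=\bar u=\alpha_n+r^{(n)}$. So $h_1=y-r$. **Identifier.** Let $\sigma>0$, let $\Gamma=\Gamma^T>0$, let $A_0$ be the matrix with diagonal $-c_1,\dots,-c_n$, ones on the superdiagonal and zeros elsewhere, and let $P=P^T>0$ satisfy $A_0^TP+PA_0=-I$. Use $$\dot{\hat x}=\big(A_0-\sigma F(x)^TF(x)P\big)(\hat x-x)+f(x,u)+F(x)^T\hat\theta,\qquad \dot{\hat\theta}=\Gamma F(x)P\epsilon,\qquad \epsilon=x-\hat x.$$ Put $\tilde\theta=\theta-\hat\theta$. **Theorem 3 ($x$-passive).** (i) For every initial time $t_0\ge0$ and all initial values $x(t_0),\hat x(t_0),\hat\theta(t_0)$ the closed loop has a unique solution, and it is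 defined on $[t_0,\infty)$. All signals are globally uniformly bounded: for every $R$ there is $B$ such that, for every $t_0\ge 0$, if $|x(t_0)|,|\hat x(t_0)|,|\hat\theta(t_0)|\le R$, then $|x|,|\hat x|,|\hat\theta|,|h|,|\dot{\hat\theta}|,|u|\le B$ for all $t\ge t_0$, where $h=(h_1,\dots,h_n)$ and $\dot{\hat\theta}$ stands for $\Gamma F(x)P\epsilon$. Moreover $h(t)\to0$ as $t\to\infty$; in particular $y(t)-r(t)\to0$. (ii) Consider initial time $0$. For $i=1,\dots,n-1$ let $$b_i=x_{i+1}-r^{(i)}+w_i^T\hat\theta-\sum_{j=1}^{i-1}\Big(\frac{\partial\alpha_{i-1}}{\partial x_j}x_{j+1}+\frac{\partial\alpha_{i-1}}{\partial r^{(j-1)}}r^{(j)}\Big)\Big|_{t=0},\qquad \underline c_i=-\frac{b_i}{h_i(0)}.$$ Suppose $c_i\ge\max\{\underline c_i,0\}$ for $i=1,\dots,n-1$ (when $h_i(0)=0$ this condition is replaced by $b_i\ge0$). If $h_1(0)\ge0$, $\hat x(0)=x(0)$ and $\Gamma=\gamma I$ with $\gamma>0$, then for all $t\ge0$ $$-h_1^*\le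 h_1(t)\le e^{-\underline ct}\sum_{i=1}^n\frac{t^{i-1}}{(i-1)!}h_i(0)+h_1^*,\qquad h_1^*=\frac{\underline c^n-1}{2\underline c^{n-1}(\underline c-1)}\bigg(\frac1{\sqrt{\underline c\,\underline\kappa}}+\sqrt{\frac{\gamma}{\sigma\underline g}}\bigg)|\tilde\theta(0)|,$$ where $\underline c=\min_{1\le i\le n}c_i$, $\underline\kappa=\min_{1\le i\le n}\kappa_i$, $\underline g=\min_{2\le i\le n}g_i$; for $\underline c=1$ the quotient $\frac{\underline c^n-1}{\underline c^{n-1}(\underline c-1)}$ means its limit $n$, and for $n=1$ the term with $\underline g$ is absent. -/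

import Mathlib

open Set Filter Topology
open scoped ContDiff Matrix

noncomputable section

namespace XPassive

/-- Euclidean norm of a real vector. -/
def eucNorm {m : ℕ} (v : Fin m → ℝ) : ℝ := Real.sqrt (∑ j, v j ^ 2)

/-- A set of times that has finitely many points in every bounded interval. -/
def LocFinite (E : Set ℝ) : Prop := ∀ a b : ℝ, (E ∩ Icc a b).Finite

/-! ### The reference signal -/

/-- The `k`-th derivative of `r` on `[0, ∞)` (one-sided at `0`). -/
def refDeriv (r : ℝ → ℝ) (k : ℕ) (t : ℝ) : ℝ := iteratedDerivWithin k r (Ici 0) t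

/-- The vector `(r(t), r'(t), …, r⁽ⁿ⁾(t))`. -/
def refJet (n : ℕ) (r : ℝ → ℝ) (t : ℝ) : Fin (n + 1) → ℝ := fun k => refDeriv r k t

/-- `r` and its first `n` derivatives are bounded on `[0, ∞)`, and the `n`-th derivative is
piecewise continuous: it exists and is continuous outside a set with finitely many points in each
bounded interval, and it has one-sided limits at the points of that set. (A jump of the `n`-th
derivative is a corner of the `(n-1)`-st, so the `n`-th derivative is not asked to exist there.) -/
structure AdmissibleReference (n : ℕ) (r : ℝ → ℝ) : Prop where
  contDiffOn : ContDiffOn ℝ ((n - 1 : ℕ) : WithTop ℕ∞) r (Ici 0)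
  bounded : ∀ k ≤ n, ∃ M : ℝ, ∀ t, 0 ≤ t → |refDeriv r k t| ≤ M
  piecewise : ∃ D : Set ℝ, LocFinite D ∧
    (∀ t, 0 ≤ t → t ∉ D →
      DifferentiableWithinAt ℝ (refDeriv r (n - 1)) (Ici 0) t ∧
      ContinuousWithinAt (refDeriv r n) (Ici 0) t) ∧
    (∀ t ∈ D, 0 ≤ t → ∃ l : ℝ, Tendsto (refDeriv r n) (𝓝[>] t) (𝓝 l)) ∧
    (∀ t ∈ D, 0 < t → ∃ l : ℝ, Tendsto (refDeriv r n) (𝓝[<] t) (𝓝 l))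

/-! ### Data of the closed loop

Indices start at `0`: the entry `i : Fin n` is the one with number `i + 1` in the usual writing
`x₁, …, xₙ`, whereas `r⁽ᵏ⁾` is entry `k : Fin (n + 1)`. -/

/-- Plant nonlinearities `φᵢ` (a function of the first components of the state, up to the `i`-th),
the unknown parameter `θ`, the reference `r` and the design parameters. Plain data, no laws. -/
structure Loop (n p : ℕ) where
  φ : (i : Fin n) → (Fin (i.val + 1) → ℝ) → (Fin p → ℝ)
  θ : Fin p → ℝ
  r : ℝ → ℝ
  c : Fin n → ℝ
  κ : Fin n → ℝ
  g : Fin n → ℝ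
  σ : ℝ
  P : Matrix (Fin n) (Fin n) ℝ
  Γ : Matrix (Fin p) (Fin p) ℝ

/-- The arguments `(x, θ̂, (r, r', …, r⁽ⁿ⁾))` of the virtual controls. -/
abbrev Args (n p : ℕ) : Type := (Fin n → ℝ) × (Fin p → ℝ) × (Fin (n + 1) → ℝ)

/-- `∂a/∂xₖ`. -/
def dX {n p : ℕ} (a : Args n p → ℝ) (k : Fin n) (z : Args n p) : ℝ :=
  fderiv ℝ a z (Pi.single k 1, 0, 0)

/-- `∂a/∂θ̂`, as a vector. -/
def dTheta {n p : ℕ} (a : Args n p → ℝ) (z : Args n p) : Fin p → ℝ :=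
  fun j => fderiv ℝ a z (0, Pi.single j 1, 0)

/-- `∂a/∂r⁽ᵏ⁾`. -/
def dR {n p : ℕ} (a : Args n p → ℝ) (k : Fin (n + 1)) (z : Args n p) : ℝ :=
  fderiv ℝ a z (0, 0, Pi.single k 1)

namespace Loop

variable {n p : ℕ} (S : Loop n p)

/-- `φᵢ` evaluated at the first components of the full state `x`, up to the `i`-th. -/
def phi (i : Fin n) (x : Fin n → ℝ) : Fin p → ℝ :=
  S.φ i (fun j => x ⟨j.val, lt_of_lt_of_le j.isLt i.isLt⟩)

/-- `F(x)`, the `p × n` matrix with columns `φ₁, …, φₙ`. -/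
def F (x : Fin n → ℝ) : Matrix (Fin p) (Fin n) ℝ := Matrix.of fun j i => S.phi i x j

/-- `f(x, u) = (x₂, …, xₙ, u)`. -/
def f (x : Fin n → ℝ) (u : ℝ) : Fin n → ℝ :=
  fun i => if hi : i.val + 1 < n then x ⟨i.val + 1, hi⟩ else u

/-- The matrix with diagonal `-c₁, …, -cₙ` and ones on the superdiagonal. -/
def A₀ : Matrix (Fin n) (Fin n) ℝ :=
  Matrix.of fun i j => if i = j then -S.c i else if j.val = i.val + 1 then 1 else 0

/-! ### Nonovershooting backstepping

In the next four definitions `a` is the virtual control of the preceding step. -/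

/-- Error coordinate `xᵢ - a - r⁽ⁱ⁻¹⁾`. -/
def hStep (a : Args n p → ℝ) (i : Fin n) (z : Args n p) : ℝ :=
  z.1 i - a z - z.2.2 i.castSucc

/-- Regressor `φᵢ - ∑_{j<i} (∂a/∂xⱼ) φⱼ`. -/
def wStep (a : Args n p → ℝ) (i : Fin n) (z : Args n p) : Fin p → ℝ :=
  S.phi i z.1 - ∑ j : Fin i.val,
    dX a ⟨j.val, j.isLt.trans i.isLt⟩ z • S.phi ⟨j.val, j.isLt.trans i.isLt⟩ z.1

/-- Nonlinear damping `cᵢ + κᵢ |wᵢ|² + gᵢ |∂a/∂θ̂|²`. -/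
def sStep (a : Args n p → ℝ) (i : Fin n) (z : Args n p) : ℝ :=
  S.c i + S.κ i * eucNorm (S.wStep a i z) ^ 2 + S.g i * eucNorm (dTheta a z) ^ 2

/-- `∑_{k<i} ((∂a/∂xₖ) xₖ₊₁ + (∂a/∂r⁽ᵏ⁻¹⁾) r⁽ᵏ⁾)` (with `k` starting at `1` in this formula). -/
def knownTerms (a : Args n p → ℝ) (i : Fin n) (z : Args n p) : ℝ :=
  ∑ k : Fin i.val,
    (dX a ⟨k.val, k.isLt.trans i.isLt⟩ z *
        z.1 ⟨k.val + 1, lt_of_le_of_lt (Nat.succ_le_of_lt k.isLt) i.isLt⟩ +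
      dR a ⟨k.val, by omega⟩ z * z.2.2 ⟨k.val + 1, by omega⟩)

/-- The virtual controls `α₀ = 0, α₁, …, αₙ` as functions of `(x, θ̂, (r, …, r⁽ⁿ⁾))`. -/
def alpha : (i : ℕ) → i ≤ n → Args n p → ℝ
  | 0, _ => fun _ => 0
  | i + 1, hi => fun z =>
      let a := alpha i (Nat.le_of_succ_le hi)
      let k : Fin n := ⟨i, hi⟩;
      (-S.sStep a k z) * hStep a k z - S.wStep a k z ⬝ᵥ z.2.1 + knownTerms a k z

/-- The virtual control of the step before step `i`. -/
def prev (i : Fin n) : Args n p → ℝ := S.alpha i.val i.isLt.le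

/-- The error coordinate `hᵢ`. -/
def h (i : Fin n) (z : Args n p) : ℝ := hStep (S.prev i) i z

/-- The override controller `ū = αₙ + r⁽ⁿ⁾`. -/
def uBar (z : Args n p) : ℝ := S.alpha n le_rfl z + z.2.2 (Fin.last n)

/-! ### Closed loop with the plant observer -/

/-- The arguments of the virtual controls at time `t` along signals `x`, `θ̂`. -/
def args (x : ℝ → Fin n → ℝ) (th : ℝ → Fin p → ℝ) (t : ℝ) : Args n p :=
  (x t, th t, refJet n S.r t)

/-- Right-hand side of the plant `ẋ = f(x, u) + F(x)ᵀ θ`. -/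
def plantRHS (x : Fin n → ℝ) (u : ℝ) : Fin n → ℝ :=
  f x u + (S.F x)ᵀ *ᵥ S.θ

/-- Right-hand side of the observer
`(A₀ - σ F(x)ᵀ F(x) P) (x̂ - x) + f(x, u) + F(x)ᵀ θ̂`. -/
def observerRHS (x xh : Fin n → ℝ) (th : Fin p → ℝ) (u : ℝ) : Fin n → ℝ :=
  (S.A₀ - S.σ • ((S.F x)ᵀ * S.F x * S.P)) *ᵥ (xh - x) + f x u + (S.F x)ᵀ *ᵥ th

/-- Right-hand side of the update law `Γ F(x) P (x - x̂)`. -/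
def updateRHS (x xh : Fin n → ℝ) : Fin p → ℝ :=
  (S.Γ * S.F x * S.P) *ᵥ (x - xh)

/-- `(x, x̂, θ̂)` solves the closed loop with `u = ū` on the time interval `I`: the signals are
continuous and the differential equations hold on `I` outside a set with finitely many points in
each bounded interval (the input is only piecewise continuous in time). -/
structure IsSolution (I : Set ℝ) (x xh : ℝ → Fin n → ℝ) (th : ℝ → Fin p → ℝ) : Prop where
  cont_x : ContinuousOn x I
  cont_xh : ContinuousOn xh I
  cont_th : ContinuousOn th I
  eqs : ∃ E : Set ℝ, LocFinite E ∧ ∀ t ∈ I, t ∉ E →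
    HasDerivWithinAt x (S.plantRHS (x t) (S.uBar (S.args x th t))) I t ∧
    HasDerivWithinAt xh (S.observerRHS (x t) (xh t) (th t) (S.uBar (S.args x th t))) I t ∧
    HasDerivWithinAt th (S.updateRHS (x t) (xh t)) I t

/-! ### Choice of the gains and the violation bound -/

/-- `xᵢ₊₁ - r⁽ⁱ⁾ + wᵢᵀ θ̂ - ∑_{j<i} ((∂αᵢ₋₁/∂xⱼ) xⱼ₊₁ + (∂αᵢ₋₁/∂r⁽ʲ⁻¹⁾) r⁽ʲ⁾)` for `i < n`. -/
def bracket (i : Fin n) (hi : i.val + 1 < n) (z : Args n p) : ℝ :=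
  z.1 ⟨i.val + 1, hi⟩ - z.2.2 i.succ + S.wStep (S.prev i) i z ⬝ᵥ z.2.1 -
    knownTerms (S.prev i) i z

/-- The lower gain threshold `-hᵢ⁻¹ · bracketᵢ`. -/
def cLow (i : Fin n) (hi : i.val + 1 < n) (z : Args n p) : ℝ :=
  -(S.h i z)⁻¹ * S.bracket i hi z

/-- The gain condition `cᵢ ≥ max (threshold) 0` for `i < n` at the initial data `z`. Where
`hᵢ` vanishes the threshold is a quotient by zero; it is read there as `+∞` (no admissible
gain) if the bracket is negative, and as no restriction otherwise. -/
def GainChoice (z : Args n p) : Prop :=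
  ∀ (i : Fin n) (hi : i.val + 1 < n),
    (S.h i z ≠ 0 → max (S.cLow i hi z) 0 ≤ S.c i) ∧
    (S.h i z = 0 → 0 ≤ S.bracket i hi z)

/-- `min cᵢ`. -/
def cMin : ℝ := ⨅ i : Fin n, S.c i

/-- `min κᵢ`. -/
def κMin : ℝ := ⨅ i : Fin n, S.κ i

/-- The minimum of `gᵢ` over all indices but the first. -/
def gMin : ℝ := ⨅ i : {i : Fin n // 0 < i.val}, S.g i.val

/-- The geometric factor `(cⁿ - 1) / (cⁿ⁻¹ (c - 1)) = 1 + c⁻¹ + … + c⁻⁽ⁿ⁻¹⁾`, `c = min cᵢ`, whose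
value at `c = 1` is `n`. -/
def geomFactor : ℝ :=
  if S.cMin = 1 then (n : ℝ)
  else (S.cMin ^ n - 1) / (S.cMin ^ (n - 1) * (S.cMin - 1))

/-- The violation bound `h₁*` for adaptation gain `γ` and initial parameter error of norm `e`. For
`n = 1` there is no `gᵢ` with `i ≥ 2` and the second summand is absent. -/
def violationBound (γ e : ℝ) : ℝ :=
  S.geomFactor / 2 *
    (1 / Real.sqrt (S.cMin * S.κMin) +
      (if n = 1 then 0 else Real.sqrt (γ / (S.σ * S.gMin)))) * e

end Loop

end XPassive

end

noncomputable section

namespace XPassive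

/-! ### Monotonicity and comparison with finitely many exceptional times -/

/-! Two estimates carry the theorem, one for the identifier and one for the error coordinates.

Identifier. Put e = x - x̂, q = F(x) P e and V = eᵀPe + θ̃ᵀΓ⁻¹θ̃. The update law θ̂' = Γq cancels
the indefinite term in V', and the Lyapunov equation for A₀ leaves V' = -|e|² - 2σ|q|²
(`hasDerivAt_lyapunov`). This holds whatever x does, so e and θ̃ are bounded before anything is
known about the plant state, and the decay of V dominates a multiple of |θ̂'|².

Error coordinates. The recursion for αᵢ is made so that hᵢ' = hᵢ₊₁ - sᵢhᵢ + wᵢᵀθ̃ - (∂αᵢ₋₁/∂θ̂)θ̂',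
with hₙ₊₁ = 0 (`hasDerivAt_h`). By Young's inequality the κ-part of sᵢ absorbs wᵢᵀθ̃ at the price
|θ̃|²/(2κᵢ), and the g-part absorbs the adaptation term at a price paid by a fraction of V'
(`damping_estimate`). Hence the squared positive part of hᵢ, or of -hᵢ, minus a comparison function,
plus a multiple of V, obeys a scalar linear differential inequality (`damped_bound`,
`Loop.Run.error_step`). It is applied from i = n down to i = 1.

Boundedness uses the zero comparison function and both signs; x is then recovered from h, θ̂ and r,
component by component (`exists_state_bound`). The bounds do not depend on the length of the
interval, so they also give global existence: the field is made bounded and Lipschitz by clamping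
the state, and the a priori bound shows that the clamp never acts. Subtracting r⁽ⁿ⁻¹⁾ times the
input direction removes the discontinuous r⁽ⁿ⁾ from the equation, so the standard theorems for
fields continuous in time apply.

Tracking uses Barbalat's lemma twice: on V, giving e → 0 and q → 0, then on e, whose equation gives
Fᵀθ̃ → 0. All disturbances of the h-cascade then vanish asymptotically, and so does h.

For the violation bound the gain condition makes every hᵢ(0) nonnegative, and the comparison
functions are the responses of the undisturbed chain with all gains equal to the smallest. Each
level adds one fixed amount, and each passage from hᵢ₊₁ to hᵢ divides the accumulated bound by that
gain, whence the geometric factor (`error_bounds`). -/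

lemma le_of_deriv_nonpos_off_finite {f f' : ℝ → ℝ} {E : Set ℝ} (N : ℕ) :
    ∀ {a b : ℝ}, a ≤ b → (hE : (E ∩ Ioo a b).Finite) → hE.toFinset.card ≤ N →
      ContinuousOn f (Icc a b) →
      (∀ t ∈ Ioo a b, t ∉ E → HasDerivAt f (f' t) t ∧ f' t ≤ 0) → f b ≤ f a := by
  induction N with
  | zero =>
    intro a b hab hE hcard hf hd
    have hemp : E ∩ Ioo a b = ∅ := by
      have := Finset.card_eq_zero.mp (Nat.le_zero.mp hcard)
      simpa using this
    have hd' : ∀ t ∈ Ioo a b, HasDerivAt f (f' t) t ∧ f' t ≤ 0 := fun t ht =>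
      hd t ht fun htE => by
        have : t ∈ E ∩ Ioo a b := ⟨htE, ht⟩
        simp [hemp] at this
    refine antitoneOn_of_deriv_nonpos (convex_Icc a b) hf ?_ ?_ (left_mem_Icc.mpr hab)
      (right_mem_Icc.mpr hab) hab
    · rw [interior_Icc]
      exact fun t ht => (hd' t ht).1.differentiableAt.differentiableWithinAt
    · rw [interior_Icc]
      intro t ht
      rw [(hd' t ht).1.deriv]
      exact (hd' t ht).2
  | succ N ih =>
    intro a b hab hE hcard hf hd
    by_cases hne : (E ∩ Ioo a b).Nonempty
    · obtain ⟨e, heE, he⟩ := hne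
      have sub : ∀ {u v : ℝ}, a ≤ u → v ≤ b → u ≤ v → e ∉ Ioo u v → f v ≤ f u := by
        intro u v hu hv huv hev
        have hss : E ∩ Ioo u v ⊆ E ∩ Ioo a b :=
          inter_subset_inter_right _ (Ioo_subset_Ioo hu hv)
        have hfin := hE.subset hss
        refine ih huv hfin ?_ (hf.mono (Icc_subset_Icc hu hv))
          (fun t ht => hd t (Ioo_subset_Ioo hu hv ht))
        have : hfin.toFinset.card < hE.toFinset.card := by
          apply Finset.card_lt_card
          rw [Set.Finite.toFinset_ssubset_toFinset]
          refine ⟨hss, fun h => hev (h ⟨heE, he⟩).2⟩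
        omega
      exact (sub he.1.le le_rfl he.2.le (fun h => lt_irrefl _ h.1)).trans
        (sub le_rfl he.2.le he.1.le (fun h => lt_irrefl _ h.2))
    · refine ih hab hE ?_ hf hd
      rw [Set.not_nonempty_iff_eq_empty] at hne
      simp [hne]

lemma le_of_deriv_nonpos {f f' : ℝ → ℝ} {E : Set ℝ} (hE : LocFinite E) {a b : ℝ} (hab : a ≤ b)
    (hf : ContinuousOn f (Icc a b))
    (hd : ∀ t ∈ Ioo a b, t ∉ E → HasDerivAt f (f' t) t ∧ f' t ≤ 0) : f b ≤ f a :=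
  le_of_deriv_nonpos_off_finite _ hab
    ((hE a b).subset (inter_subset_inter_right _ Ioo_subset_Icc_self)) le_rfl hf hd

lemma abs_sub_le_of_deriv_bound {f f' : ℝ → ℝ} {E : Set ℝ} (hE : LocFinite E) {a b C : ℝ}
    (hab : a ≤ b) (hf : ContinuousOn f (Icc a b))
    (hd : ∀ t ∈ Ioo a b, t ∉ E → HasDerivAt f (f' t) t ∧ |f' t| ≤ C) :
    |f b - f a| ≤ C * (b - a) := by
  have h1 := le_of_deriv_nonpos (f := fun t => f t - C * t) (f' := fun t => f' t - C * 1) hE hab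
    (by fun_prop) (fun t ht htE => ⟨(hd t ht htE).1.sub ((hasDerivAt_id t).const_mul C), by
      have := (abs_le.mp (hd t ht htE).2).2
      linarith⟩)
  have h2 := le_of_deriv_nonpos (f := fun t => -f t - C * t) (f' := fun t => -f' t - C * 1) hE hab
    (by fun_prop) (fun t ht htE => ⟨(hd t ht htE).1.neg.sub ((hasDerivAt_id t).const_mul C), by
      have := (abs_le.mp (hd t ht htE).2).1
      linarith⟩)
  rw [abs_le]
  constructor <;> linarith

/-- Linear comparison: `v' ≤ -k v + K` gives `v(b) ≤ K / k + e^{-k (b - a)} (v(a) - K / k)`. -/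
lemma linear_comparison {v v' : ℝ → ℝ} {E : Set ℝ} (hE : LocFinite E) {a b k K : ℝ} (hk : 0 < k)
    (hab : a ≤ b) (hv : ContinuousOn v (Icc a b))
    (hd : ∀ t ∈ Ioo a b, t ∉ E → HasDerivAt v (v' t) t ∧ v' t ≤ -k * v t + K) :
    v b ≤ K / k + Real.exp (-k * (b - a)) * (v a - K / k) := by
  have h1 := le_of_deriv_nonpos (f := fun t => Real.exp (k * t) * (v t - K / k))
    (f' := fun t => Real.exp (k * t) * (k * 1) * (v t - K / k) + Real.exp (k * t) * v' t) hE hab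
    (by fun_prop) (fun t ht htE => ⟨(((hasDerivAt_id t).const_mul k).exp).mul
      ((hd t ht htE).1.sub_const _), by
      have h2 := (hd t ht htE).2
      have h3 := Real.exp_pos (k * t)
      have h4 : Real.exp (k * t) * (k * 1) * (v t - K / k) + Real.exp (k * t) * v' t
          = Real.exp (k * t) * (v' t + k * v t - K) := by field_simp; ring
      rw [h4]
      exact mul_nonpos_of_nonneg_of_nonpos h3.le (by linarith)⟩)
  have h5 : Real.exp (-k * (b - a)) = Real.exp (k * a) / Real.exp (k * b) := by
    rw [← Real.exp_sub]; ring_nf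
  have h6 := Real.exp_pos (k * b)
  rw [h5, div_mul_eq_mul_div]
  have : v b - K / k ≤ Real.exp (k * a) * (v a - K / k) / Real.exp (k * b) := by
    rw [le_div_iff₀ h6]; linarith
  linarith

/-- Squaring makes the positive part differentiable at zero too, so one-sided bounds can be proved
by differentiating. -/
lemma hasDerivAt_max_zero_sq (y : ℝ) : HasDerivAt (fun y : ℝ => max y 0 ^ 2) (2 * max y 0) y := by
  rcases lt_trichotomy y 0 with hy | rfl | hy
  · rw [max_eq_right hy.le]
    refine (hasDerivAt_const y (0 : ℝ)).congr_deriv (by simp) |>.congr_of_eventuallyEq ?_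
    filter_upwards [Iio_mem_nhds hy] with z hz
    have hz' : z < 0 := hz
    simp [max_eq_right hz'.le]
  · rw [hasDerivAt_iff_isLittleO]
    simp only [max_self, mul_zero, sub_zero, smul_zero, ne_eq, OfNat.ofNat_ne_zero,
      not_false_eq_true, zero_pow]
    have h1 : (fun x : ℝ => max x 0 ^ 2) =O[𝓝 0] fun x : ℝ => x ^ 2 := by
      refine Asymptotics.isBigO_of_le _ fun x => ?_
      rw [norm_pow, norm_pow]
      gcongr
      rw [Real.norm_eq_abs, Real.norm_eq_abs]
      rcases le_total x 0 with h | h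
      · simp [h]
      · simp [h]
    refine h1.trans_isLittleO ?_
    simpa using Asymptotics.isLittleO_pow_pow (𝕜 := ℝ) one_lt_two
  · rw [max_eq_left hy.le]
    have h1 : HasDerivAt (fun z : ℝ => z ^ 2) (2 * y) y := by
      simpa using hasDerivAt_pow 2 y
    refine h1.congr_of_eventuallyEq ?_
    filter_upwards [Ioi_mem_nhds hy] with z hz
    rw [max_eq_left (le_of_lt hz)]

/-- One step of a damped cascade: if `h' = hₙ - s h + δ` where the disturbance is dominated through
the damping by `K` and the decay of `V`, and `hₙ ≤ Uₙ + M`, then `h` is at most `U + M / c` up to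
the square root of the energy put in. -/
lemma damped_bound {h hn s δ U Un V V' : ℝ → ℝ} {E : Set ℝ} (hE : LocFinite E) {a b c M K : ℝ}
    (hab : a ≤ b) (hc : 0 < c) (hM : 0 ≤ M) (hK : 0 ≤ K)
    (hh : ContinuousOn h (Icc a b)) (hU : ContinuousOn U (Icc a b)) (hV : ContinuousOn V (Icc a b))
    (hUd : ∀ t ∈ Ioo a b, HasDerivAt U (-c * U t + Un t) t)
    (hU0 : ∀ t ∈ Ioo a b, 0 ≤ U t)
    (hn_le : ∀ t ∈ Ioo a b, hn t ≤ Un t + M)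
    (hV0 : ∀ t ∈ Icc a b, 0 ≤ V t)
    (hd : ∀ t ∈ Ioo a b, t ∉ E → HasDerivAt h (hn t - s t * h t + δ t) t ∧
      HasDerivAt V (V' t) t ∧ V' t ≤ 0 ∧ c ≤ s t ∧
      ∀ y, 2 * y * (-s t * y + δ t) ≤ -(2 * c) * y ^ 2 + K - V' t) :
    h b ≤ U b + M / c + Real.sqrt (max (h a - U a - M / c) 0 ^ 2 + V a + K / (2 * c)) := by
  set y : ℝ → ℝ := fun t => h t - U t - M / c with hy
  have hVle : ∀ t ∈ Icc a b, V t ≤ V a := fun t ht =>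
    le_of_deriv_nonpos hE ht.1 (hV.mono (Icc_subset_Icc_right ht.2)) fun τ hτ hτE =>
      ⟨(hd τ ⟨hτ.1, hτ.2.trans_le ht.2⟩ hτE).2.1, (hd τ ⟨hτ.1, hτ.2.trans_le ht.2⟩ hτE).2.2.1⟩
  -- The terms V' cancel. Writing -2c y₊² = -2c (y₊² + V) + 2cV and bounding V by its initial value
  -- gives the constant 2cV(a) + K.
  have key := linear_comparison (v := fun t => max (y t) 0 ^ 2 + V t)
    (v' := fun t => 2 * max (y t) 0 *
      (hn t - s t * h t + δ t - (-c * U t + Un t)) + V' t) (k := 2 * c)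
    (K := 2 * c * V a + K) hE (by linarith) hab (by fun_prop) (fun t ht htE => by
      obtain ⟨h1, h2, h3, h4, h5⟩ := hd t ht htE
      have hyd : HasDerivAt y (hn t - s t * h t + δ t - (-c * U t + Un t)) t :=
        (h1.sub (hUd t ht)).sub_const _
      refine ⟨((hasDerivAt_max_zero_sq (y t)).comp t hyd).add h2, ?_⟩
      have h6 := hVle t (Ioo_subset_Icc_self ht)
      have h7 := h5 (max (y t) 0)
      -- Where y > 0, substitute h = y + U + M/c: since s ≥ c and U + M/c ≥ 0, the damping of this
      -- part outweighs Uₙ + M - (-cU + Uₙ) = cU + M.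
      have h8 : max (y t) 0 * (hn t - s t * h t + δ t - (-c * U t + Un t)) ≤
          max (y t) 0 * (-s t * max (y t) 0 + δ t) := by
        rcases le_total (y t) 0 with hneg | hpos
        · simp [max_eq_right hneg]
        · rw [max_eq_left hpos]
          refine mul_le_mul_of_nonneg_left ?_ hpos
          have e1 : h t = y t + U t + M / c := by simp only [hy]; ring
          have e2 := hn_le t ht
          have e3 : 0 ≤ (s t - c) * (U t + M / c) :=
            mul_nonneg (by linarith) (add_nonneg (hU0 t ht) (by positivity))
          have e4 : c * (M / c) = M := by field_simp
          rw [e1]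
          nlinarith
      have h9 : c * V t ≤ c * V a := mul_le_mul_of_nonneg_left h6 hc.le
      nlinarith)
  have hexp0 := Real.exp_pos (-(2 * c) * (b - a))
  have hexp1 : Real.exp (-(2 * c) * (b - a)) ≤ 1 := by
    rw [Real.exp_le_one_iff]
    nlinarith
  have hdiv : (2 * c * V a + K) / (2 * c) = V a + K / (2 * c) := by field_simp
  rw [hdiv] at key
  have hVb := hV0 b (right_mem_Icc.mpr hab)
  have hm0 : 0 ≤ max (y a) 0 ^ 2 := sq_nonneg _
  have hbd : max (y b) 0 ^ 2 ≤ max (y a) 0 ^ 2 + V a + K / (2 * c) := by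
    have h1 : Real.exp (-(2 * c) * (b - a)) * (max (y a) 0 ^ 2) ≤ max (y a) 0 ^ 2 :=
      mul_le_of_le_one_left hm0 hexp1
    have hK0 : 0 ≤ K / (2 * c) := by positivity
    nlinarith
  have := Real.le_sqrt_of_sq_le hbd
  have h2 := le_max_left (y b) 0
  have h3 : y b = h b - U b - M / c := rfl
  linarith

/-! ### Barbalat's lemma -/

lemma eventually_lt_of_barbalat {f a q : ℝ → ℝ} {E : Set ℝ} (hE : LocFinite E) {T l : ℝ}
    (hf : ContinuousOn f (Ici T))
    (hd : ∀ t ∈ Ioi T, t ∉ E → HasDerivAt f (a t + q t) t) (hl : Tendsto f atTop (𝓝 l))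
    (ha : Tendsto a atTop (𝓝 0)) (hq : UniformContinuousOn q (Ici T)) {ε : ℝ} (hε : 0 < ε) :
    ∀ᶠ t in atTop, q t < ε := by
  obtain ⟨δ, hδ, hqδ⟩ := Metric.uniformContinuousOn_iff.mp hq (ε / 4) (by positivity)
  have h1 : ∀ᶠ t in atTop, |a t| < ε / 4 := by
    simpa [Real.dist_eq] using Metric.tendsto_nhds.mp ha (ε / 4) (by positivity)
  have h2 : ∀ᶠ t in atTop, |f t - l| < ε * δ / 16 := by
    simpa [Real.dist_eq] using Metric.tendsto_nhds.mp hl (ε * δ / 16) (by positivity)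
  filter_upwards [eventually_forall_ge_atTop.mpr h1, eventually_forall_ge_atTop.mpr h2,
    eventually_ge_atTop T] with t ht1 ht2 htT
  by_contra! hcon
  -- If q(t) ≥ ε, then f' ≥ 3ε/4 - ε/4 on an interval of length δ/2, so f rises by at least εδ/4;
  -- being within εδ/16 of its limit it can vary by less than εδ/8.
  have key := le_of_deriv_nonpos (f := fun τ => ε / 2 * τ - f τ)
    (f' := fun τ => ε / 2 * 1 - (a τ + q τ)) hE (a := t) (b := t + δ / 2) (by linarith)
    ((by fun_prop : ContinuousOn (fun τ : ℝ => ε / 2 * τ) _).sub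
      (hf.mono fun τ hτ => htT.trans hτ.1))
    (fun τ hτ hτE => ⟨((hasDerivAt_id τ).const_mul _).sub
      (hd τ (lt_of_le_of_lt htT hτ.1) hτE), by
      have e1 := (abs_lt.mp (ht1 τ hτ.1.le)).1
      have e2 := hqδ τ (htT.trans hτ.1.le) t htT (by
        rw [Real.dist_eq, abs_lt]; constructor <;> linarith [hτ.1, hτ.2])
      rw [Real.dist_eq] at e2
      have := (abs_lt.mp e2).1
      linarith⟩)
  have e1 := abs_lt.mp (ht2 t le_rfl)
  have e2 := abs_lt.mp (ht2 (t + δ / 2) (by linarith))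
  nlinarith [mul_pos hε hδ]

/-- The vanishing term `a` need not be continuous. It is zero for the Lyapunov function and collects
the terms in e and q for the observer error. -/
lemma barbalat {f a q : ℝ → ℝ} {E : Set ℝ} (hE : LocFinite E) {T l : ℝ}
    (hf : ContinuousOn f (Ici T))
    (hd : ∀ t ∈ Ioi T, t ∉ E → HasDerivAt f (a t + q t) t) (hl : Tendsto f atTop (𝓝 l))
    (ha : Tendsto a atTop (𝓝 0)) (hq : UniformContinuousOn q (Ici T)) :
    Tendsto q atTop (𝓝 0) := by
  rw [Metric.tendsto_nhds]
  intro ε hε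
  have h1 := eventually_lt_of_barbalat hE hf hd hl ha hq hε
  have h2 := eventually_lt_of_barbalat (f := fun t => -f t) (a := fun t => -a t)
    (q := fun t => -q t) hE hf.neg
    (fun t ht htE => by
      have := (hd t ht htE).neg
      rwa [neg_add] at this) hl.neg (by simpa using ha.neg)
    (by
      rw [Metric.uniformContinuousOn_iff] at hq ⊢
      intro e he
      obtain ⟨d, hd0, hd1⟩ := hq e he
      exact ⟨d, hd0, fun x hx y hy hxy => by simpa using hd1 x hx y hy hxy⟩) hε
  filter_upwards [h1, h2] with t ht1 ht2
  rw [Real.dist_eq, sub_zero, abs_lt]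
  constructor <;> linarith

/-- Once |η| ≤ cε/2, `damped_bound` without energy terms compares ±h with an exponential started at
|h(a)|, up to ε/2. The damping s may be unbounded above. -/
lemma tendsto_zero_of_damped {h s η : ℝ → ℝ} {E : Set ℝ} (hE : LocFinite E) {T c : ℝ} (hc : 0 < c)
    (hh : ContinuousOn h (Ici T))
    (hd : ∀ t ∈ Ioi T, t ∉ E → HasDerivAt h (η t - s t * h t) t ∧ c ≤ s t)
    (hη : Tendsto η atTop (𝓝 0)) : Tendsto h atTop (𝓝 0) := by
  rw [Metric.tendsto_nhds]
  intro ε hε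
  have h1 : ∀ᶠ t in atTop, |η t| < c * (ε / 2) := by
    simpa [Real.dist_eq] using Metric.tendsto_nhds.mp hη (c * (ε / 2)) (by positivity)
  obtain ⟨a, ha⟩ := ((eventually_forall_ge_atTop.mpr h1).and (eventually_ge_atTop T)).exists
  obtain ⟨ha1, haT⟩ := ha
  have side : ∀ σ : ℝ, |σ| = 1 → ∀ b, a ≤ b →
      σ * h b ≤ Real.exp (-c * (b - a)) * |h a| + ε / 2 := by
    intro σ hσ b hab
    have key := damped_bound (h := fun t => σ * h t) (hn := fun t => σ * η t) (s := s)
      (δ := fun _ => 0) (U := fun t => Real.exp (-c * (t - a)) * |h a|) (Un := fun _ => 0)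
      (V := fun _ => 0) (V' := fun _ => 0) (c := c) (M := c * (ε / 2)) (K := 0) hE hab hc
      (by positivity) le_rfl (continuousOn_const.mul (hh.mono fun t ht => haT.trans ht.1))
      (by fun_prop) continuousOn_const
      (fun t _ => by
        have := ((((hasDerivAt_id t).sub_const a).const_mul (-c)).exp).mul_const (|h a|)
        refine HasDerivAt.congr_deriv this ?_
        simp only [id]; ring)
      (fun t _ => by positivity)
      (fun t ht => by
        have := (le_abs_self (σ * η t)).trans_eq (abs_mul _ _)
        rw [hσ, one_mul] at this
        linarith [ha1 t ht.1.le])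
      (fun _ _ => le_rfl)
      (fun t ht htE => ⟨by
        have := (hd t (lt_of_le_of_lt haT ht.1) htE).1.const_mul σ
        refine HasDerivAt.congr_deriv this ?_
        ring, hasDerivAt_const _ _, le_rfl, (hd t (lt_of_le_of_lt haT ht.1) htE).2, fun y => by
          have := (hd t (lt_of_le_of_lt haT ht.1) htE).2
          nlinarith [mul_le_mul_of_nonneg_right this (sq_nonneg y)]⟩)
    have e1 : σ * h a ≤ |h a| := by
      have := (le_abs_self (σ * h a)).trans_eq (abs_mul _ _)
      rwa [hσ, one_mul] at this
    have e2 : max (σ * h a - Real.exp (-c * (a - a)) * |h a| - c * (ε / 2) / c) 0 = 0 := by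
      apply max_eq_right
      simp only [sub_self, mul_zero, Real.exp_zero, one_mul]
      have : 0 ≤ c * (ε / 2) / c := by positivity
      linarith
    simp only [e2] at key
    have e3 : c * (ε / 2) / c = ε / 2 := by field_simp
    simpa [e3] using key
  have hexp : Tendsto (fun b => Real.exp (-c * (b - a)) * |h a|) atTop (𝓝 0) := by
    have h2 : Tendsto (fun b : ℝ => -c * (b - a)) atTop atBot := by
      refine Tendsto.const_mul_atTop_of_neg (by linarith) ?_
      exact tendsto_atTop_add_const_right _ (-a) tendsto_id
    simpa using (Real.tendsto_exp_atBot.comp h2).mul_const (|h a|)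
  filter_upwards [(tendsto_order.mp hexp).2 (ε / 2) (by positivity), eventually_ge_atTop a]
    with b hb hab
  have u := side 1 (by simp) b hab
  have v := side (-1) (by simp) b hab
  rw [Real.dist_eq, sub_zero, abs_lt]
  constructor <;> linarith

/-! ### Euclidean norm and dot product -/

lemma eucNorm_nonneg {m : ℕ} (v : Fin m → ℝ) : 0 ≤ eucNorm v := Real.sqrt_nonneg _

lemma eucNorm_sq {m : ℕ} (v : Fin m → ℝ) : eucNorm v ^ 2 = v ⬝ᵥ v := by
  rw [eucNorm, Real.sq_sqrt (Finset.sum_nonneg fun j _ => sq_nonneg _)]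
  simp [dotProduct, sq]

lemma abs_dotProduct_le {m : ℕ} (v w : Fin m → ℝ) : |v ⬝ᵥ w| ≤ eucNorm v * eucNorm w := by
  rw [eucNorm, eucNorm, ← Real.sqrt_mul (Finset.sum_nonneg fun j _ => sq_nonneg _)]
  exact Real.abs_le_sqrt (Finset.sum_mul_sq_le_sq_mul_sq _ _ _)

/-! ### Smoothness of the virtual controls -/

section Smooth

variable {n p : ℕ}

lemma contDiff_dX {a : Args n p → ℝ} (ha : ContDiff ℝ ∞ a) (k : Fin n) :
    ContDiff ℝ ∞ (dX a k) :=
  (ha.fderiv_right (m := ∞) (by simp)).clm_apply contDiff_const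

lemma contDiff_dR {a : Args n p → ℝ} (ha : ContDiff ℝ ∞ a) (k : Fin (n + 1)) :
    ContDiff ℝ ∞ (dR a k) :=
  (ha.fderiv_right (m := ∞) (by simp)).clm_apply contDiff_const

lemma contDiff_dTheta {a : Args n p → ℝ} (ha : ContDiff ℝ ∞ a) : ContDiff ℝ ∞ (dTheta a) :=
  contDiff_pi.mpr fun _ => (ha.fderiv_right (m := ∞) (by simp)).clm_apply contDiff_const

lemma contDiff_dotProduct {F : Type*} [NormedAddCommGroup F] [NormedSpace ℝ F] {m : ℕ}
    {v w : F → Fin m → ℝ} (hv : ContDiff ℝ ∞ v) (hw : ContDiff ℝ ∞ w) :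
    ContDiff ℝ ∞ fun z => v z ⬝ᵥ w z := by
  rw [contDiff_pi] at hv hw
  exact ContDiff.sum fun i _ => (hv i).mul (hw i)

variable {S : Loop n p}

lemma contDiff_phi (hφ : ∀ i, ContDiff ℝ ∞ (S.φ i)) (i : Fin n) : ContDiff ℝ ∞ (S.phi i) :=
  (hφ i).comp (contDiff_pi.mpr fun _ => contDiff_apply ℝ ℝ _)

lemma contDiff_wStep (hφ : ∀ i, ContDiff ℝ ∞ (S.φ i)) {a : Args n p → ℝ} (ha : ContDiff ℝ ∞ a)
    (i : Fin n) : ContDiff ℝ ∞ (S.wStep a i) :=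
  ((contDiff_phi hφ i).comp contDiff_fst).sub
    (ContDiff.sum fun _ _ => (contDiff_dX ha _).smul ((contDiff_phi hφ _).comp contDiff_fst))

lemma contDiff_sStep (hφ : ∀ i, ContDiff ℝ ∞ (S.φ i)) {a : Args n p → ℝ} (ha : ContDiff ℝ ∞ a)
    (i : Fin n) : ContDiff ℝ ∞ (S.sStep a i) := by
  unfold Loop.sStep
  simp only [eucNorm_sq]
  exact (contDiff_const.add (contDiff_const.mul (contDiff_dotProduct (contDiff_wStep hφ ha i)
    (contDiff_wStep hφ ha i)))).add (contDiff_const.mul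
      (contDiff_dotProduct (contDiff_dTheta ha) (contDiff_dTheta ha)))

lemma contDiff_state (i : Fin n) : ContDiff ℝ ∞ fun z : Args n p => z.1 i :=
  (contDiff_apply ℝ ℝ i).comp contDiff_fst

lemma contDiff_jet (i : Fin (n + 1)) : ContDiff ℝ ∞ fun z : Args n p => z.2.2 i :=
  (contDiff_apply ℝ ℝ i).comp (contDiff_snd.comp contDiff_snd)

lemma contDiff_hStep {a : Args n p → ℝ} (ha : ContDiff ℝ ∞ a) (i : Fin n) :
    ContDiff ℝ ∞ (Loop.hStep a i) :=
  ((contDiff_state i).sub ha).sub (contDiff_jet _)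

lemma contDiff_knownTerms {a : Args n p → ℝ} (ha : ContDiff ℝ ∞ a) (i : Fin n) :
    ContDiff ℝ ∞ (Loop.knownTerms a i) :=
  ContDiff.sum fun _ _ => ((contDiff_dX ha _).mul (contDiff_state _)).add
    ((contDiff_dR ha _).mul (contDiff_jet _))

lemma contDiff_alpha (hφ : ∀ i, ContDiff ℝ ∞ (S.φ i)) :
    ∀ (i : ℕ) (hi : i ≤ n), ContDiff ℝ ∞ (S.alpha i hi)
  | 0, _ => contDiff_const
  | i + 1, hi => by
    have ha := contDiff_alpha hφ i (Nat.le_of_succ_le hi)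
    exact (((contDiff_sStep hφ ha _).neg.mul (contDiff_hStep ha _)).sub
      (contDiff_dotProduct (contDiff_wStep hφ ha _) (contDiff_fst.comp contDiff_snd))).add
      (contDiff_knownTerms ha _)

lemma contDiff_h (hφ : ∀ i, ContDiff ℝ ∞ (S.φ i)) (i : Fin n) : ContDiff ℝ ∞ (S.h i) :=
  contDiff_hStep (contDiff_alpha hφ _ _) i

end Smooth

/-! ### Dependence on the first components only -/

section Dependence

variable {n p : ℕ}

/-- Agreement of the first `i` entries of the state and of the reference jet, and of `θ̂`. -/
def AgreeTo (i : ℕ) (z z' : Args n p) : Prop :=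
  (∀ k : Fin n, k.val < i → z.1 k = z'.1 k) ∧ z.2.1 = z'.2.1 ∧
    ∀ k : Fin (n + 1), k.val < i → z.2.2 k = z'.2.2 k

lemma AgreeTo.mono {i j : ℕ} (hij : i ≤ j) {z z' : Args n p} (h : AgreeTo j z z') :
    AgreeTo i z z' :=
  ⟨fun k hk => h.1 k (hk.trans_le hij), h.2.1, fun k hk => h.2.2 k (hk.trans_le hij)⟩

/-- `a` is a function of the first `i` entries of the state and of the jet, and of `θ̂`. -/
def DependsTo {β : Type*} (i : ℕ) (a : Args n p → β) : Prop :=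
  ∀ z z', AgreeTo i z z' → a z = a z'

lemma DependsTo.mono {β : Type*} {i j : ℕ} (hij : i ≤ j) {a : Args n p → β}
    (h : DependsTo i a) : DependsTo j a := fun z z' hz => h z z' (hz.mono hij)

/-- The function is invariant under translation by z' - z, and so is its derivative. -/
lemma DependsTo.fderiv {i : ℕ} {a : Args n p → ℝ} (h : DependsTo i a) :
    DependsTo i (fderiv ℝ a) := by
  intro z z' hz
  have : a = fun w => a (w + (z' - z)) := by
    funext w
    refine h _ _ ⟨fun k hk => ?_, ?_, fun k hk => ?_⟩
    · simp [hz.1 k hk]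
    · simp [hz.2.1]
    · simp [hz.2.2 k hk]
  calc _root_.fderiv ℝ a z = _root_.fderiv ℝ (fun w => a (w + (z' - z))) z := by rw [← this]
    _ = _root_.fderiv ℝ a z' := by rw [fderiv_comp_add_right]; simp

lemma DependsTo.fderiv_apply_eq_zero {i : ℕ} {a : Args n p → ℝ} (h : DependsTo i a)
    (ha : ContDiff ℝ ∞ a) (z : Args n p) {v : Args n p} (hv : AgreeTo i v 0) :
    _root_.fderiv ℝ a z v = 0 := by
  have h1 : HasDerivAt (fun t : ℝ => z + t • v) v 0 := by
    simpa using ((hasDerivAt_id (0 : ℝ)).smul_const v).const_add z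
  have h2 : HasFDerivAt a (_root_.fderiv ℝ a z) (z + (0 : ℝ) • v) := by
    simpa using (ha.differentiable (by simp) z).hasFDerivAt
  have h3 := h2.comp_hasDerivAt 0 h1
  have h4 : (a ∘ fun t : ℝ => z + t • v) = fun _ => a z := by
    funext t
    refine h _ _ ⟨fun k hk => ?_, ?_, fun k hk => ?_⟩
    · simp [hv.1 k hk]
    · simp [hv.2.1]
    · simp [hv.2.2 k hk]
  rw [h4] at h3
  exact h3.unique (hasDerivAt_const _ _)

lemma DependsTo.fderiv_apply_congr {i : ℕ} {a : Args n p → ℝ} (h : DependsTo i a)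
    (ha : ContDiff ℝ ∞ a) (z : Args n p) {v v' : Args n p} (hv : AgreeTo i v v') :
    _root_.fderiv ℝ a z v = _root_.fderiv ℝ a z v' := by
  rw [← sub_eq_zero, ← map_sub]
  refine h.fderiv_apply_eq_zero ha z ⟨fun k hk => ?_, ?_, fun k hk => ?_⟩
  · simp [hv.1 k hk]
  · simp [hv.2.1]
  · simp [hv.2.2 k hk]

lemma fderiv_apply_eq_sums (a : Args n p → ℝ) (z v : Args n p) :
    fderiv ℝ a z v = ∑ k, dX a k z * v.1 k + dTheta a z ⬝ᵥ v.2.1 + ∑ k, dR a k z * v.2.2 k := by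
  have hv : v = ∑ k, v.1 k • ((Pi.single k 1, 0, 0) : Args n p) +
      ∑ j, v.2.1 j • ((0, Pi.single j 1, 0) : Args n p) +
      ∑ k, v.2.2 k • ((0, 0, Pi.single k 1) : Args n p) := by
    refine Prod.ext ?_ (Prod.ext ?_ ?_)
    all_goals
      funext l
      simp [Prod.fst_sum, Prod.snd_sum, Finset.sum_apply, Pi.single_apply]
  conv_lhs => rw [hv]
  simp only [map_add, map_sum, map_smul, smul_eq_mul, dX, dTheta, dR, dotProduct]
  congr 1
  · congr 1
    · exact Finset.sum_congr rfl fun _ _ => mul_comm _ _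
    · exact Finset.sum_congr rfl fun _ _ => mul_comm _ _
  · exact Finset.sum_congr rfl fun _ _ => mul_comm _ _

/-- Cuts the chain rule to the sums over k < i that occur in `wStep` and `knownTerms`. -/
lemma DependsTo.fderiv_apply {a : Args n p → ℝ} {i : Fin n} (h : DependsTo i.val a)
    (ha : ContDiff ℝ ∞ a) (z v : Args n p) :
    _root_.fderiv ℝ a z v =
      ∑ k : Fin i.val, dX a ⟨k.val, k.isLt.trans i.isLt⟩ z * v.1 ⟨k.val, k.isLt.trans i.isLt⟩ +
      dTheta a z ⬝ᵥ v.2.1 +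
      ∑ k : Fin i.val, dR a ⟨k.val, by omega⟩ z * v.2.2 ⟨k.val, by omega⟩ := by
  rw [fderiv_apply_eq_sums]
  congr 1
  · congr 1
    symm
    refine Fintype.sum_of_injective (fun k : Fin i.val => (⟨k.val, k.isLt.trans i.isLt⟩ : Fin n))
      (fun k l hkl => by simpa [Fin.ext_iff] using hkl) _ _ (fun k hk => ?_) (fun _ => rfl)
    have hik : i.val ≤ k.val := by
      by_contra! hlt
      exact hk ⟨⟨k.val, hlt⟩, rfl⟩
    rw [dX, h.fderiv_apply_eq_zero ha z, zero_mul]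
    refine ⟨fun l hl => ?_, rfl, fun _ _ => rfl⟩
    have : l ≠ k := fun h => by subst h; omega
    simp [this]
  · symm
    refine Fintype.sum_of_injective (fun k : Fin i.val => (⟨k.val, by omega⟩ : Fin (n + 1)))
      (fun k l hkl => by simpa [Fin.ext_iff] using hkl) _ _ (fun k hk => ?_) (fun _ => rfl)
    have hik : i.val ≤ k.val := by
      by_contra! hlt
      exact hk ⟨⟨k.val, hlt⟩, rfl⟩
    rw [dR, h.fderiv_apply_eq_zero ha z, zero_mul]
    refine ⟨fun _ _ => rfl, rfl, fun l hl => ?_⟩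
    have : l ≠ k := fun h => by subst h; omega
    simp [this]

variable (S : Loop n p)

lemma phi_congr {i : Fin n} {x x' : Fin n → ℝ} (h : ∀ k : Fin n, k.val ≤ i.val → x k = x' k) :
    S.phi i x = S.phi i x' := by
  unfold Loop.phi
  congr 1
  funext j
  exact h _ (Nat.lt_succ_iff.mp j.isLt)

lemma DependsTo.dX {i : ℕ} {a : Args n p → ℝ} (h : DependsTo i a) (k : Fin n) :
    DependsTo i (dX a k) := fun z z' hz => by
  unfold XPassive.dX; rw [h.fderiv z z' hz]

lemma DependsTo.dR {i : ℕ} {a : Args n p → ℝ} (h : DependsTo i a) (k : Fin (n + 1)) :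
    DependsTo i (dR a k) := fun z z' hz => by
  unfold XPassive.dR; rw [h.fderiv z z' hz]

lemma DependsTo.dTheta {i : ℕ} {a : Args n p → ℝ} (h : DependsTo i a) :
    DependsTo i (dTheta a) := fun z z' hz => by
  unfold XPassive.dTheta; rw [h.fderiv z z' hz]

lemma DependsTo.wStep {a : Args n p → ℝ} {i : Fin n} (h : DependsTo i.val a) :
    DependsTo (i.val + 1) (S.wStep a i) := fun z z' hz => by
  unfold Loop.wStep
  rw [phi_congr S fun k hk => hz.1 k (Nat.lt_succ_of_le hk)]
  congr 1
  refine Finset.sum_congr rfl fun j _ => ?_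
  rw [h.dX _ z z' (hz.mono (Nat.le_succ _)),
    phi_congr S fun k hk => hz.1 k ((hk.trans_lt j.isLt).trans (Nat.lt_succ_self _))]

lemma DependsTo.sStep {a : Args n p → ℝ} {i : Fin n} (h : DependsTo i.val a) :
    DependsTo (i.val + 1) (S.sStep a i) := fun z z' hz => by
  unfold Loop.sStep
  rw [h.wStep S z z' hz, h.dTheta z z' (hz.mono (Nat.le_succ _))]

lemma DependsTo.hStep {a : Args n p → ℝ} {i : Fin n} (h : DependsTo i.val a) :
    DependsTo (i.val + 1) (Loop.hStep a i) := fun z z' hz => by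
  unfold Loop.hStep
  rw [h z z' (hz.mono (Nat.le_succ _)), hz.1 i (Nat.lt_succ_self _),
    hz.2.2 i.castSucc (Nat.lt_succ_self _)]

lemma DependsTo.knownTerms {a : Args n p → ℝ} {i : Fin n} (h : DependsTo i.val a) :
    DependsTo (i.val + 1) (Loop.knownTerms a i) := fun z z' hz => by
  unfold Loop.knownTerms
  refine Finset.sum_congr rfl fun j _ => ?_
  rw [h.dX _ z z' (hz.mono (Nat.le_succ _)), h.dR _ z z' (hz.mono (Nat.le_succ _)),
    hz.1 _ (Nat.succ_lt_succ j.isLt), hz.2.2 _ (Nat.succ_lt_succ j.isLt)]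

lemma dependsTo_alpha : ∀ (i : ℕ) (hi : i ≤ n), DependsTo i (S.alpha i hi)
  | 0, _ => fun _ _ _ => rfl
  | i + 1, hi => fun z z' hz => by
    have ha : DependsTo (⟨i, hi⟩ : Fin n).val (S.alpha i (Nat.le_of_succ_le hi)) :=
      dependsTo_alpha i (Nat.le_of_succ_le hi)
    simp only [Loop.alpha]
    rw [ha.sStep S z z' hz, ha.hStep z z' hz, ha.wStep S z z' hz, ha.knownTerms z z' hz, hz.2.1]

lemma dependsTo_h (i : Fin n) : DependsTo (i.val + 1) (S.h i) :=
  DependsTo.hStep (i := i) (dependsTo_alpha S i.val i.isLt.le)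

end Dependence

/-! ### The reference -/

section Reference

variable {n : ℕ} {r : ℝ → ℝ}

lemma AdmissibleReference.continuousOn_refDeriv (hr : AdmissibleReference n r) (hn : 0 < n) {k : ℕ}
    (hk : k < n) : ContinuousOn (refDeriv r k) (Ici 0) :=
  hr.contDiffOn.continuousOn_iteratedDerivWithin (by exact_mod_cast (by omega : k ≤ n - 1))
    (uniqueDiffOn_Ici 0)

/-- Orders below n - 1 come from the C^(n-1) hypothesis, the order n - 1 from piecewise regularity.
Positivity of t turns one-sided derivatives into two-sided ones. -/
lemma AdmissibleReference.exists_hasDerivAt (hr : AdmissibleReference n r) (hn : 0 < n) :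
    ∃ D : Set ℝ, LocFinite D ∧ ∀ t, 0 < t → t ∉ D → ∀ k < n,
      HasDerivAt (refDeriv r k) (refDeriv r (k + 1) t) t := by
  obtain ⟨D, hD, hd, -⟩ := hr.piecewise
  refine ⟨D, hD, fun t ht htD k hk => ?_⟩
  have hdiff : DifferentiableWithinAt ℝ (refDeriv r k) (Ici 0) t := by
    rcases Nat.lt_or_ge k (n - 1) with h | h
    · exact (hr.contDiffOn.differentiableOn_iteratedDerivWithin (by exact_mod_cast h)
        (uniqueDiffOn_Ici 0)) t ht.le
    · obtain rfl : k = n - 1 := by omega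
      exact (hd t ht.le htD).1
  have h1 := hdiff.hasDerivWithinAt.hasDerivAt (Ici_mem_nhds ht)
  refine h1.congr_deriv ?_
  rw [refDeriv, iteratedDerivWithin_succ]
  rfl

lemma AdmissibleReference.exists_bound (hr : AdmissibleReference n r) :
    ∃ M : ℝ, 0 ≤ M ∧ ∀ t, 0 ≤ t → ∀ k ≤ n, |refDeriv r k t| ≤ M := by
  have h : ∀ k : Fin (n + 1), ∃ M : ℝ, ∀ t, 0 ≤ t → |refDeriv r k t| ≤ M := fun k =>
    hr.bounded k (Nat.lt_succ_iff.mp k.isLt)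
  choose M hM using h
  refine ⟨∑ k, |M k|, Finset.sum_nonneg fun _ _ => abs_nonneg _, fun t ht k hk => ?_⟩
  refine ((hM ⟨k, Nat.lt_succ_of_le hk⟩ t ht).trans (le_abs_self _)).trans ?_
  exact Finset.single_le_sum (f := fun k => |M k|) (fun _ _ => abs_nonneg _) (Finset.mem_univ _)

end Reference

/-! ### Error dynamics -/

section ErrorDynamics

variable {n p : ℕ} (S : Loop n p)

/-- The arguments along a trajectory with the last entry of the jet replaced by `0`. -/
def Loop.cargs (x : ℝ → Fin n → ℝ) (th : ℝ → Fin p → ℝ) (t : ℝ) : Args n p :=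
  (x t, th t, fun k => if k.val < n then refDeriv S.r k t else 0)

lemma agreeTo_cargs (x : ℝ → Fin n → ℝ) (th : ℝ → Fin p → ℝ) (t : ℝ) :
    AgreeTo n (S.args x th t) (S.cargs x th t) :=
  ⟨fun _ _ => rfl, rfl, fun k hk => by simp [Loop.args, Loop.cargs, refJet, hk]⟩

variable {S}

/-- The entry r⁽ⁿ⁾ of the jet may jump, so the chain rule is applied along `cargs`, where that entry
is frozen. The last entry of the direction in the conclusion is a formal (n+1)-st derivative; it has
no effect because `a` ignores that coordinate. -/
lemma hasDerivAt_comp_args {a : Args n p → ℝ} (ha : ContDiff ℝ ∞ a) (hda : DependsTo n a)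
    {x : ℝ → Fin n → ℝ} {th : ℝ → Fin p → ℝ} {t : ℝ} {x' : Fin n → ℝ} {th' : Fin p → ℝ}
    (hx : HasDerivAt x x' t) (hth : HasDerivAt th th' t)
    (hr : ∀ k < n, HasDerivAt (refDeriv S.r k) (refDeriv S.r (k + 1) t) t) :
    HasDerivAt (fun τ => a (S.args x th τ))
      (fderiv ℝ a (S.args x th t) (x', th', fun k => refDeriv S.r (k + 1) t)) t := by
  have h1 : (fun τ => a (S.args x th τ)) = a ∘ S.cargs x th :=
    funext fun τ => hda _ _ (agreeTo_cargs S x th τ)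
  have h2 : HasDerivAt (S.cargs x th)
      (x', th', fun k : Fin (n + 1) => if k.val < n then refDeriv S.r (k + 1) t else 0) t := by
    refine hx.prodMk (hth.prodMk (hasDerivAt_pi.mpr fun k => ?_))
    by_cases hk : k.val < n
    · simpa [hk] using hr k hk
    · simpa [hk] using hasDerivAt_const t (0 : ℝ)
  have h3 := ((ha.differentiable (by simp) (S.cargs x th t)).hasFDerivAt).comp_hasDerivAt t h2
  rw [h1]
  refine h3.congr_deriv ?_
  rw [← hda.fderiv _ _ (agreeTo_cargs S x th t)]
  refine hda.fderiv_apply_congr ha _ ⟨fun _ _ => rfl, rfl, fun k hk => by simp [hk]⟩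

lemma alpha_succ (i : Fin n) (z : Args n p) :
    S.alpha (i.val + 1) i.isLt z = (-S.sStep (S.prev i) i z) * S.h i z -
      S.wStep (S.prev i) i z ⬝ᵥ z.2.1 + Loop.knownTerms (S.prev i) i z := rfl

/-- The error coordinate after `i`, or `0` after the last one. -/
def Loop.hNext (S : Loop n p) (i : Fin n) (z : Args n p) : ℝ :=
  if hi : i.val + 1 < n then S.h ⟨i.val + 1, hi⟩ z else 0

/-- The plant in terms of the next error coordinate. -/
lemma plant_succ (i : Fin n) (z : Args n p) :
    Loop.f z.1 (S.uBar z) i = S.hNext i z + S.alpha (i.val + 1) i.isLt z + z.2.2 i.succ := by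
  unfold Loop.f Loop.hNext
  split_ifs with hi
  · simp only [Loop.h, Loop.hStep, Loop.prev]
    have : z.2.2 (Fin.castSucc ⟨i.val + 1, hi⟩) = z.2.2 i.succ := rfl
    rw [this]; ring
  · have hlast : i.val + 1 = n := by omega
    have h1 : S.alpha (i.val + 1) i.isLt z = S.alpha n le_rfl z := by
      congr 1
    have h2 : i.succ = Fin.last n := Fin.ext (by simpa using hlast)
    rw [h1, h2, Loop.uBar]; ring

lemma wStep_dotProduct (a : Args n p → ℝ) (i : Fin n) (z : Args n p) (v : Fin p → ℝ) :
    S.wStep a i z ⬝ᵥ v = S.phi i z.1 ⬝ᵥ v -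
      ∑ k : Fin i.val, dX a ⟨k.val, k.isLt.trans i.isLt⟩ z *
        (S.phi ⟨k.val, k.isLt.trans i.isLt⟩ z.1 ⬝ᵥ v) := by
  simp [Loop.wStep, sub_dotProduct, sum_dotProduct, smul_dotProduct]

/-- The virtual control cancels all known terms and replaces θ by θ̂. What survives is the mismatch
wᵢᵀθ̃ and the drift of αᵢ₋₁ through θ̂, which is deliberately not cancelled but damped. -/
lemma hasDerivAt_h (hφ : ∀ i, ContDiff ℝ ∞ (S.φ i)) (i : Fin n)
    {x : ℝ → Fin n → ℝ} {th : ℝ → Fin p → ℝ} {t : ℝ} {th' : Fin p → ℝ}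
    (hx : HasDerivAt x (S.plantRHS (x t) (S.uBar (S.args x th t))) t) (hth : HasDerivAt th th' t)
    (hr : ∀ k < n, HasDerivAt (refDeriv S.r k) (refDeriv S.r (k + 1) t) t) :
    HasDerivAt (fun τ => S.h i (S.args x th τ))
      (S.hNext i (S.args x th t) -
        S.sStep (S.prev i) i (S.args x th t) * S.h i (S.args x th t) +
        (S.wStep (S.prev i) i (S.args x th t) ⬝ᵥ (S.θ - th t) -
          dTheta (S.prev i) (S.args x th t) ⬝ᵥ th')) t := by
  have hda : DependsTo i.val (S.prev i) := dependsTo_alpha S i.val i.isLt.le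
  have hca : ContDiff ℝ ∞ (S.prev i) := contDiff_alpha hφ i.val i.isLt.le
  set z := S.args x th t with hz
  have h1 := hasDerivAt_comp_args hca (hda.mono i.isLt.le) hx hth hr
  have h2 : HasDerivAt (fun τ => x τ i) _ t := (hasDerivAt_pi.mp hx) i
  have h3 := (h2.sub h1).sub (hr i.val i.isLt)
  refine h3.congr_deriv ?_
  rw [hda.fderiv_apply hca]
  have hz1 : z.1 = x t := rfl
  have hz2 : z.2.1 = th t := rfl
  have hpl : ∀ j : Fin n, S.plantRHS (x t) (S.uBar z) j =
      Loop.f z.1 (S.uBar z) j + S.phi j z.1 ⬝ᵥ S.θ := fun j => rfl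
  have hsh : ∀ k : Fin i.val, Loop.f z.1 (S.uBar z) ⟨k.val, k.isLt.trans i.isLt⟩ =
      z.1 ⟨k.val + 1, lt_of_le_of_lt (Nat.succ_le_of_lt k.isLt) i.isLt⟩ := fun k =>
    dif_pos (lt_of_le_of_lt (Nat.succ_le_of_lt k.isLt) i.isLt)
  simp only [hpl, hsh, plant_succ, alpha_succ, dotProduct_sub, Loop.knownTerms,
    mul_add, Finset.sum_add_distrib]
  rw [wStep_dotProduct _ _ _ S.θ]
  have hr1 : ∀ k : Fin i.val, z.2.2 ⟨k.val + 1, by omega⟩ = refDeriv S.r (k.val + 1) t :=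
    fun k => rfl
  have hr2 : z.2.2 i.succ = refDeriv S.r (i.val + 1) t := rfl
  simp only [hr1, hr2, hz2]
  ring

end ErrorDynamics

/-! ### Quadratic forms and bounds on compact sets -/

section Quadratic

lemma hasDerivAt_dotProduct {m : ℕ} {v w : ℝ → Fin m → ℝ} {v' w' : Fin m → ℝ} {t : ℝ}
    (hv : HasDerivAt v v' t) (hw : HasDerivAt w w' t) :
    HasDerivAt (fun τ => v τ ⬝ᵥ w τ) (v' ⬝ᵥ w t + v t ⬝ᵥ w') t := by
  rw [hasDerivAt_pi] at hv hw
  have := HasDerivAt.fun_sum (u := Finset.univ) fun i _ => (hv i).mul (hw i)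
  refine this.congr_deriv ?_
  simp [dotProduct, Finset.sum_add_distrib]

lemma hasDerivAt_mulVec {k m : ℕ} (A : Matrix (Fin k) (Fin m) ℝ) {v : ℝ → Fin m → ℝ}
    {v' : Fin m → ℝ} {t : ℝ} (hv : HasDerivAt v v' t) :
    HasDerivAt (fun τ => A *ᵥ v τ) (A *ᵥ v') t :=
  (A.mulVecLin.toContinuousLinearMap.hasFDerivAt (x := v t)).comp_hasDerivAt t hv

lemma hasDerivAt_quadratic {m : ℕ} {A : Matrix (Fin m) (Fin m) ℝ} (hA : Aᵀ = A)
    {v : ℝ → Fin m → ℝ} {v' : Fin m → ℝ} {t : ℝ} (hv : HasDerivAt v v' t) :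
    HasDerivAt (fun τ => v τ ⬝ᵥ A *ᵥ v τ) (2 * (A *ᵥ v t ⬝ᵥ v')) t := by
  refine (hasDerivAt_dotProduct hv (hasDerivAt_mulVec A hv)).congr_deriv ?_
  rw [dotProduct_comm v', Matrix.dotProduct_mulVec, ← Matrix.mulVec_transpose, hA]
  ring

lemma continuous_quadratic {m : ℕ} (A : Matrix (Fin m) (Fin m) ℝ) :
    Continuous fun v : Fin m → ℝ => v ⬝ᵥ A *ᵥ v := by fun_prop

lemma posDef_dotProduct_nonneg {m : ℕ} {A : Matrix (Fin m) (Fin m) ℝ} (hA : A.PosDef)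
    (v : Fin m → ℝ) : 0 ≤ v ⬝ᵥ A *ᵥ v := by
  simpa using hA.posSemidef.dotProduct_mulVec_nonneg v

lemma posDef_transpose {m : ℕ} {A : Matrix (Fin m) (Fin m) ℝ} (hA : A.PosDef) : Aᵀ = A := by
  rw [← Matrix.conjTranspose_eq_transpose_of_trivial]
  exact hA.isHermitian

/-- The constant is the minimum of the form over the unit sphere, followed by homogeneity. In
dimension zero the sphere is empty and any constant serves. -/
lemma exists_norm_sq_le_quadratic {m : ℕ} {A : Matrix (Fin m) (Fin m) ℝ} (hA : A.PosDef) :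
    ∃ c : ℝ, 0 < c ∧ ∀ v : Fin m → ℝ, c * ‖v‖ ^ 2 ≤ v ⬝ᵥ A *ᵥ v := by
  rcases (Metric.sphere (0 : Fin m → ℝ) 1).eq_empty_or_nonempty with hempty | hne
  · refine ⟨1, one_pos, fun v => ?_⟩
    have hv : v = 0 := by
      by_contra hv
      have : ‖v‖⁻¹ • v ∈ Metric.sphere (0 : Fin m → ℝ) 1 := by
        simp [norm_smul, norm_ne_zero_iff.mpr hv]
      rw [hempty] at this
      exact this
    simp [hv]
  · obtain ⟨u, hu, hmin⟩ := (isCompact_sphere (0 : Fin m → ℝ) 1).exists_isMinOn hne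
      (continuous_quadratic A).continuousOn
    have hu1 : ‖u‖ = 1 := by simpa using hu
    refine ⟨u ⬝ᵥ A *ᵥ u, ?_, fun v => ?_⟩
    · have hu0 : u ≠ 0 := by
        rintro rfl
        simp at hu1
      simpa using hA.dotProduct_mulVec_pos hu0
    · rcases eq_or_ne v 0 with rfl | hv
      · simp
      · have hv0 : ‖v‖ ≠ 0 := norm_ne_zero_iff.mpr hv
        have h1 := hmin (show ‖v‖⁻¹ • v ∈ Metric.sphere (0 : Fin m → ℝ) 1 by
          simp [norm_smul, hv0])
        simp only [mem_ofPred_eq, Matrix.mulVec_smul, smul_dotProduct, dotProduct_smul,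
          smul_eq_mul] at h1
        calc u ⬝ᵥ A *ᵥ u * ‖v‖ ^ 2
            ≤ ‖v‖⁻¹ * (‖v‖⁻¹ * v ⬝ᵥ A *ᵥ v) * ‖v‖ ^ 2 := by gcongr
          _ = v ⬝ᵥ A *ᵥ v := by field_simp

lemma exists_bound_of_continuous {F : Type*} [NormedAddCommGroup F] [ProperSpace F] {g : F → ℝ}
    (hg : Continuous g) (R : ℝ) : ∃ B : ℝ, 0 ≤ B ∧ ∀ z, ‖z‖ ≤ R → |g z| ≤ B := by
  obtain ⟨B, hB⟩ := (isCompact_closedBall (0 : F) R).exists_bound_of_continuousOn hg.continuousOn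
  exact ⟨max B 0, le_max_right _ _, fun z hz =>
    (hB z (by simpa using hz)).trans (le_max_left _ _)⟩

lemma continuous_eucNorm {m : ℕ} : Continuous (eucNorm (m := m)) := by
  unfold eucNorm; fun_prop

lemma norm_le_eucNorm {m : ℕ} (v : Fin m → ℝ) : ‖v‖ ≤ eucNorm v := by
  refine (pi_norm_le_iff_of_nonneg (eucNorm_nonneg v)).mpr fun j => ?_
  refine Real.abs_le_sqrt ?_
  exact Finset.single_le_sum (f := fun j => v j ^ 2) (fun _ _ => sq_nonneg _) (Finset.mem_univ j)

lemma exists_eucNorm_le (m : ℕ) (R : ℝ) :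
    ∃ B : ℝ, 0 ≤ B ∧ ∀ v : Fin m → ℝ, ‖v‖ ≤ R → eucNorm v ≤ B := by
  obtain ⟨B, h0, hB⟩ := exists_bound_of_continuous (continuous_eucNorm (m := m)) R
  exact ⟨B, h0, fun v hv => (le_abs_self _).trans (hB v hv)⟩

/-- The constant is the squared Frobenius norm. It serves boundedness only; the violation bound
takes the sharp value γ² instead. -/
lemma exists_dotProduct_mulVec_le {k m : ℕ} (A : Matrix (Fin k) (Fin m) ℝ) :
    ∃ G : ℝ, 0 ≤ G ∧ ∀ v, A *ᵥ v ⬝ᵥ A *ᵥ v ≤ G * (v ⬝ᵥ v) := by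
  refine ⟨∑ i, A i ⬝ᵥ A i, Finset.sum_nonneg fun i _ => ?_, fun v => ?_⟩
  · rw [← eucNorm_sq]; positivity
  · rw [Finset.sum_mul]
    refine Finset.sum_le_sum fun i _ => ?_
    have h := abs_dotProduct_le (A i) v
    have h2 : (A i ⬝ᵥ v) ^ 2 ≤ (eucNorm (A i) * eucNorm v) ^ 2 := sq_le_sq' (by
      linarith [neg_le_of_abs_le h]) (le_of_abs_le h)
    rw [mul_pow, eucNorm_sq, eucNorm_sq] at h2
    have h3 : (A *ᵥ v) i = A i ⬝ᵥ v := rfl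
    rw [h3]; nlinarith

end Quadratic

/-! ### Runs of the closed loop -/

variable {n p : ℕ}

/-- The standing assumptions on the data. -/
structure Loop.Regular (S : Loop n p) : Prop where
  pos : 0 < n
  smooth : ∀ i, ContDiff ℝ ∞ (S.φ i)
  ref : AdmissibleReference n S.r
  c_pos : ∀ i, 0 < S.c i
  κ_pos : ∀ i, 0 < S.κ i
  g_pos : ∀ i, 0 < S.g i
  σ_pos : 0 < S.σ
  P_posDef : S.P.PosDef
  lyap : S.A₀ᵀ * S.P + S.P * S.A₀ = -1
  Γ_posDef : S.Γ.PosDef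

/-- The closed loop equations on the open interval `(a, b)` outside `E`, where also the reference
jet is differentiable. -/
structure Loop.Run (S : Loop n p) (E : Set ℝ) (a b : ℝ) (x xh : ℝ → Fin n → ℝ)
    (th : ℝ → Fin p → ℝ) : Prop where
  nonneg : 0 ≤ a
  locFinite : LocFinite E
  cont_x : ContinuousOn x (Icc a b)
  cont_xh : ContinuousOn xh (Icc a b)
  cont_th : ContinuousOn th (Icc a b)
  ode_x : ∀ t ∈ Ioo a b, t ∉ E → HasDerivAt x (S.plantRHS (x t) (S.uBar (S.args x th t))) t
  ode_xh : ∀ t ∈ Ioo a b, t ∉ E →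
    HasDerivAt xh (S.observerRHS (x t) (xh t) (th t) (S.uBar (S.args x th t))) t
  ode_th : ∀ t ∈ Ioo a b, t ∉ E → HasDerivAt th (S.updateRHS (x t) (xh t)) t
  ref : ∀ t ∈ Ioo a b, t ∉ E → ∀ k < n, HasDerivAt (refDeriv S.r k) (refDeriv S.r (k + 1) t) t

lemma LocFinite.union {D E : Set ℝ} (hD : LocFinite D) (hE : LocFinite E) :
    LocFinite (D ∪ E) := fun a b => by
  rw [union_inter_distrib_right]
  exact (hD a b).union (hE a b)

variable {S : Loop n p}

lemma Loop.Run.mono {E : Set ℝ} {a b a' b' : ℝ} {x xh : ℝ → Fin n → ℝ} {th : ℝ → Fin p → ℝ}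
    (h : S.Run E a b x xh th) (ha : a ≤ a') (hb : b' ≤ b) : S.Run E a' b' x xh th where
  nonneg := h.nonneg.trans ha
  locFinite := h.locFinite
  cont_x := h.cont_x.mono (Icc_subset_Icc ha hb)
  cont_xh := h.cont_xh.mono (Icc_subset_Icc ha hb)
  cont_th := h.cont_th.mono (Icc_subset_Icc ha hb)
  ode_x t ht := h.ode_x t (Ioo_subset_Ioo ha hb ht)
  ode_xh t ht := h.ode_xh t (Ioo_subset_Ioo ha hb ht)
  ode_th t ht := h.ode_th t (Ioo_subset_Ioo ha hb ht)
  ref t ht := h.ref t (Ioo_subset_Ioo ha hb ht)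

lemma Loop.IsSolution.exists_run (hS : S.Regular) {I : Set ℝ} {x xh : ℝ → Fin n → ℝ}
    {th : ℝ → Fin p → ℝ} (h : S.IsSolution I x xh th) :
    ∃ E, ∀ a b, 0 ≤ a → Icc a b ⊆ I → S.Run E a b x xh th := by
  obtain ⟨E, hE, hode⟩ := h.eqs
  obtain ⟨D, hD, href⟩ := hS.ref.exists_hasDerivAt hS.pos
  have hI : ∀ {a b}, Icc a b ⊆ I → ∀ t ∈ Ioo a b, I ∈ 𝓝 t := fun hab t ht =>
    mem_of_superset (Icc_mem_nhds ht.1 ht.2) hab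
  refine ⟨E ∪ D, fun a b ha hab => ⟨ha, hE.union hD, h.cont_x.mono hab, h.cont_xh.mono hab,
    h.cont_th.mono hab, fun t ht htE => ?_, fun t ht htE => ?_, fun t ht htE => ?_,
    fun t ht htE k hk => ?_⟩⟩
  · exact (hode t (hab (Ioo_subset_Icc_self ht)) fun h => htE (Or.inl h)).1.hasDerivAt
      (hI hab t ht)
  · exact (hode t (hab (Ioo_subset_Icc_self ht)) fun h => htE (Or.inl h)).2.1.hasDerivAt
      (hI hab t ht)
  · exact (hode t (hab (Ioo_subset_Icc_self ht)) fun h => htE (Or.inl h)).2.2.hasDerivAt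
      (hI hab t ht)
  · exact href t (ha.trans_lt ht.1) (fun h => htE (Or.inr h)) k hk

lemma Loop.Run.continuousOn_args (hS : S.Regular) {E : Set ℝ} {a b : ℝ} {x xh : ℝ → Fin n → ℝ}
    {th : ℝ → Fin p → ℝ} (h : S.Run E a b x xh th) : ContinuousOn (S.cargs x th) (Icc a b) := by
  refine h.cont_x.prodMk (h.cont_th.prodMk (continuousOn_pi.mpr fun k => ?_))
  by_cases hk : k.val < n
  · simp only [hk, if_true]
    exact (hS.ref.continuousOn_refDeriv hS.pos hk).mono fun t ht => h.nonneg.trans ht.1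
  · simp only [hk, if_false]
    exact continuousOn_const

lemma Loop.Run.continuousOn_comp (hS : S.Regular) {E : Set ℝ} {a b : ℝ} {x xh : ℝ → Fin n → ℝ}
    {th : ℝ → Fin p → ℝ} (h : S.Run E a b x xh th) {β : Type*} [TopologicalSpace β]
    {q : Args n p → β} (hq : Continuous q) (hdq : DependsTo n q) :
    ContinuousOn (fun t => q (S.args x th t)) (Icc a b) := by
  have : (fun t => q (S.args x th t)) = q ∘ S.cargs x th :=
    funext fun t => hdq _ _ (agreeTo_cargs S x th t)
  rw [this]
  exact hq.comp_continuousOn (h.continuousOn_args hS)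

/-! ### The Lyapunov function of the identifier -/

/-- `F(x) P e` for the observer error `e`. -/
def Loop.innov (S : Loop n p) (x xh : Fin n → ℝ) : Fin p → ℝ := S.F x *ᵥ (S.P *ᵥ (x - xh))

/-- `eᵀ P e + θ̃ᵀ Γ⁻¹ θ̃`. -/
def Loop.lyapunov (S : Loop n p) (x xh : Fin n → ℝ) (th : Fin p → ℝ) : ℝ :=
  (x - xh) ⬝ᵥ S.P *ᵥ (x - xh) + (S.θ - th) ⬝ᵥ S.Γ⁻¹ *ᵥ (S.θ - th)

lemma updateRHS_eq (x xh : Fin n → ℝ) : S.updateRHS x xh = S.Γ *ᵥ S.innov x xh := by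
  simp [Loop.updateRHS, Loop.innov, Matrix.mulVec_mulVec, Matrix.mul_assoc]

lemma plant_sub_observer (x xh : Fin n → ℝ) (th : Fin p → ℝ) (u : ℝ) :
    S.plantRHS x u - S.observerRHS x xh th u =
      S.A₀ *ᵥ (x - xh) - S.σ • ((S.F x)ᵀ *ᵥ S.innov x xh) + (S.F x)ᵀ *ᵥ (S.θ - th) := by
  have h : xh - x = -(x - xh) := by abel
  simp only [Loop.plantRHS, Loop.observerRHS, Loop.innov, Matrix.mulVec_sub, h, Matrix.mulVec_neg,
    Matrix.sub_mulVec, Matrix.smul_mulVec, ← Matrix.mulVec_mulVec, smul_sub]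
  abel

lemma lyapunov_nonneg (hS : S.Regular) (x xh : Fin n → ℝ) (th : Fin p → ℝ) :
    0 ≤ S.lyapunov x xh th :=
  add_nonneg (posDef_dotProduct_nonneg hS.P_posDef _)
    (posDef_dotProduct_nonneg hS.Γ_posDef.inv _)

lemma continuous_lyapunov (S : Loop n p) :
    Continuous fun z : (Fin n → ℝ) × (Fin n → ℝ) × (Fin p → ℝ) =>
      S.lyapunov z.1 z.2.1 z.2.2 := by
  unfold Loop.lyapunov; fun_prop

lemma dotProduct_lyap (hS : S.Regular) (e : Fin n → ℝ) :
    2 * (S.P *ᵥ e ⬝ᵥ S.A₀ *ᵥ e) = -(e ⬝ᵥ e) := by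
  have h1 : e ⬝ᵥ (S.A₀ᵀ * S.P + S.P * S.A₀) *ᵥ e = -(e ⬝ᵥ e) := by
    rw [hS.lyap, Matrix.neg_mulVec, Matrix.one_mulVec, dotProduct_neg]
  rw [Matrix.add_mulVec, dotProduct_add, ← Matrix.mulVec_mulVec, ← Matrix.mulVec_mulVec,
    Matrix.dotProduct_mulVec, Matrix.vecMul_transpose, Matrix.dotProduct_mulVec e S.P,
    ← Matrix.mulVec_transpose, posDef_transpose hS.P_posDef,
    dotProduct_comm (S.A₀ *ᵥ e)] at h1
  linarith

/-- Since Pe · Fᵀθ̃ = q · θ̃ and Γ⁻¹θ̃ · Γq = q · θ̃, the parameter error drops out. The A₀-part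
yields -|e|² and the σ-injection yields -2σ|q|². -/
lemma hasDerivAt_lyapunov (hS : S.Regular) {x xh : ℝ → Fin n → ℝ} {th : ℝ → Fin p → ℝ} {t u : ℝ}
    (hx : HasDerivAt x (S.plantRHS (x t) u) t)
    (hxh : HasDerivAt xh (S.observerRHS (x t) (xh t) (th t) u) t)
    (hth : HasDerivAt th (S.updateRHS (x t) (xh t)) t) :
    HasDerivAt (fun τ => S.lyapunov (x τ) (xh τ) (th τ))
      (-((x t - xh t) ⬝ᵥ (x t - xh t)) -
        2 * S.σ * (S.innov (x t) (xh t) ⬝ᵥ S.innov (x t) (xh t))) t := by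
  have h1 := hasDerivAt_quadratic (posDef_transpose hS.P_posDef) (hx.sub hxh)
  have h2 := hasDerivAt_quadratic (posDef_transpose hS.Γ_posDef.inv) (hth.const_sub S.θ)
  refine (h1.add h2).congr_deriv ?_
  have hdet : IsUnit S.Γ.det := (Matrix.isUnit_iff_isUnit_det _).mp hS.Γ_posDef.isUnit
  have h3 : S.Γ⁻¹ *ᵥ (S.θ - th t) ⬝ᵥ -S.updateRHS (x t) (xh t) =
      -(S.innov (x t) (xh t) ⬝ᵥ (S.θ - th t)) := by
    rw [updateRHS_eq, dotProduct_neg, Matrix.dotProduct_mulVec, ← Matrix.mulVec_transpose,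
      posDef_transpose hS.Γ_posDef, Matrix.mulVec_mulVec, Matrix.mul_nonsing_inv _ hdet,
      Matrix.one_mulVec, dotProduct_comm]
  have h4 : ∀ v : Fin p → ℝ, S.P *ᵥ (x t - xh t) ⬝ᵥ (S.F (x t))ᵀ *ᵥ v =
      S.innov (x t) (xh t) ⬝ᵥ v := fun v => by
    rw [Matrix.dotProduct_mulVec, Matrix.vecMul_transpose]; rfl
  rw [h3]
  simp only [Pi.sub_apply, plant_sub_observer, dotProduct_add, dotProduct_sub, dotProduct_smul, h4,
    smul_eq_mul, mul_add, mul_sub, dotProduct_lyap hS]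
  ring

lemma Loop.Run.hasDerivAt_lyapunov (hS : S.Regular) {E : Set ℝ} {a b : ℝ} {x xh : ℝ → Fin n → ℝ}
    {th : ℝ → Fin p → ℝ} (h : S.Run E a b x xh th) {t : ℝ} (ht : t ∈ Ioo a b) (htE : t ∉ E) :
    HasDerivAt (fun τ => S.lyapunov (x τ) (xh τ) (th τ))
      (-((x t - xh t) ⬝ᵥ (x t - xh t)) -
        2 * S.σ * (S.innov (x t) (xh t) ⬝ᵥ S.innov (x t) (xh t))) t :=
  XPassive.hasDerivAt_lyapunov hS (h.ode_x t ht htE) (h.ode_xh t ht htE) (h.ode_th t ht htE)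

lemma Loop.Run.continuousOn_lyapunov {E : Set ℝ} {a b : ℝ} {x xh : ℝ → Fin n → ℝ}
    {th : ℝ → Fin p → ℝ} (h : S.Run E a b x xh th) :
    ContinuousOn (fun τ => S.lyapunov (x τ) (xh τ) (th τ)) (Icc a b) :=
  (continuous_lyapunov S).comp_continuousOn (h.cont_x.prodMk (h.cont_xh.prodMk h.cont_th))

lemma dotProduct_self_nonneg_real {m : ℕ} (v : Fin m → ℝ) : 0 ≤ v ⬝ᵥ v := by
  rw [← eucNorm_sq]; positivity

lemma lyapunov_deriv_le (hS : S.Regular) (x xh : Fin n → ℝ) :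
    -((x - xh) ⬝ᵥ (x - xh)) - 2 * S.σ * (S.innov x xh ⬝ᵥ S.innov x xh) ≤ 0 := by
  have h1 := dotProduct_self_nonneg_real (x - xh)
  have h2 := mul_nonneg hS.σ_pos.le (dotProduct_self_nonneg_real (S.innov x xh))
  linarith

lemma Loop.Run.lyapunov_le (hS : S.Regular) {E : Set ℝ} {a b : ℝ} {x xh : ℝ → Fin n → ℝ}
    {th : ℝ → Fin p → ℝ} (h : S.Run E a b x xh th) {t : ℝ} (ht : t ∈ Icc a b) :
    S.lyapunov (x t) (xh t) (th t) ≤ S.lyapunov (x a) (xh a) (th a) :=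
  le_of_deriv_nonpos h.locFinite ht.1 (h.mono le_rfl ht.2).continuousOn_lyapunov
    fun _ hτ hτE => ⟨h.hasDerivAt_lyapunov hS ⟨hτ.1, hτ.2.trans_le ht.2⟩ hτE,
      lyapunov_deriv_le hS _ _⟩

/-! ### One step of the cascade of error coordinates -/

/-- The share of the Lyapunov function that pays for the adaptation in the `i`-th step. -/
def Loop.adaptWeight (S : Loop n p) (G : ℝ) (i : Fin n) : ℝ :=
  if i.val = 0 then 0 else G / (4 * S.σ * S.g i)

lemma adaptWeight_nonneg (hS : S.Regular) {G : ℝ} (hG : 0 ≤ G) (i : Fin n) :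
    0 ≤ S.adaptWeight G i := by
  unfold Loop.adaptWeight
  split_ifs
  · exact le_rfl
  · have := hS.σ_pos
    have := hS.g_pos i
    positivity

/-- Young's inequality: expand |2kyv - w|² ≥ 0 and divide by 2k. -/
lemma cross_term_le {m : ℕ} {k : ℝ} (hk : 0 < k) (y : ℝ) (v w : Fin m → ℝ) :
    2 * y * (v ⬝ᵥ w) ≤ 2 * k * (v ⬝ᵥ v) * y ^ 2 + w ⬝ᵥ w / (2 * k) := by
  have h := dotProduct_self_nonneg_real ((2 * k * y) • v - w)
  simp only [sub_dotProduct, dotProduct_sub, smul_dotProduct, dotProduct_smul, smul_eq_mul,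
    dotProduct_comm w v] at h
  have h2 : 2 * k * (v ⬝ᵥ v) * y ^ 2 + w ⬝ᵥ w / (2 * k) - 2 * y * (v ⬝ᵥ w) =
      (2 * k * y * (2 * k * y * v ⬝ᵥ v - v ⬝ᵥ w) -
        (2 * k * y * v ⬝ᵥ w - w ⬝ᵥ w)) / (2 * k) := by
    field_simp; ring
  have h3 := div_nonneg h (by positivity : 0 ≤ 2 * k)
  linarith

lemma dTheta_prev_zero {i : Fin n} (hi : i.val = 0) (z : Args n p) :
    dTheta (S.prev i) z = 0 := by
  have h : S.prev i = fun _ => 0 := by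
    obtain ⟨k, hk⟩ := i
    simp only at hi
    subst hi
    rfl
  funext j
  simp [dTheta, h]

/-- Young's inequality is used with weights κᵢ and gᵢ, so that its quadratic terms are exactly those
in 2sᵢy². The sign ε serves the upper and the lower bound at once, and `E2` stands for |e|², whose
contribution to the decay is discarded. -/
lemma damping_estimate (hS : S.Regular) (i : Fin n) (z : Args n p) (θt q : Fin p → ℝ) {G τ E2 : ℝ}
    (hτ : θt ⬝ᵥ θt ≤ τ) (hG0 : 0 ≤ G) (hG : S.Γ *ᵥ q ⬝ᵥ S.Γ *ᵥ q ≤ G * (q ⬝ᵥ q)) (hE2 : 0 ≤ E2)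
    {ε : ℝ} (hε : ε ^ 2 = 1) (y : ℝ) :
    2 * y * (-S.sStep (S.prev i) i z * y +
        ε * (S.wStep (S.prev i) i z ⬝ᵥ θt - dTheta (S.prev i) z ⬝ᵥ S.Γ *ᵥ q)) ≤
      -(2 * S.c i) * y ^ 2 + τ / (2 * S.κ i) -
        S.adaptWeight G i * (-E2 - 2 * S.σ * (q ⬝ᵥ q)) := by
  have hκ := hS.κ_pos i
  have hg := hS.g_pos i
  have hσ := hS.σ_pos
  have hβ := adaptWeight_nonneg hS hG0 i
  have h1 := cross_term_le hκ (ε * y) (S.wStep (S.prev i) i z) θt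
  have h3 : θt ⬝ᵥ θt / (2 * S.κ i) ≤ τ / (2 * S.κ i) := by gcongr
  have h4 : -(2 * (ε * y) * (dTheta (S.prev i) z ⬝ᵥ S.Γ *ᵥ q)) ≤
      2 * S.g i * (dTheta (S.prev i) z ⬝ᵥ dTheta (S.prev i) z) * y ^ 2 +
        S.adaptWeight G i * (2 * S.σ * (q ⬝ᵥ q)) := by
    have hqq := dotProduct_self_nonneg_real q
    by_cases hi : i.val = 0
    · rw [dTheta_prev_zero hi]
      simp only [zero_dotProduct, mul_zero, neg_zero, zero_mul, zero_add]
      positivity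
    · have h2 := cross_term_le hg (-(ε * y)) (dTheta (S.prev i) z) (S.Γ *ᵥ q)
      -- The weight G/(4σg) is chosen so that 2σ times it equals the Young constant G/(2g).
      have h5 : S.Γ *ᵥ q ⬝ᵥ S.Γ *ᵥ q / (2 * S.g i) ≤ S.adaptWeight G i * (2 * S.σ * (q ⬝ᵥ q)) := by
        rw [Loop.adaptWeight, if_neg hi]
        calc S.Γ *ᵥ q ⬝ᵥ S.Γ *ᵥ q / (2 * S.g i) ≤ G * (q ⬝ᵥ q) / (2 * S.g i) := by gcongr
          _ = _ := by field_simp; ring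
      have h6 : (-(ε * y)) ^ 2 = y ^ 2 := by rw [neg_sq, mul_pow, hε, one_mul]
      rw [h6] at h2
      linarith
  have h6 : (ε * y) ^ 2 = y ^ 2 := by rw [mul_pow, hε, one_mul]
  rw [h6] at h1
  have h7 : 0 ≤ S.adaptWeight G i * E2 := mul_nonneg hβ hE2
  rw [Loop.sStep, eucNorm_sq, eucNorm_sq]
  nlinarith

lemma Loop.Run.continuousOn_h (hS : S.Regular) {E : Set ℝ} {a b : ℝ} {x xh : ℝ → Fin n → ℝ}
    {th : ℝ → Fin p → ℝ} (h : S.Run E a b x xh th) (i : Fin n) :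
    ContinuousOn (fun t => S.h i (S.args x th t)) (Icc a b) :=
  h.continuousOn_comp hS (contDiff_h hS.smooth i).continuous ((dependsTo_h S i).mono i.isLt)

lemma le_sStep (hS : S.Regular) (a : Args n p → ℝ) (i : Fin n) (z : Args n p) :
    S.c i ≤ S.sStep a i z := by
  have h1 := mul_nonneg (hS.κ_pos i).le (sq_nonneg (eucNorm (S.wStep a i z)))
  have h2 := mul_nonneg (hS.g_pos i).le (sq_nonneg (eucNorm (dTheta a z)))
  unfold Loop.sStep
  linarith

/-- The bound on `± hᵢ` by the bound on the next coordinate, the initial value and the energy of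
the parameter error and of the adaptation. -/
lemma Loop.Run.error_step (hS : S.Regular) {E : Set ℝ} {a b : ℝ} {x xh : ℝ → Fin n → ℝ}
    {th : ℝ → Fin p → ℝ} (h : S.Run E a b x xh th) (hab : a ≤ b) (i : Fin n) {G τ M ε : ℝ}
    (hG0 : 0 ≤ G) (hG : ∀ q, S.Γ *ᵥ q ⬝ᵥ S.Γ *ᵥ q ≤ G * (q ⬝ᵥ q))
    (hτ : ∀ t ∈ Icc a b, (S.θ - th t) ⬝ᵥ (S.θ - th t) ≤ τ) (hε : ε ^ 2 = 1) (hM : 0 ≤ M)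
    {U Un : ℝ → ℝ} (hU : ContinuousOn U (Icc a b))
    (hUd : ∀ t ∈ Ioo a b, HasDerivAt U (-S.c i * U t + Un t) t) (hU0 : ∀ t ∈ Ioo a b, 0 ≤ U t)
    (hnext : ∀ t ∈ Ioo a b, ε * S.hNext i (S.args x th t) ≤ Un t + M) :
    ε * S.h i (S.args x th b) ≤ U b + M / S.c i +
      Real.sqrt (max (ε * S.h i (S.args x th a) - U a - M / S.c i) 0 ^ 2 +
        S.adaptWeight G i * S.lyapunov (x a) (xh a) (th a) +
        τ / (2 * S.κ i) / (2 * S.c i)) := by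
  have hβ := adaptWeight_nonneg hS hG0 i
  have hτ0 : 0 ≤ τ := (dotProduct_self_nonneg_real _).trans (hτ a (left_mem_Icc.mpr hab))
  exact damped_bound (h := fun t => ε * S.h i (S.args x th t))
    (hn := fun t => ε * S.hNext i (S.args x th t))
    (s := fun t => S.sStep (S.prev i) i (S.args x th t))
    (δ := fun t => ε * (S.wStep (S.prev i) i (S.args x th t) ⬝ᵥ (S.θ - th t) -
          dTheta (S.prev i) (S.args x th t) ⬝ᵥ S.Γ *ᵥ S.innov (x t) (xh t)))
    (V := fun t => S.adaptWeight G i * S.lyapunov (x t) (xh t) (th t))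
    (V' := fun t => S.adaptWeight G i * (-((x t - xh t) ⬝ᵥ (x t - xh t)) -
        2 * S.σ * (S.innov (x t) (xh t) ⬝ᵥ S.innov (x t) (xh t))))
    h.locFinite hab (hS.c_pos i) hM (by have := hS.κ_pos i; positivity)
    (continuousOn_const.mul (h.continuousOn_h hS i)) hU
    (continuousOn_const.mul h.continuousOn_lyapunov) hUd hU0 hnext
    (fun t _ => mul_nonneg hβ (lyapunov_nonneg hS _ _ _))
    (fun t ht htE => ⟨by
      have h1 := (hasDerivAt_h hS.smooth i (h.ode_x t ht htE) (h.ode_th t ht htE)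
        (h.ref t ht htE)).const_mul ε
      rw [updateRHS_eq] at h1
      refine h1.congr_deriv ?_
      ring, (h.hasDerivAt_lyapunov hS ht htE).const_mul _,
      mul_nonpos_of_nonneg_of_nonpos hβ (lyapunov_deriv_le hS _ _), le_sStep hS _ _ _,
      fun y => damping_estimate hS i _ _ _ (hτ t (Ioo_subset_Icc_self ht)) hG0 (hG _)
        (dotProduct_self_nonneg_real _) hε y⟩)

/-- No separate base case: at the last index the premise is vacuous. -/
lemma backward_induction {Q : Fin n → Prop}
    (hQ : ∀ i : Fin n, (∀ hi : i.val + 1 < n, Q ⟨i.val + 1, hi⟩) → Q i) : ∀ i, Q i := by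
  have key : ∀ d : ℕ, ∀ i : Fin n, i.val + d + 1 = n → Q i := by
    intro d
    induction d with
    | zero => exact fun i hi => hQ i fun h => by omega
    | succ d ih => exact fun i hi => hQ i fun h => ih _ (by simp only; omega)
  exact fun i => key (n - 1 - i.val) i (by omega)

/-! ### Uniform bounds -/

/-- The change of coordinates is triangular: x_j = h_j + α_{j-1} + r^(j-1), where α_{j-1} involves
only earlier components of x. So the components are bounded in increasing order. -/
lemma exists_state_bound (hS : S.Regular) (C : ℝ) :
    ∃ B : ℝ, 0 ≤ B ∧ ∀ z : Args n p, (∀ i, |S.h i z| ≤ C) → ‖z.2.1‖ ≤ C → ‖z.2.2‖ ≤ C →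
      ‖z.1‖ ≤ B := by
  have key : ∀ k : ℕ, ∃ B : ℝ, 0 ≤ B ∧ ∀ z : Args n p, (∀ i, |S.h i z| ≤ C) → ‖z.2.1‖ ≤ C →
      ‖z.2.2‖ ≤ C → ∀ j : Fin n, j.val < k → |z.1 j| ≤ B := by
    intro k
    induction k with
    | zero => exact ⟨0, le_rfl, fun _ _ _ _ j hj => absurd hj (Nat.not_lt_zero _)⟩
    | succ k ih =>
      obtain ⟨B, hB0, hB⟩ := ih
      by_cases hk : k < n
      · obtain ⟨A, hA0, hA⟩ := exists_bound_of_continuous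
          (contDiff_alpha hS.smooth k hk.le).continuous (max B C)
        refine ⟨max B (C + A + C), le_max_of_le_left hB0, fun z hh h1 h2 j hj => ?_⟩
        have hC : 0 ≤ C := (norm_nonneg _).trans h1
        rcases Nat.lt_succ_iff_lt_or_eq.mp hj with hlt | heq
        · exact (hB z hh h1 h2 j hlt).trans (le_max_left _ _)
        · refine le_trans ?_ (le_max_right _ _)
          -- Zeroing the components not yet bounded leaves α unchanged and puts its argument in a
          -- fixed ball.
          set z' : Args n p := (fun l => if l.val < k then z.1 l else 0, z.2.1, z.2.2) with hz'
          have hzz : S.alpha k hk.le z = S.alpha k hk.le z' :=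
            dependsTo_alpha S k hk.le _ _ ⟨fun l hl => by simp [hz', hl], rfl, fun _ _ => rfl⟩
          have hz'n : ‖z'‖ ≤ max B C := by
            refine max_le ?_ (max_le (h1.trans (le_max_right _ _)) (h2.trans (le_max_right _ _)))
            refine (pi_norm_le_iff_of_nonneg (le_max_of_le_left hB0)).mpr fun l => ?_
            by_cases hl : l.val < k
            · simpa [hz', hl] using Or.inl (hB z hh h1 h2 l hl)
            · simp [hz', hl, hB0]
          have h3 := hA z' hz'n
          have h4 := hh j
          have h5 : S.h j z = z.1 j - S.alpha k hk.le z - z.2.2 j.castSucc := by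
            obtain ⟨l, hl⟩ := j
            simp only at heq
            subst heq
            rfl
          have h6 : |z.2.2 j.castSucc| ≤ C := (norm_le_pi_norm z.2.2 _).trans h2
          have h7 : z.1 j = S.h j z + S.alpha k hk.le z' + z.2.2 j.castSucc := by
            rw [h5, hzz]; ring
          rw [h7]
          exact (abs_add_three _ _ _).trans (add_le_add (add_le_add h4 h3) h6)
      · exact ⟨B, hB0, fun z hh h1 h2 j _ => hB z hh h1 h2 j (by omega)⟩
  obtain ⟨B, hB0, hB⟩ := key n
  exact ⟨B, hB0, fun z hh h1 h2 => (pi_norm_le_iff_of_nonneg hB0).mpr fun j =>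
    hB z hh h1 h2 j j.isLt⟩

lemma norm_refJet_le {M t : ℝ} (hM0 : 0 ≤ M) (hM : ∀ k ≤ n, |refDeriv S.r k t| ≤ M) :
    ‖refJet n S.r t‖ ≤ M :=
  (pi_norm_le_iff_of_nonneg hM0).mpr fun k => hM k (Nat.lt_succ_iff.mp k.isLt)

/-- Monotonicity of V needs no bound on the plant state, so the constant depends on the initial
radius alone, not on the interval or on the run. -/
lemma exists_identifier_bound (hS : S.Regular) (R : ℝ) :
    ∃ B : ℝ, 0 ≤ B ∧ ∀ (E : Set ℝ) (a b : ℝ) (x xh : ℝ → Fin n → ℝ) (th : ℝ → Fin p → ℝ),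
      S.Run E a b x xh th → ‖x a‖ ≤ R → ‖xh a‖ ≤ R → ‖th a‖ ≤ R → ∀ t ∈ Icc a b,
        ‖x t - xh t‖ ≤ B ∧ ‖th t‖ ≤ B ∧ (S.θ - th t) ⬝ᵥ (S.θ - th t) ≤ B ∧
          S.lyapunov (x a) (xh a) (th a) ≤ B := by
  obtain ⟨V, hV0, hV⟩ := exists_bound_of_continuous (continuous_lyapunov S) R
  obtain ⟨cP, hcP, hP⟩ := exists_norm_sq_le_quadratic hS.P_posDef
  obtain ⟨cΓ, hcΓ, hΓ⟩ := exists_norm_sq_le_quadratic hS.Γ_posDef.inv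
  obtain ⟨T, hT0, hT⟩ := exists_bound_of_continuous
    (g := fun v : Fin p → ℝ => v ⬝ᵥ v) (by fun_prop) (Real.sqrt (V / cΓ))
  refine ⟨Real.sqrt (V / cP) + (‖S.θ‖ + Real.sqrt (V / cΓ)) + T + V, by positivity,
    fun E a b x xh th h hx hxh hth t ht => ?_⟩
  have hVa : S.lyapunov (x a) (xh a) (th a) ≤ V :=
    (le_abs_self _).trans (hV (x a, xh a, th a) (max_le hx (max_le hxh hth)))
  have hVt := (h.lyapunov_le hS ht).trans hVa
  have e1 := posDef_dotProduct_nonneg hS.P_posDef (x t - xh t)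
  have e2 := posDef_dotProduct_nonneg hS.Γ_posDef.inv (S.θ - th t)
  unfold Loop.lyapunov at hVt
  have h1 : ‖x t - xh t‖ ≤ Real.sqrt (V / cP) := by
    refine Real.le_sqrt_of_sq_le ?_
    rw [le_div_iff₀ hcP]
    linarith [hP (x t - xh t)]
  have h2 : ‖S.θ - th t‖ ≤ Real.sqrt (V / cΓ) := by
    refine Real.le_sqrt_of_sq_le ?_
    rw [le_div_iff₀ hcΓ]
    linarith [hΓ (S.θ - th t)]
  have h3 : ‖th t‖ ≤ ‖S.θ‖ + Real.sqrt (V / cΓ) := by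
    have : th t = S.θ - (S.θ - th t) := by abel
    rw [this]
    exact (norm_sub_le _ _).trans (by gcongr)
  have h4 := (le_abs_self _).trans (hT _ h2)
  have h5 := Real.sqrt_nonneg (V / cP)
  have h6 := Real.sqrt_nonneg (V / cΓ)
  have h7 := norm_nonneg S.θ
  exact ⟨by linarith, by linarith, by linarith, by linarith⟩

/-- The cascade step with zero comparison function and both signs, from the last coordinate
backwards. The damping dominates wᵢ and ∂αᵢ₋₁/∂θ̂ however large they are, so no bound on x enters.
-/
lemma exists_error_bound (hS : S.Regular) (R : ℝ) (i : Fin n) :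
    ∃ B : ℝ, 0 ≤ B ∧ ∀ (E : Set ℝ) (a b : ℝ) (x xh : ℝ → Fin n → ℝ) (th : ℝ → Fin p → ℝ),
      S.Run E a b x xh th → ‖x a‖ ≤ R → ‖xh a‖ ≤ R → ‖th a‖ ≤ R → ∀ t ∈ Icc a b,
        |S.h i (S.args x th t)| ≤ B := by
  obtain ⟨C, hC0, hC⟩ := exists_identifier_bound hS R
  obtain ⟨Mr, hMr0, hMr⟩ := hS.ref.exists_bound
  obtain ⟨G, hG0, hG⟩ := exists_dotProduct_mulVec_le S.Γ
  refine backward_induction (Q := fun i => ∃ B : ℝ, 0 ≤ B ∧ ∀ (E : Set ℝ) (a b : ℝ)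
    (x xh : ℝ → Fin n → ℝ) (th : ℝ → Fin p → ℝ),
      S.Run E a b x xh th → ‖x a‖ ≤ R → ‖xh a‖ ≤ R → ‖th a‖ ≤ R → ∀ t ∈ Icc a b,
        |S.h i (S.args x th t)| ≤ B) (fun i ih => ?_) i
  have hnext : ∃ M : ℝ, 0 ≤ M ∧ ∀ (E : Set ℝ) (a b : ℝ) (x xh : ℝ → Fin n → ℝ)
      (th : ℝ → Fin p → ℝ), S.Run E a b x xh th → ‖x a‖ ≤ R → ‖xh a‖ ≤ R → ‖th a‖ ≤ R →
      ∀ t ∈ Icc a b, |S.hNext i (S.args x th t)| ≤ M := by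
    by_cases hi : i.val + 1 < n
    · simpa [Loop.hNext, hi] using ih hi
    · exact ⟨0, le_rfl, by simp [Loop.hNext, hi]⟩
  obtain ⟨M, hM0, hM⟩ := hnext
  obtain ⟨H, hH0, hH⟩ := exists_bound_of_continuous (contDiff_h hS.smooth i).continuous
    (max R Mr)
  have hβ := adaptWeight_nonneg hS hG0 i
  have hc := hS.c_pos i
  have hκ := hS.κ_pos i
  refine ⟨M / S.c i + Real.sqrt (H ^ 2 + S.adaptWeight G i * C + C / (2 * S.κ i) / (2 * S.c i)),
    by positivity, fun E a b x xh th h hx hxh hth t ht => ?_⟩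
  have hrun := h.mono le_rfl ht.2
  have hHa := hH (S.args x th a) (max_le (hx.trans (le_max_left _ _))
    (max_le (hth.trans (le_max_left _ _))
      ((norm_refJet_le hMr0 (hMr a h.nonneg)).trans (le_max_right _ _))))
  have side : ∀ ε : ℝ, |ε| = 1 → ε * S.h i (S.args x th t) ≤ M / S.c i +
      Real.sqrt (H ^ 2 + S.adaptWeight G i * C + C / (2 * S.κ i) / (2 * S.c i)) := by
    intro ε hε
    have key := hrun.error_step hS ht.1 i (U := fun _ => 0) (Un := fun _ => 0) (M := M) (ε := ε)
      (τ := C) hG0 hG (fun τ hτ => (hC E a t x xh th hrun hx hxh hth τ hτ).2.2.1)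
      (by rw [← sq_abs, hε, one_pow]) hM0 continuousOn_const
      (fun τ _ => by simpa using hasDerivAt_const τ (0 : ℝ)) (fun _ _ => le_rfl)
      (fun τ hτ => by
        have h1 := hM E a t x xh th hrun hx hxh hth τ (Ioo_subset_Icc_self hτ)
        have h2 := le_abs_self (ε * S.hNext i (S.args x th τ))
        rw [abs_mul, hε, one_mul] at h2
        linarith)
    rw [zero_add] at key
    refine key.trans ?_
    gcongr
    · refine max_le ?_ hH0
      have h2 := le_abs_self (ε * S.h i (S.args x th a))
      rw [abs_mul, hε, one_mul] at h2
      have : 0 ≤ M / S.c i := by positivity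
      linarith
    · exact (hC E a t x xh th hrun hx hxh hth a ⟨le_rfl, ht.1⟩).2.2.2
  rw [abs_le]
  have h1 := side 1 (by simp)
  have h2 := side (-1) (by simp)
  constructor <;> linarith

lemma exists_run_bound (hS : S.Regular) (R : ℝ) :
    ∃ B : ℝ, 0 ≤ B ∧ ∀ (E : Set ℝ) (a b : ℝ) (x xh : ℝ → Fin n → ℝ) (th : ℝ → Fin p → ℝ),
      S.Run E a b x xh th → ‖x a‖ ≤ R → ‖xh a‖ ≤ R → ‖th a‖ ≤ R → ∀ t ∈ Icc a b,
        ‖x t‖ ≤ B ∧ ‖xh t‖ ≤ B ∧ ‖th t‖ ≤ B ∧ ‖S.args x th t‖ ≤ B := by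
  obtain ⟨C, hC0, hC⟩ := exists_identifier_bound hS R
  obtain ⟨Mr, hMr0, hMr⟩ := hS.ref.exists_bound
  choose H hH0 hH using exists_error_bound hS R
  set K := C + Mr + ∑ i, H i with hK
  have hHs : 0 ≤ ∑ i, H i := Finset.sum_nonneg fun i _ => hH0 i
  obtain ⟨X, hX0, hX⟩ := exists_state_bound hS K
  refine ⟨X + K, by positivity, fun E a b x xh th h hx hxh hth t ht => ?_⟩
  obtain ⟨h1, h2, -, -⟩ := hC E a b x xh th h hx hxh hth t ht
  have h3 := norm_refJet_le (S := S) hMr0 (hMr t (h.nonneg.trans ht.1))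
  have hx' : ‖x t‖ ≤ X := by
    refine hX (S.args x th t) (fun i => ?_) (h2.trans (by linarith)) (h3.trans (by linarith))
    refine (hH i E a b x xh th h hx hxh hth t ht).trans ?_
    have := Finset.single_le_sum (f := H) (fun i _ => hH0 i) (Finset.mem_univ i)
    linarith
  have hxh' : ‖xh t‖ ≤ X + C := by
    have : xh t = x t - (x t - xh t) := by abel
    rw [this]
    exact (norm_sub_le _ _).trans (add_le_add hx' h1)
  exact ⟨by linarith, by linarith, by linarith,
    max_le (hx'.trans (by linarith)) (max_le (h2.trans (by linarith)) (h3.trans (by linarith)))⟩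

/-! ### Continuity of the closed-loop maps and boundedness of all signals -/

lemma continuous_phi (hS : S.Regular) (i : Fin n) : Continuous (S.phi i) :=
  (contDiff_phi hS.smooth i).continuous

lemma contDiff_F (hS : S.Regular) (j : Fin p) (i : Fin n) :
    ContDiff ℝ ∞ fun x => S.F x j i :=
  contDiff_pi.mp (contDiff_phi hS.smooth i) j

lemma continuous_F (hS : S.Regular) : Continuous S.F :=
  continuous_matrix fun j i => (contDiff_F hS j i).continuous

lemma continuous_innov (hS : S.Regular) :
    Continuous fun z : (Fin n → ℝ) × (Fin n → ℝ) => S.innov z.1 z.2 := by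
  have := continuous_F hS
  unfold Loop.innov
  fun_prop

lemma continuous_updateRHS (hS : S.Regular) :
    Continuous fun z : (Fin n → ℝ) × (Fin n → ℝ) => S.updateRHS z.1 z.2 := by
  simp only [updateRHS_eq]
  exact continuous_const.matrix_mulVec (continuous_innov hS)

lemma continuous_uBar (hS : S.Regular) : Continuous S.uBar :=
  (contDiff_alpha hS.smooth n le_rfl).continuous.add (contDiff_jet _).continuous

theorem globally_bounded (hS : S.Regular) (R : ℝ) : ∃ B : ℝ, ∀ t₀ : ℝ, 0 ≤ t₀ →
    ∀ (x xh : ℝ → Fin n → ℝ) (th : ℝ → Fin p → ℝ), S.IsSolution (Ici t₀) x xh th →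
      eucNorm (x t₀) ≤ R → eucNorm (xh t₀) ≤ R → eucNorm (th t₀) ≤ R → ∀ t, t₀ ≤ t →
        eucNorm (x t) ≤ B ∧ eucNorm (xh t) ≤ B ∧ eucNorm (th t) ≤ B ∧
        eucNorm (fun i => S.h i (S.args x th t)) ≤ B ∧
        eucNorm (S.updateRHS (x t) (xh t)) ≤ B ∧ |S.uBar (S.args x th t)| ≤ B := by
  obtain ⟨B, hB0, hB⟩ := exists_run_bound hS R
  obtain ⟨B1, hB10, hB1⟩ := exists_eucNorm_le n B
  obtain ⟨B2, hB20, hB2⟩ := exists_eucNorm_le p B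
  obtain ⟨B3, hB30, hB3⟩ := exists_bound_of_continuous (g := fun z => eucNorm fun i => S.h i z)
    (continuous_eucNorm.comp (continuous_pi fun i => (contDiff_h hS.smooth i).continuous)) B
  obtain ⟨B4, hB40, hB4⟩ := exists_bound_of_continuous
    (continuous_eucNorm.comp (continuous_updateRHS hS)) B
  obtain ⟨B5, hB50, hB5⟩ := exists_bound_of_continuous (continuous_uBar hS) B
  refine ⟨B1 + B2 + B3 + B4 + B5, fun t₀ ht₀ x xh th hsol hx hxh hth t ht => ?_⟩
  obtain ⟨E, hE⟩ := hsol.exists_run hS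
  obtain ⟨h1, h2, h3, h4⟩ := hB E t₀ t x xh th (hE t₀ t ht₀ Icc_subset_Ici_self)
    ((norm_le_eucNorm _).trans hx) ((norm_le_eucNorm _).trans hxh) ((norm_le_eucNorm _).trans hth)
    t ⟨ht, le_rfl⟩
  refine ⟨?_, ?_, ?_, ?_, ?_, ?_⟩
  · linarith [hB1 _ h1]
  · linarith [hB1 _ h2]
  · linarith [hB2 _ h3]
  · linarith [(le_abs_self _).trans (hB3 _ h4)]
  · have h5 := (le_abs_self _).trans (hB4 (x t, xh t) (max_le h1 h2))
    simp only [Function.comp] at h5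
    linarith
  · linarith [hB5 _ h4]

/-! ### Ordinary differential equations on a half-line -/

section HalfLine

variable {F : Type*} [NormedAddCommGroup F] [NormedSpace ℝ F]

/-- A curve whose derivative agrees off a locally finite set with a continuous function has that
right derivative everywhere. -/
lemma hasDerivWithinAt_Ici_of_locFinite {E : Set ℝ} (hE : LocFinite E) {a b : ℝ} {y f : ℝ → F}
    (hy : ContinuousOn y (Icc a b)) (hf : ContinuousOn f (Icc a b))
    (hd : ∀ t ∈ Ioo a b, t ∉ E → HasDerivAt y (f t) t) :
    ∀ t ∈ Ico a b, HasDerivWithinAt y (f t) (Ici t) t := by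
  intro t ht
  have hs : Ioo t b \ E ∈ 𝓝[>] t := by
    have h1 : ((E ∩ Icc t b) \ {t})ᶜ ∈ 𝓝 t :=
      ((hE t b).subset sdiff_subset).isClosed.isOpen_compl.mem_nhds fun h => h.2 rfl
    filter_upwards [mem_nhdsWithin_of_mem_nhds h1, Ioo_mem_nhdsGT ht.2] with τ hτ1 hτ2
    exact ⟨hτ2, fun hτE => hτ1 ⟨⟨hτE, hτ2.1.le, hτ2.2.le⟩, ne_of_gt hτ2.1⟩⟩
  have hd' : ∀ τ ∈ Ioo t b \ E, HasDerivAt y (f τ) τ := fun τ hτ =>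
    hd τ ⟨ht.1.trans_lt hτ.1.1, hτ.1.2⟩ hτ.2
  have hsub : Ioo t b \ E ⊆ Icc a b := fun τ hτ => ⟨ht.1.trans hτ.1.1.le, hτ.1.2.le⟩
  -- Exceptional times do not accumulate, so just to the right of t the derivative exists and tends
  -- to f(t); this limit is the right derivative at t.
  refine hasDerivWithinAt_Ici_of_tendsto_deriv
    (fun τ hτ => (hd' τ hτ).differentiableAt.differentiableWithinAt)
    ((hy t ⟨ht.1, ht.2.le⟩).mono hsub) hs ?_
  have h2 : Tendsto f (𝓝[>] t) (𝓝 (f t)) := by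
    refine (hf t ⟨ht.1, ht.2.le⟩).mono_left ?_
    refine le_inf nhdsWithin_le_nhds (le_principal_iff.mpr ?_)
    exact mem_of_superset hs hsub
  refine h2.congr' ?_
  filter_upwards [hs] with τ hτ
  exact (hd' τ hτ).deriv.symm

/-- Global existence for a bounded, globally Lipschitz time-dependent vector field. -/
lemma exists_solution_of_bounded_lipschitz [CompleteSpace F] {H : ℝ → F → F} {a : ℝ}
    {K L : NNReal} (hK : ∀ t, a ≤ t → LipschitzWith K (H t)) (hL : ∀ t, a ≤ t → ∀ y, ‖H t y‖ ≤ L)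
    (hc : ∀ y, ContinuousOn (fun t => H t y) (Ici a)) (y₀ : F) :
    ∃ y : ℝ → F, y a = y₀ ∧ ContinuousOn y (Ici a) ∧
      ∀ t ∈ Ioi a, HasDerivAt y (H t (y t)) t := by
  have hloc : ∀ N : ℕ, ∃ y : ℝ → F, y a = y₀ ∧
      ∀ t ∈ Icc a (a + N), HasDerivWithinAt y (H t (y t)) (Icc a (a + N)) t := by
    intro N
    have hN : a ≤ a + N := by simp
    -- A field bounded by L cannot leave the ball of radius L·N within time N, so one application
    -- covers the whole interval.
    have hPL : IsPicardLindelof H (tmin := a) (tmax := a + N) ⟨a, left_mem_Icc.mpr hN⟩ y₀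
        (L * N) 0 L K :=
      { lipschitzOnWith := fun t ht => (hK t ht.1).lipschitzOnWith
        continuousOn := fun y _ => (hc y).mono fun t ht => ht.1
        norm_le := fun t ht y _ => hL t ht.1 y
        mul_max_le := by simp }
    exact hPL.exists_eq_forall_mem_Icc_hasDerivWithinAt₀
  choose Y hY0 hYd using hloc
  have hright : ∀ N : ℕ, ∀ t ∈ Ico a (a + N), HasDerivWithinAt (Y N) (H t (Y N t)) (Ici t) t :=
    fun N t ht => ((hYd N t ⟨ht.1, ht.2.le⟩).mono (Icc_subset_Icc_left ht.1)).mono_of_mem_nhdsWithin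
      (Icc_mem_nhdsGE ht.2)
  have hagree : ∀ M N : ℕ, M ≤ N → EqOn (Y M) (Y N) (Icc a (a + M)) := by
    intro M N hMN
    have hMN' : (M : ℝ) ≤ N := by exact_mod_cast hMN
    refine ODE_solution_unique_of_mem_Icc_right (v := H) (s := fun _ => univ) (K := K)
      (fun t ht => (hK t ht.1).lipschitzOnWith) (fun t ht => (hYd M t ht).continuousWithinAt)
      (hright M) (fun _ _ => mem_univ _)
      (fun t ht => (hYd N t ⟨ht.1, by linarith [ht.2]⟩).continuousWithinAt.mono
        (Icc_subset_Icc_right (by linarith)))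
      (fun t ht => hright N t ⟨ht.1, by linarith [ht.2]⟩) (fun _ _ => mem_univ _) ?_
    rw [hY0, hY0]
  -- The extra 1 keeps t strictly below the right end of the interval of the solution used there.
  set y : ℝ → F := fun t => Y (⌈t - a⌉₊ + 1) t with hy
  have hyN : ∀ N : ℕ, EqOn y (Y N) (Ico a (a + N)) := by
    intro N t ht
    have h1 : t - a ≤ ⌈t - a⌉₊ := Nat.le_ceil _
    rcases le_total (⌈t - a⌉₊ + 1) N with h | h
    · exact hagree _ _ h ⟨ht.1, by push_cast; linarith⟩
    · exact (hagree _ _ h ⟨ht.1, ht.2.le⟩).symm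
  have hex : ∀ t ∈ Ici a, ∃ N : ℕ, t < a + N := fun t _ => by
    obtain ⟨N, hN⟩ := exists_nat_gt (t - a)
    exact ⟨N, by linarith⟩
  refine ⟨y, ?_, fun t ht => ?_, fun t ht => ?_⟩
  · rw [hyN 1 ⟨le_rfl, by simp⟩, hY0]
  · obtain ⟨N, hN⟩ := hex t ht
    have h1 : ContinuousWithinAt (Y N) (Ici a) t :=
      (hYd N t ⟨ht, hN.le⟩).continuousWithinAt.mono_of_mem_nhdsWithin
        (mem_nhdsWithin_iff_exists_mem_nhds_inter.mpr
          ⟨Iio (a + N), Iio_mem_nhds hN, fun τ hτ => ⟨hτ.2, le_of_lt hτ.1⟩⟩)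
    refine h1.congr_of_eventuallyEq ?_ (hyN N ⟨ht, hN⟩)
    exact mem_nhdsWithin_iff_exists_mem_nhds_inter.mpr
          ⟨Iio (a + N), Iio_mem_nhds hN, fun τ hτ => hyN N ⟨hτ.2, hτ.1⟩⟩
  · obtain ⟨N, hN⟩ := hex t (Ioi_subset_Ici_self ht)
    have h1 := (hYd N t ⟨le_of_lt ht, hN.le⟩).hasDerivAt (Icc_mem_nhds ht hN)
    rw [← hyN N ⟨le_of_lt ht, hN⟩] at h1
    refine h1.congr_of_eventuallyEq ?_
    filter_upwards [Ioo_mem_nhds ht hN] with τ hτ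
    exact hyN N ⟨hτ.1.le, hτ.2⟩

lemma exists_lipschitzOnWith_closedBall {F' : Type*} [NormedAddCommGroup F'] [NormedSpace ℝ F']
    [ProperSpace F] {g : F → F'} (hg : ContDiff ℝ ∞ g) (R : ℝ) :
    ∃ K, LipschitzOnWith K g (Metric.closedBall 0 R) :=
  ((hg.of_le (by simp)).locallyLipschitz.locallyLipschitzOn).exists_lipschitzOnWith_of_compact
    (isCompact_closedBall _ _)

end HalfLine

/-! ### Clamping -/

/-- Clamp every entry of a vector to `[-R, R]`. -/
def clamp {m : ℕ} (R : ℝ) (v : Fin m → ℝ) : Fin m → ℝ := fun i => max (-R) (min R (v i))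

lemma dist_clamp_le {m : ℕ} (R : ℝ) (v w : Fin m → ℝ) : dist (clamp R v) (clamp R w) ≤ dist v w := by
  refine (dist_pi_le_iff dist_nonneg).mpr fun i => le_trans ?_ (dist_le_pi_dist v w i)
  rw [Real.dist_eq, Real.dist_eq]
  refine (abs_max_sub_max_le_max _ _ _ _).trans (max_le (by simp) ?_)
  exact (abs_min_sub_min_le_max _ _ _ _).trans (max_le (by simp) le_rfl)

lemma norm_clamp_le {m : ℕ} {R : ℝ} (hR : 0 ≤ R) (v : Fin m → ℝ) : ‖clamp R v‖ ≤ R := by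
  refine (pi_norm_le_iff_of_nonneg hR).mpr fun i => ?_
  rw [Real.norm_eq_abs, abs_le]
  exact ⟨le_max_left _ _, max_le (by linarith) (min_le_left _ _)⟩

lemma clamp_eq_self {m : ℕ} {R : ℝ} {v : Fin m → ℝ} (hv : ‖v‖ ≤ R) : clamp R v = v := by
  funext i
  have h := abs_le.mp ((norm_le_pi_norm v i).trans hv)
  rw [clamp, min_eq_right h.2, max_eq_right h.1]

/-! ### The closed loop as a differential equation continuous in time -/

/-- The state `(x, x̂, θ̂)` of the closed loop. -/
abbrev Signals (n p : ℕ) : Type := (Fin n → ℝ) × (Fin n → ℝ) × (Fin p → ℝ)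

/-- Componentwise clamp of the closed-loop state. -/
def clampSignals {n p : ℕ} (R : ℝ) (z : Signals n p) : Signals n p :=
  (clamp R z.1, clamp R z.2.1, clamp R z.2.2)

section Field

variable {n p : ℕ}

lemma lipschitzWith_clampSignals (R : ℝ) : LipschitzWith 1 (clampSignals (n := n) (p := p) R) := by
  refine LipschitzWith.of_dist_le_mul fun z w => ?_
  rw [NNReal.coe_one, one_mul, Prod.dist_eq, Prod.dist_eq, Prod.dist_eq, Prod.dist_eq]
  exact max_le_max (dist_clamp_le R _ _) (max_le_max (dist_clamp_le R _ _) (dist_clamp_le R _ _))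

lemma norm_clampSignals_le {R : ℝ} (hR : 0 ≤ R) (z : Signals n p) : ‖clampSignals R z‖ ≤ R :=
  max_le (norm_clamp_le hR _) (max_le (norm_clamp_le hR _) (norm_clamp_le hR _))

lemma clampSignals_eq_self {R : ℝ} {z : Signals n p} (hz : ‖z‖ ≤ R) : clampSignals R z = z := by
  have h1 : ‖z.1‖ ≤ R := (le_max_left _ _).trans hz
  have h2 : ‖z.2‖ ≤ R := (le_max_right _ _).trans hz
  have h3 : ‖z.2.1‖ ≤ R := (le_max_left _ _).trans h2
  have h4 : ‖z.2.2‖ ≤ R := (le_max_right _ _).trans h2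
  simp [clampSignals, clamp_eq_self h1, clamp_eq_self h3, clamp_eq_self h4]

variable (S : Loop n p)

/-- The right-hand side of the closed loop for the control `u`. -/
def Loop.field (z : Signals n p) (u : ℝ) : Signals n p :=
  (S.plantRHS z.1 u, S.observerRHS z.1 z.2.1 z.2.2 u, S.updateRHS z.1 z.2.1)

/-- The right-hand side of the closed loop without the feed-forward term `r⁽ⁿ⁾`. -/
def Loop.feedbackField (w : Signals n p × (Fin (n + 1) → ℝ)) : Signals n p :=
  S.field w.1 (S.alpha n le_rfl (w.1.1, w.1.2.2, w.2))

/-- The direction in which the control enters. -/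
def inputDir (n p : ℕ) : Signals n p :=
  (fun i => if i.val + 1 < n then 0 else 1, fun i => if i.val + 1 < n then 0 else 1, 0)

/-- The jet with its last entry replaced by `0`. -/
def Loop.lowJet (t : ℝ) : Fin (n + 1) → ℝ := fun k => if k.val < n then refDeriv S.r k t else 0

variable {S}

lemma field_add (z : Signals n p) (u v : ℝ) :
    S.field z (u + v) = S.field z u + v • inputDir n p := by
  have hf : Loop.f z.1 (u + v) = Loop.f z.1 u + v • (inputDir n p).1 := by
    funext i
    simp only [Loop.f, inputDir, Pi.add_apply, Pi.smul_apply, smul_eq_mul]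
    split_ifs <;> simp
  refine Prod.ext ?_ (Prod.ext ?_ ?_)
  · simp only [Loop.field, Loop.plantRHS, hf, Prod.fst_add, Prod.smul_fst]
    abel
  · simp only [Loop.field, Loop.observerRHS, hf, Prod.fst_add, Prod.snd_add, Prod.smul_snd,
      Prod.smul_fst]
    have : (inputDir n p).1 = (inputDir n p).2.1 := rfl
    rw [this]
    abel
  · simp [Loop.field, inputDir]

/-- Isolates r⁽ⁿ⁾, the only term discontinuous in time; it enters additively along a constant
direction and is the derivative of `shift`. -/
lemma field_uBar (z : Signals n p) (t : ℝ) :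
    S.field z (S.uBar (z.1, z.2.2, refJet n S.r t)) =
      S.feedbackField (z, S.lowJet t) + refDeriv S.r n t • inputDir n p := by
  have h1 : S.alpha n le_rfl (z.1, z.2.2, refJet n S.r t) =
      S.alpha n le_rfl (z.1, z.2.2, S.lowJet t) :=
    dependsTo_alpha S n le_rfl _ _ ⟨fun _ _ => rfl, rfl, fun k hk => by
      simp [Loop.lowJet, refJet, hk]⟩
  rw [Loop.uBar, field_add, h1]
  rfl

lemma contDiff_mulVec {F : Type*} [NormedAddCommGroup F] [NormedSpace ℝ F] {k m : ℕ}
    {A : F → Matrix (Fin k) (Fin m) ℝ} {v : F → Fin m → ℝ}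
    (hA : ∀ i j, ContDiff ℝ ∞ fun z => A z i j) (hv : ContDiff ℝ ∞ v) :
    ContDiff ℝ ∞ fun z => A z *ᵥ v z :=
  contDiff_pi.mpr fun i => contDiff_dotProduct (contDiff_pi.mpr fun j => hA i j) hv

lemma contDiff_feedbackField (hS : S.Regular) : ContDiff ℝ ∞ S.feedbackField := by
  have hx : ContDiff ℝ ∞ fun w : Signals n p × (Fin (n + 1) → ℝ) => w.1.1 :=
    contDiff_fst.comp contDiff_fst
  have hxh : ContDiff ℝ ∞ fun w : Signals n p × (Fin (n + 1) → ℝ) => w.1.2.1 :=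
    contDiff_fst.comp (contDiff_snd.comp contDiff_fst)
  have hth : ContDiff ℝ ∞ fun w : Signals n p × (Fin (n + 1) → ℝ) => w.1.2.2 :=
    contDiff_snd.comp (contDiff_snd.comp contDiff_fst)
  have hu : ContDiff ℝ ∞ fun w : Signals n p × (Fin (n + 1) → ℝ) =>
      S.alpha n le_rfl (w.1.1, w.1.2.2, w.2) :=
    (contDiff_alpha hS.smooth n le_rfl).comp (hx.prodMk (hth.prodMk contDiff_snd))
  have hf : ContDiff ℝ ∞ fun w : Signals n p × (Fin (n + 1) → ℝ) =>
      Loop.f w.1.1 (S.alpha n le_rfl (w.1.1, w.1.2.2, w.2)) := by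
    refine contDiff_pi.mpr fun i => ?_
    unfold Loop.f
    by_cases hi : i.val + 1 < n
    · simp only [hi, dif_pos]
      exact (contDiff_apply ℝ ℝ _).comp hx
    · simp only [hi, dif_neg, not_false_eq_true]
      exact hu
  have hF : ∀ j i, ContDiff ℝ ∞ fun w : Signals n p × (Fin (n + 1) → ℝ) => S.F w.1.1 j i :=
    fun j i => (contDiff_F hS j i).comp hx
  have hcv : ∀ {k m : ℕ} (A : Matrix (Fin k) (Fin m) ℝ)
      {v : Signals n p × (Fin (n + 1) → ℝ) → Fin m → ℝ}, ContDiff ℝ ∞ v →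
      ContDiff ℝ ∞ fun w => A *ᵥ v w := fun A v hv =>
    contDiff_mulVec (fun _ _ => contDiff_const) hv
  have hinnov : ∀ {v : Signals n p × (Fin (n + 1) → ℝ) → Fin n → ℝ}, ContDiff ℝ ∞ v →
      ContDiff ℝ ∞ fun w => S.F w.1.1 *ᵥ (S.P *ᵥ v w) := fun hv =>
    contDiff_mulVec hF (hcv _ hv)
  unfold Loop.feedbackField Loop.field
  refine ContDiff.prodMk ?_ (ContDiff.prodMk ?_ ?_)
  · exact hf.add (contDiff_mulVec (fun i j => hF j i) contDiff_const)
  · unfold Loop.observerRHS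
    simp only [Matrix.sub_mulVec, Matrix.smul_mulVec, ← Matrix.mulVec_mulVec]
    exact (((hcv _ (hxh.sub hx)).sub ((contDiff_mulVec (fun i j => hF j i)
      (hinnov (hxh.sub hx))).const_smul _)).add hf).add (contDiff_mulVec (fun i j => hF j i) hth)
  · simp only [updateRHS_eq]
    exact hcv _ (hinnov (hx.sub hxh))

lemma continuousOn_lowJet (hS : S.Regular) : ContinuousOn S.lowJet (Ici 0) := by
  refine continuousOn_pi.mpr fun k => ?_
  unfold Loop.lowJet
  by_cases hk : k.val < n
  · simp only [hk, if_true]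
    exact hS.ref.continuousOn_refDeriv hS.pos hk
  · simp only [hk, if_false]
    exact continuousOn_const

lemma exists_norm_lowJet_le (hS : S.Regular) :
    ∃ M : ℝ, 0 ≤ M ∧ ∀ t, 0 ≤ t → ‖S.lowJet t‖ ≤ M := by
  obtain ⟨M, hM0, hM⟩ := hS.ref.exists_bound
  refine ⟨M, hM0, fun t ht => (pi_norm_le_iff_of_nonneg hM0).mpr fun k => ?_⟩
  unfold Loop.lowJet
  split_ifs with hk
  · exact hM t ht k hk.le
  · simpa using hM0

variable (S) in
/-- The part of the state that is moved directly by `r⁽ⁿ⁾`. -/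
def Loop.shift (t : ℝ) : Signals n p := refDeriv S.r (n - 1) t • inputDir n p

lemma continuousOn_shift (hS : S.Regular) : ContinuousOn S.shift (Ici 0) :=
  (hS.ref.continuousOn_refDeriv hS.pos (Nat.sub_lt hS.pos one_pos)).smul continuousOn_const

lemma hasDerivAt_shift (hS : S.Regular) {t : ℝ}
    (h : ∀ k < n, HasDerivAt (refDeriv S.r k) (refDeriv S.r (k + 1) t) t) :
    HasDerivAt S.shift (refDeriv S.r n t • inputDir n p) t := by
  have h1 := h (n - 1) (Nat.sub_lt hS.pos one_pos)
  rw [Nat.sub_add_cancel (show 1 ≤ n from hS.pos)] at h1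
  exact h1.smul_const _

/-- Bounded and Lipschitz in the state, uniformly in time, after clamping. -/
lemma exists_lipschitz_feedbackField (hS : S.Regular) (R : ℝ) :
    ∃ K : NNReal, ∀ t, 0 ≤ t →
      LipschitzOnWith K (fun z => S.feedbackField (z, S.lowJet t)) (Metric.closedBall 0 R) := by
  obtain ⟨M, hM0, hM⟩ := exists_norm_lowJet_le hS
  obtain ⟨K, hK⟩ := exists_lipschitzOnWith_closedBall (contDiff_feedbackField hS) (max R M)
  refine ⟨K, fun t ht z hz w hw => ?_⟩
  have hmem : ∀ z ∈ Metric.closedBall (0 : Signals n p) R,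
      ((z, S.lowJet t) : Signals n p × (Fin (n + 1) → ℝ)) ∈ Metric.closedBall 0 (max R M) := by
    intro z hz
    rw [mem_closedBall_zero_iff] at hz ⊢
    exact max_le (hz.trans (le_max_left _ _)) ((hM t ht).trans (le_max_right _ _))
  refine (hK (hmem z hz) (hmem w hw)).trans ?_
  simp [Prod.edist_eq]

lemma exists_bound_feedbackField (hS : S.Regular) (R : ℝ) :
    ∃ L : NNReal, ∀ t, 0 ≤ t → ∀ z : Signals n p, ‖z‖ ≤ R →
      ‖S.feedbackField (z, S.lowJet t)‖ ≤ L := by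
  obtain ⟨M, hM0, hM⟩ := exists_norm_lowJet_le hS
  obtain ⟨L, hL0, hL⟩ := exists_bound_of_continuous
    (contDiff_feedbackField hS).continuous.norm (max R M)
  refine ⟨⟨L, hL0⟩, fun t ht z hz => ?_⟩
  have := hL (z, S.lowJet t) (max_le (hz.trans (le_max_left _ _))
    ((hM t ht).trans (le_max_right _ _)))
  rwa [abs_norm] at this

end Field

/-! ### Existence and uniqueness -/

section Wellposed

variable {n p : ℕ} {S : Loop n p}

lemma run_of_hasDerivAt {D : Set ℝ} (hD : LocFinite D)
    (href : ∀ t, 0 < t → t ∉ D → ∀ k < n, HasDerivAt (refDeriv S.r k) (refDeriv S.r (k + 1) t) t)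
    {a b : ℝ} (ha : 0 ≤ a) {z : ℝ → Signals n p} (hz : ContinuousOn z (Icc a b))
    (hd : ∀ t ∈ Ioo a b, t ∉ D → HasDerivAt z
      (S.field (z t) (S.uBar ((z t).1, (z t).2.2, refJet n S.r t))) t) :
    S.Run D a b (fun t => (z t).1) (fun t => (z t).2.1) (fun t => (z t).2.2) where
  nonneg := ha
  locFinite := hD
  cont_x := hz.fst
  cont_xh := hz.snd.fst
  cont_th := hz.snd.snd
  ode_x t ht htD := (hd t ht htD).fst
  ode_xh t ht htD := (hd t ht htD).snd.fst
  ode_th t ht htD := (hd t ht htD).snd.snd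
  ref t ht htD := href t (ha.trans_lt ht.1) htD

lemma exists_solution (hS : S.Regular) {a : ℝ} (ha : 0 ≤ a) (z₀ : Signals n p) :
    ∃ z : ℝ → Signals n p, z a = z₀ ∧
      S.IsSolution (Ici a) (fun t => (z t).1) (fun t => (z t).2.1) (fun t => (z t).2.2) := by
  obtain ⟨D, hD, href⟩ := hS.ref.exists_hasDerivAt hS.pos
  obtain ⟨B, hB0, hB⟩ := exists_run_bound hS ‖z₀‖
  set R := B + ‖z₀‖ + 1 with hR
  have hR0 : 0 ≤ R := by positivity
  obtain ⟨K, hK⟩ := exists_lipschitz_feedbackField hS R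
  obtain ⟨L, hL⟩ := exists_bound_feedbackField hS R
  -- Here y stands for z - `shift`. Its equation is free of r⁽ⁿ⁾ and thus continuous in time, and
  -- the clamp makes it bounded and globally Lipschitz.
  obtain ⟨y, hy0, hyc, hyd⟩ := exists_solution_of_bounded_lipschitz
    (H := fun t y => S.feedbackField (clampSignals R (y + S.shift t), S.lowJet t)) (a := a)
    (K := K) (L := L)
    (fun t ht => by
      have h1 : LipschitzWith 1 fun y => clampSignals R (y + S.shift t) :=
        LipschitzWith.of_dist_le_mul fun y y' => by
          simpa using (lipschitzWith_clampSignals R).dist_le_mul (y + S.shift t) (y' + S.shift t)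
      have h2 := (hK t (ha.trans ht)).comp (s := univ) (h1.lipschitzOnWith)
        (fun y _ => by simpa using norm_clampSignals_le hR0 (y + S.shift t))
      rw [mul_one, lipschitzOnWith_univ] at h2
      exact h2)
    (fun t ht y => hL t (ha.trans ht) _ (norm_clampSignals_le hR0 _))
    (fun y => (contDiff_feedbackField hS).continuous.comp_continuousOn
      (((lipschitzWith_clampSignals R).continuous.comp_continuousOn
        (continuousOn_const.add ((continuousOn_shift hS).mono (Ici_subset_Ici.mpr ha)))).prodMk
        ((continuousOn_lowJet hS).mono (Ici_subset_Ici.mpr ha)))) (z₀ - S.shift a)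
  set z : ℝ → Signals n p := fun t => y t + S.shift t with hz
  have hza : z a = z₀ := by simp [hz, hy0]
  have hzc : ContinuousOn z (Ici a) :=
    hyc.add ((continuousOn_shift hS).mono (Ici_subset_Ici.mpr ha))
  have hzd : ∀ t ∈ Ioi a, t ∉ D → ‖z t‖ ≤ R → HasDerivAt z
      (S.field (z t) (S.uBar ((z t).1, (z t).2.2, refJet n S.r t))) t := by
    intro t ht htD hzR
    rw [field_uBar]
    have h1 := (hyd t ht).add (hasDerivAt_shift hS (href t (ha.trans_lt ht) htD))
    have h2 : y t + S.shift t = z t := rfl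
    simp only [h2, clampSignals_eq_self hzR] at h1
    exact h1
  -- At the first time with ‖z‖ ≥ R the clamp has not acted yet, so z is a true run up to then and
  -- the a priori bound B < R contradicts ‖z‖ ≥ R.
  have hbound : ∀ t ∈ Ici a, ‖z t‖ < R := by
    by_contra! hcon
    obtain ⟨t₁, ht₁, hzt₁⟩ := hcon
    set A : Set ℝ := Icc a t₁ ∩ (fun t => ‖z t‖) ⁻¹' Ici R with hA
    have hAc : IsClosed A := (hzc.norm.mono fun t ht => ht.1).preimage_isClosed_of_isClosed
      isClosed_Icc isClosed_Ici
    have hAne : A.Nonempty := ⟨t₁, ⟨ht₁, le_rfl⟩, hzt₁⟩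
    have hAb : BddBelow A := ⟨a, fun t ht => ht.1.1⟩
    set τ := sInf A with hτ
    have hτA : τ ∈ A := hAc.csInf_mem hAne hAb
    have hlt : ∀ t ∈ Ioo a τ, ‖z t‖ ≤ R := by
      intro t ht
      by_contra! h
      have : τ ≤ t := csInf_le hAb ⟨⟨ht.1.le, ht.2.le.trans hτA.1.2⟩, h.le⟩
      exact absurd ht.2 (not_lt.mpr this)
    have hrun := run_of_hasDerivAt (S := S) hD href ha (b := τ) (hzc.mono fun t ht => ht.1)
      (fun t ht htD => hzd t ht.1 htD (hlt t ht))
    have e1 : ‖z₀.2‖ ≤ ‖z₀‖ := le_max_right _ _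
    obtain ⟨b1, b2, b3, -⟩ := hB D a τ _ _ _ hrun (by rw [hza]; exact le_max_left _ _)
      (by rw [hza]; exact (le_max_left _ _).trans e1)
      (by rw [hza]; exact (le_max_right _ _).trans e1) τ ⟨hτA.1.1, le_rfl⟩
    have h1 : ‖z τ‖ ≤ B := max_le b1 (max_le b2 b3)
    have h2 : R ≤ ‖z τ‖ := hτA.2
    have h3 := norm_nonneg z₀
    linarith
  -- The initial time joins the exceptional set, because the equation is only known to its right.
  refine ⟨z, hza, ⟨hzc.fst, hzc.snd.fst, hzc.snd.snd, D ∪ {a},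
    hD.union fun _ _ => (finite_singleton a).inter_of_left _, fun t ht htE => ?_⟩⟩
  have hta : t ∈ Ioi a := lt_of_le_of_ne ht fun h => htE (Or.inr h.symm)
  have hrun := run_of_hasDerivAt (S := S) hD href ha (b := t + 1) (hzc.mono fun t ht => ht.1)
    (fun t ht htD => hzd t ht.1 htD (hbound t ht.1.le).le)
  have htI : t ∈ Ioo a (t + 1) := ⟨hta, lt_add_one t⟩
  have htD : t ∉ D := fun h => htE (Or.inl h)
  exact ⟨(hrun.ode_x t htI htD).hasDerivWithinAt, (hrun.ode_xh t htI htD).hasDerivWithinAt,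
    (hrun.ode_th t htI htD).hasDerivWithinAt⟩

/-- After subtraction of `shift` both runs have right derivatives everywhere given by one field,
Lipschitz on a ball containing both. This is also why their exceptional sets may differ. -/
lemma Loop.Run.eqOn (hS : S.Regular) {E E' : Set ℝ} {a b : ℝ} {x xh x' xh' : ℝ → Fin n → ℝ}
    {th th' : ℝ → Fin p → ℝ} (h : S.Run E a b x xh th) (h' : S.Run E' a b x' xh' th')
    (hx : x' a = x a) (hxh : xh' a = xh a) (hth : th' a = th a) :
    EqOn (fun t => (x' t, xh' t, th' t)) (fun t => (x t, xh t, th t)) (Icc a b) := by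
  have hsub : Icc a b ⊆ Ici 0 := fun t ht => h.nonneg.trans ht.1
  have key : ∀ {E : Set ℝ} {x xh : ℝ → Fin n → ℝ} {th : ℝ → Fin p → ℝ}, S.Run E a b x xh th →
      ContinuousOn (fun t => ((x t, xh t, th t) : Signals n p)) (Icc a b) ∧
      ∀ t ∈ Ico a b, HasDerivWithinAt (fun t => ((x t, xh t, th t) : Signals n p) - S.shift t)
        (S.feedbackField ((x t, xh t, th t), S.lowJet t)) (Ici t) t := by
    intro E x xh th h
    have hc : ContinuousOn (fun t => ((x t, xh t, th t) : Signals n p)) (Icc a b) :=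
      h.cont_x.prodMk (h.cont_xh.prodMk h.cont_th)
    refine ⟨hc, hasDerivWithinAt_Ici_of_locFinite h.locFinite
      (hc.sub ((continuousOn_shift hS).mono hsub))
      ((contDiff_feedbackField hS).continuous.comp_continuousOn
        (hc.prodMk ((continuousOn_lowJet hS).mono hsub))) fun t ht htE => ?_⟩
    have h1 := ((h.ode_x t ht htE).prodMk ((h.ode_xh t ht htE).prodMk (h.ode_th t ht htE))).sub
      (hasDerivAt_shift hS (h.ref t ht htE))
    refine h1.congr_deriv ?_
    have h2 := field_uBar (S := S) (x t, xh t, th t) t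
    rw [sub_eq_iff_eq_add, ← h2]
    rfl
  obtain ⟨hc, hd⟩ := key h
  obtain ⟨hc', hd'⟩ := key h'
  obtain ⟨R₁, hR₁⟩ := isCompact_Icc.exists_bound_of_continuousOn hc
  obtain ⟨R₂, hR₂⟩ := isCompact_Icc.exists_bound_of_continuousOn hc'
  obtain ⟨K, hK⟩ := exists_lipschitz_feedbackField hS (max R₁ R₂)
  have hshift := (continuousOn_shift hS).mono hsub
  have huniq := ODE_solution_unique_of_mem_Icc_right
    (v := fun t y => S.feedbackField (y + S.shift t, S.lowJet t))
    (s := fun t => {y | y + S.shift t ∈ Metric.closedBall 0 (max R₁ R₂)}) (K := K)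
    (fun t ht y hy w hw => by
      have := hK t (h.nonneg.trans ht.1) hy hw
      simpa using this)
    (hc'.sub hshift) (fun t ht => (hd' t ht).congr_deriv (by simp))
    (fun t ht => by simpa using Or.inr (hR₂ t (Ico_subset_Icc_self ht)))
    (hc.sub hshift) (fun t ht => (hd t ht).congr_deriv (by simp))
    (fun t ht => by simpa using Or.inl (hR₁ t (Ico_subset_Icc_self ht)))
    (by simp [hx, hxh, hth])
  intro t ht
  exact sub_left_injective (huniq ht)

theorem existence_uniqueness (hS : S.Regular) (t₀ : ℝ) (ht₀ : 0 ≤ t₀) (x₀ xh₀ : Fin n → ℝ)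
    (th₀ : Fin p → ℝ) :
    ∃ (x xh : ℝ → Fin n → ℝ) (th : ℝ → Fin p → ℝ),
      S.IsSolution (Ici t₀) x xh th ∧ x t₀ = x₀ ∧ xh t₀ = xh₀ ∧ th t₀ = th₀ ∧
      ∀ (T : ℝ) (x' xh' : ℝ → Fin n → ℝ) (th' : ℝ → Fin p → ℝ),
        S.IsSolution (Ico t₀ T) x' xh' th' → x' t₀ = x₀ → xh' t₀ = xh₀ → th' t₀ = th₀ →
        EqOn x' x (Ico t₀ T) ∧ EqOn xh' xh (Ico t₀ T) ∧ EqOn th' th (Ico t₀ T) := by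
  obtain ⟨z, hz0, hz⟩ := exists_solution hS ht₀ (x₀, xh₀, th₀)
  refine ⟨_, _, _, hz, by rw [hz0], by rw [hz0], by rw [hz0],
    fun T x' xh' th' hsol hx hxh hth => ?_⟩
  obtain ⟨E, hE⟩ := hz.exists_run hS
  obtain ⟨E', hE'⟩ := hsol.exists_run hS
  have key : ∀ t ∈ Ico t₀ T, ((x' t, xh' t, th' t) : Signals n p) = z t := fun t ht =>
    (hE t₀ t ht₀ Icc_subset_Ici_self).eqOn hS
      (hE' t₀ t ht₀ fun τ hτ => ⟨hτ.1, hτ.2.trans_lt ht.2⟩)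
      (by rw [hx, hz0]) (by rw [hxh, hz0]) (by rw [hth, hz0]) ⟨ht.1, le_rfl⟩
  refine ⟨fun t ht => ?_, fun t ht => ?_, fun t ht => ?_⟩
  · exact congrArg Prod.fst (key t ht)
  · exact congrArg (fun z => z.2.1) (key t ht)
  · exact congrArg (fun z => z.2.2) (key t ht)

end Wellposed

/-! ### Asymptotic tracking -/

section Tracking

variable {n p : ℕ} {S : Loop n p}

lemma uniformContinuousOn_of_deriv_bound {m : ℕ} {E : Set ℝ} (hE : LocFinite E) {a C : ℝ}
    {y y' : ℝ → Fin m → ℝ} (hy : ContinuousOn y (Ici a))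
    (hd : ∀ t ∈ Ioi a, t ∉ E → HasDerivAt y (y' t) t ∧ ‖y' t‖ ≤ C) (hC : 0 ≤ C) :
    UniformContinuousOn y (Ici a) := by
  have key : ∀ s t, a ≤ s → s ≤ t → dist (y s) (y t) ≤ C * dist s t := by
    intro s t hs hst
    refine (dist_pi_le_iff (by positivity)).mpr fun i => ?_
    rw [dist_comm (y s i), dist_comm s, Real.dist_eq, Real.dist_eq, abs_of_nonneg (sub_nonneg.mpr hst)]
    exact abs_sub_le_of_deriv_bound (f := fun t => y t i) (f' := fun t => y' t i) hE hst
      ((continuousOn_pi.mp hy i).mono fun τ hτ => hs.trans hτ.1) fun τ hτ hτE =>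
      ⟨hasDerivAt_pi.mp (hd τ (hs.trans_lt hτ.1) hτE).1 i,
        (norm_le_pi_norm (y' τ) i).trans (hd τ (hs.trans_lt hτ.1) hτE).2⟩
  have hL : LipschitzOnWith ⟨C, hC⟩ y (Ici a) := LipschitzOnWith.of_dist_le_mul fun s hs t ht => by
    rcases le_total s t with h | h
    · exact key s t hs h
    · rw [dist_comm, dist_comm s]
      exact key t s ht h
  exact hL.uniformContinuousOn

lemma tendsto_mul_zero_of_bounded {f g : ℝ → ℝ} {C : ℝ} (hf : ∀ᶠ t in atTop, |f t| ≤ C)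
    (hg : Tendsto g atTop (𝓝 0)) : Tendsto (fun t => f t * g t) atTop (𝓝 0) := by
  have h1 : Tendsto (fun t => C * |g t|) atTop (𝓝 0) := by
    simpa using (hg.abs.const_mul C)
  refine squeeze_zero_norm' ?_ h1
  filter_upwards [hf] with t ht
  rw [norm_mul]
  exact mul_le_mul_of_nonneg_right ht (abs_nonneg _)

lemma tendsto_zero_of_dotProduct_self {m : ℕ} {v : ℝ → Fin m → ℝ}
    (h : Tendsto (fun t => v t ⬝ᵥ v t) atTop (𝓝 0)) : Tendsto v atTop (𝓝 0) := by
  refine squeeze_zero_norm (fun t => norm_le_eucNorm (v t)) ?_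
  have h1 := (Real.continuous_sqrt.tendsto 0).comp h
  rw [Real.sqrt_zero] at h1
  refine h1.congr fun t => ?_
  simp [eucNorm, dotProduct, sq]

lemma tendsto_dotProduct_zero_of_bounded {m : ℕ} {v w : ℝ → Fin m → ℝ} {C : ℝ}
    (hv : ∀ᶠ t in atTop, ‖v t‖ ≤ C) (hw : Tendsto w atTop (𝓝 0)) :
    Tendsto (fun t => v t ⬝ᵥ w t) atTop (𝓝 0) := by
  have h : ∀ i, Tendsto (fun t => v t i * w t i) atTop (𝓝 0) := fun i =>
    tendsto_mul_zero_of_bounded (C := C)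
      (hv.mono fun t ht => (norm_le_pi_norm (v t) i).trans ht) (tendsto_pi_nhds.mp hw i)
  have h1 := tendsto_finsetSum Finset.univ fun i _ => h i
  rw [Finset.sum_const_zero] at h1
  exact h1

/-- A solution on `[a, ∞)` that stays in the ball of radius `B`. -/
structure Loop.BoundedRun (S : Loop n p) (E : Set ℝ) (a B : ℝ) (x xh : ℝ → Fin n → ℝ)
    (th : ℝ → Fin p → ℝ) : Prop where
  run : ∀ b, S.Run E a b x xh th
  norm_args : ∀ t ∈ Ici a, ‖S.args x th t‖ ≤ B
  norm_xh : ∀ t ∈ Ici a, ‖xh t‖ ≤ B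

lemma Loop.IsSolution.exists_boundedRun (hS : S.Regular) {a : ℝ} (ha : 0 ≤ a)
    {x xh : ℝ → Fin n → ℝ} {th : ℝ → Fin p → ℝ} (h : S.IsSolution (Ici a) x xh th) :
    ∃ E B, S.BoundedRun E a B x xh th := by
  obtain ⟨E, hE⟩ := h.exists_run hS
  obtain ⟨B, -, hB⟩ := exists_run_bound hS (‖x a‖ + ‖xh a‖ + ‖th a‖)
  have h1 := norm_nonneg (x a)
  have h2 := norm_nonneg (xh a)
  have h3 := norm_nonneg (th a)
  have key : ∀ t ∈ Ici a, _ := fun t (ht : a ≤ t) =>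
    hB E a t x xh th (hE a t ha Icc_subset_Ici_self) (by linarith) (by linarith) (by linarith) t
      ⟨ht, le_rfl⟩
  exact ⟨E, B, fun b => hE a b ha Icc_subset_Ici_self, fun t ht => (key t ht).2.2.2,
    fun t ht => (key t ht).2.1⟩

variable {E : Set ℝ} {a B : ℝ} {x xh : ℝ → Fin n → ℝ} {th : ℝ → Fin p → ℝ}

lemma Loop.BoundedRun.norm_x (h : S.BoundedRun E a B x xh th) {t : ℝ} (ht : t ∈ Ici a) :
    ‖x t‖ ≤ B := (le_max_left _ _).trans (h.norm_args t ht)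

lemma Loop.BoundedRun.norm_th (h : S.BoundedRun E a B x xh th) {t : ℝ} (ht : t ∈ Ici a) :
    ‖th t‖ ≤ B := (le_max_left _ _).trans ((le_max_right _ _).trans (h.norm_args t ht))

lemma Loop.BoundedRun.norm_signals (h : S.BoundedRun E a B x xh th) {t : ℝ} (ht : t ∈ Ici a) :
    ‖((x t, xh t, th t) : Signals n p)‖ ≤ B :=
  max_le (h.norm_x ht) (max_le (h.norm_xh t ht) (h.norm_th ht))

lemma continuousOn_Ici_of_Icc {F : Type*} [TopologicalSpace F] {f : ℝ → F}
    (hf : ∀ b, ContinuousOn f (Icc a b)) : ContinuousOn f (Ici a) := by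
  intro t ht
  refine (hf (t + 1) t ⟨ht, by linarith⟩).mono_of_mem_nhdsWithin ?_
  exact mem_nhdsWithin_iff_exists_mem_nhds_inter.mpr
    ⟨Iio (t + 1), Iio_mem_nhds (by linarith), fun τ hτ => ⟨hτ.2, le_of_lt hτ.1⟩⟩

lemma mem_Ioo_add_one {t : ℝ} (ht : t ∈ Ioi a) : t ∈ Ioo a (t + 1) := ⟨ht, lt_add_one t⟩

/-- Along a bounded run the right-hand side is bounded, so the signals are Lipschitz; q is uniformly
continuous on the ball that contains them. -/
lemma Loop.BoundedRun.uniformContinuousOn_comp (hS : S.Regular) (h : S.BoundedRun E a B x xh th)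
    {q : Signals n p → ℝ} (hq : Continuous q) :
    UniformContinuousOn (fun t => q (x t, xh t, th t)) (Ici a) := by
  obtain ⟨L, hL0, hL⟩ := exists_bound_of_continuous
    (F := Signals n p × (Fin (n + 1) → ℝ))
    (g := fun w => ‖S.feedbackField w + w.2 (Fin.last n) • inputDir n p‖)
    (((contDiff_feedbackField hS).continuous.add
      (((continuous_apply _).comp continuous_snd).smul continuous_const)).norm) B
  have hfield : ∀ t ∈ Ici a, ‖S.field (x t, xh t, th t) (S.uBar (S.args x th t))‖ ≤ L := by
    intro t ht
    have h1 := hL ((x t, xh t, th t), refJet n S.r t) (max_le (h.norm_signals ht)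
      ((le_max_right _ _).trans ((le_max_right _ _).trans (h.norm_args t ht))))
    rw [abs_norm] at h1
    have h2 : S.field (x t, xh t, th t) (S.uBar (S.args x th t)) =
        S.feedbackField ((x t, xh t, th t), refJet n S.r t) +
          refJet n S.r t (Fin.last n) • inputDir n p := by
      rw [Loop.uBar, field_add]; rfl
    rw [h2]
    exact h1
  have hLF := (h.run a).locFinite
  have hx : UniformContinuousOn x (Ici a) := uniformContinuousOn_of_deriv_bound hLF
    (continuousOn_Ici_of_Icc fun b => (h.run b).cont_x)
    (fun t ht htE => ⟨(h.run (t + 1)).ode_x t (mem_Ioo_add_one ht) htE,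
      (le_max_left _ _).trans (hfield t (Ioi_subset_Ici_self ht))⟩) hL0
  have hxh : UniformContinuousOn xh (Ici a) := uniformContinuousOn_of_deriv_bound hLF
    (continuousOn_Ici_of_Icc fun b => (h.run b).cont_xh)
    (fun t ht htE => ⟨(h.run (t + 1)).ode_xh t (mem_Ioo_add_one ht) htE,
      (le_max_left _ _).trans ((le_max_right _ _).trans
        (hfield t (Ioi_subset_Ici_self ht)))⟩) hL0
  have hth : UniformContinuousOn th (Ici a) := uniformContinuousOn_of_deriv_bound hLF
    (continuousOn_Ici_of_Icc fun b => (h.run b).cont_th)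
    (fun t ht htE => ⟨(h.run (t + 1)).ode_th t (mem_Ioo_add_one ht) htE,
      (le_max_right _ _).trans ((le_max_right _ _).trans
        (hfield t (Ioi_subset_Ici_self ht)))⟩) hL0
  have hz : UniformContinuousOn (fun t => ((x t, xh t, th t) : Signals n p)) (Ici a) := by
    rw [uniformContinuousOn_iff_restrict] at hx hxh hth ⊢
    exact hx.prodMk (hxh.prodMk hth)
  have hqB : UniformContinuousOn q (Metric.closedBall 0 B) :=
    (isCompact_closedBall _ _).uniformContinuousOn_of_continuous hq.continuousOn
  exact hqB.comp hz fun t ht => mem_closedBall_zero_iff.mpr (h.norm_signals ht)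

lemma Loop.BoundedRun.tendsto_lyapunov (hS : S.Regular) (h : S.BoundedRun E a B x xh th) :
    ∃ l, Tendsto (fun t => S.lyapunov (x t) (xh t) (th t)) atTop (𝓝 l) := by
  set V := fun t => S.lyapunov (x t) (xh t) (th t) with hV
  -- Freezing time at a extends the monotone function to the whole line.
  have hanti : Antitone fun t => V (max t a) := fun s t hst =>
    ((h.run (max t a)).mono (le_max_right s a) le_rfl).lyapunov_le hS
      ⟨max_le_max_right a hst, le_rfl⟩
  have hb : BddBelow (range fun t => V (max t a)) :=
    ⟨0, by rintro _ ⟨t, rfl⟩; exact lyapunov_nonneg hS _ _ _⟩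
  refine ⟨_, (tendsto_atTop_ciInf hanti hb).congr' ?_⟩
  filter_upwards [eventually_ge_atTop a] with t ht
  rw [max_eq_left ht]

lemma Loop.BoundedRun.tendsto_lyapunov_deriv (hS : S.Regular) (h : S.BoundedRun E a B x xh th) :
    Tendsto (fun t => -((x t - xh t) ⬝ᵥ (x t - xh t)) -
      2 * S.σ * (S.innov (x t) (xh t) ⬝ᵥ S.innov (x t) (xh t))) atTop (𝓝 0) := by
  obtain ⟨l, hl⟩ := h.tendsto_lyapunov hS
  have hq : Continuous fun z : Signals n p => -((z.1 - z.2.1) ⬝ᵥ (z.1 - z.2.1)) -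
      2 * S.σ * (S.innov z.1 z.2.1 ⬝ᵥ S.innov z.1 z.2.1) := by
    have h1 : Continuous fun z : Signals n p => S.innov z.1 z.2.1 :=
      (continuous_innov hS).comp (continuous_fst.prodMk (continuous_fst.comp continuous_snd))
    fun_prop
  exact barbalat (h.run a).locFinite
    (continuousOn_Ici_of_Icc fun b => (h.run b).continuousOn_lyapunov)
    (fun t ht htE => by
      rw [zero_add]
      exact (h.run (t + 1)).hasDerivAt_lyapunov hS (mem_Ioo_add_one ht) htE) hl
    tendsto_const_nhds (h.uniformContinuousOn_comp hS hq)

lemma Loop.BoundedRun.tendsto_observer_error (hS : S.Regular) (h : S.BoundedRun E a B x xh th) :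
    Tendsto (fun t => x t - xh t) atTop (𝓝 0) := by
  refine tendsto_zero_of_dotProduct_self ?_
  refine squeeze_zero (fun t => dotProduct_self_nonneg_real _) (fun t => ?_)
    (by simpa only [neg_zero] using (h.tendsto_lyapunov_deriv hS).neg)
  have := mul_nonneg hS.σ_pos.le (dotProduct_self_nonneg_real (S.innov (x t) (xh t)))
  linarith

lemma Loop.BoundedRun.tendsto_innov (hS : S.Regular) (h : S.BoundedRun E a B x xh th) :
    Tendsto (fun t => S.innov (x t) (xh t)) atTop (𝓝 0) := by
  have hσ := hS.σ_pos
  refine tendsto_zero_of_dotProduct_self ?_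
  have h1 := ((h.tendsto_lyapunov_deriv hS).neg).mul_const (2 * S.σ)⁻¹
  rw [neg_zero, zero_mul] at h1
  refine squeeze_zero (fun t => dotProduct_self_nonneg_real _) (fun t => ?_) h1
  have := dotProduct_self_nonneg_real (x t - xh t)
  rw [← div_eq_mul_inv, le_div_iff₀ (by positivity)]
  linarith

lemma Loop.BoundedRun.eventually_bound (h : S.BoundedRun E a B x xh th) {q : Args n p → ℝ}
    (hq : Continuous q) : ∃ C, ∀ᶠ t in atTop, |q (S.args x th t)| ≤ C := by
  obtain ⟨C, -, hC⟩ := exists_bound_of_continuous hq B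
  refine ⟨C, ?_⟩
  filter_upwards [eventually_ge_atTop a] with t ht
  exact hC _ (h.norm_args t ht)

lemma Loop.BoundedRun.eventually_norm_bound (h : S.BoundedRun E a B x xh th) {m : ℕ}
    {q : Args n p → Fin m → ℝ} (hq : Continuous q) :
    ∃ C, ∀ᶠ t in atTop, ‖q (S.args x th t)‖ ≤ C := by
  obtain ⟨C, hC⟩ := h.eventually_bound hq.norm
  exact ⟨C, hC.mono fun t ht => by rwa [abs_norm] at ht⟩

/-- Second use of Barbalat: eᵢ → 0 and its derivative is φᵢᵀθ̃ plus terms in e and q that already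
tend to zero. The parameter error itself need not vanish. -/
lemma Loop.BoundedRun.tendsto_regressor (hS : S.Regular) (h : S.BoundedRun E a B x xh th)
    (i : Fin n) : Tendsto (fun t => S.phi i (x t) ⬝ᵥ (S.θ - th t)) atTop (𝓝 0) := by
  have hphi := continuous_phi hS i
  have he := h.tendsto_observer_error hS
  obtain ⟨C, hC⟩ := h.eventually_norm_bound (q := fun z => S.phi i z.1)
    (hphi.comp continuous_fst)
  have ha : Tendsto (fun t => (S.A₀ *ᵥ (x t - xh t)) i -
      S.σ * (S.phi i (x t) ⬝ᵥ S.innov (x t) (xh t))) atTop (𝓝 0) := by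
    have h1 : Tendsto (fun t => (S.A₀ *ᵥ (x t - xh t)) i) atTop (𝓝 0) := by
      have hc : Continuous fun v : Fin n → ℝ => (S.A₀ *ᵥ v) i := by fun_prop
      have := (hc.tendsto 0).comp he
      rwa [Matrix.mulVec_zero] at this
    have h2 := (tendsto_dotProduct_zero_of_bounded hC (h.tendsto_innov hS)).const_mul S.σ
    rw [mul_zero] at h2
    rw [← sub_zero (0 : ℝ)]
    exact h1.sub h2
  have hq : Continuous fun z : Signals n p => S.phi i z.1 ⬝ᵥ (S.θ - z.2.2) := by fun_prop
  refine barbalat (f := fun t => (x t - xh t) i) (h.run a).locFinite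
    (continuousOn_Ici_of_Icc fun b =>
      continuousOn_pi.mp ((h.run b).cont_x.sub (h.run b).cont_xh) i)
    (fun t ht htE => ?_) (tendsto_pi_nhds.mp he i) ha (h.uniformContinuousOn_comp hS hq)
  have h1 := ((h.run (t + 1)).ode_x t (mem_Ioo_add_one ht) htE).sub
    ((h.run (t + 1)).ode_xh t (mem_Ioo_add_one ht) htE)
  rw [plant_sub_observer] at h1
  exact hasDerivAt_pi.mp h1 i

/-- As wᵢ combines the φ_j with bounded coefficients, wᵢᵀθ̃ → 0; also θ̂' = Γq → 0. So the input of
each damped equation vanishes once the next coordinate does. -/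
lemma Loop.BoundedRun.tendsto_h (hS : S.Regular) (h : S.BoundedRun E a B x xh th) (i : Fin n) :
    Tendsto (fun t => S.h i (S.args x th t)) atTop (𝓝 0) := by
  refine backward_induction
    (Q := fun i => Tendsto (fun t => S.h i (S.args x th t)) atTop (𝓝 0)) (fun i ih => ?_) i
  have hca : ContDiff ℝ ∞ (S.prev i) := contDiff_alpha hS.smooth i.val i.isLt.le
  have hnext : Tendsto (fun t => S.hNext i (S.args x th t)) atTop (𝓝 0) := by
    by_cases hi : i.val + 1 < n
    · simpa [Loop.hNext, hi] using ih hi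
    · simp [Loop.hNext, hi]
  have hw : Tendsto (fun t => S.wStep (S.prev i) i (S.args x th t) ⬝ᵥ (S.θ - th t)) atTop
      (𝓝 0) := by
    have h1 : ∀ k : Fin i.val, Tendsto (fun t =>
        dX (S.prev i) ⟨k.val, k.isLt.trans i.isLt⟩ (S.args x th t) *
          (S.phi ⟨k.val, k.isLt.trans i.isLt⟩ (x t) ⬝ᵥ (S.θ - th t))) atTop (𝓝 0) := fun k => by
      obtain ⟨C, hC⟩ := h.eventually_bound (contDiff_dX hca ⟨k.val, k.isLt.trans i.isLt⟩).continuous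
      exact tendsto_mul_zero_of_bounded hC (h.tendsto_regressor hS _)
    have h2 := (h.tendsto_regressor hS i).sub (tendsto_finsetSum Finset.univ fun k _ => h1 k)
    rw [Finset.sum_const_zero, sub_zero] at h2
    exact h2.congr fun t => (wStep_dotProduct (S.prev i) i (S.args x th t) _).symm
  have hθ : Tendsto (fun t => dTheta (S.prev i) (S.args x th t) ⬝ᵥ
      S.Γ *ᵥ S.innov (x t) (xh t)) atTop (𝓝 0) := by
    obtain ⟨C, hC⟩ := h.eventually_norm_bound (contDiff_dTheta hca).continuous
    refine tendsto_dotProduct_zero_of_bounded hC ?_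
    have hc : Continuous fun v : Fin p → ℝ => S.Γ *ᵥ v := by fun_prop
    have := (hc.tendsto 0).comp (h.tendsto_innov hS)
    rwa [Matrix.mulVec_zero] at this
  have hη := hnext.add (hw.sub hθ)
  rw [sub_zero, add_zero] at hη
  refine tendsto_zero_of_damped (s := fun t => S.sStep (S.prev i) i (S.args x th t))
    (h.run a).locFinite (hS.c_pos i)
    (continuousOn_Ici_of_Icc fun b => (h.run b).continuousOn_h hS i)
    (fun t ht htE => ⟨?_, le_sStep hS _ _ _⟩) hη
  have hr := h.run (t + 1)
  have h1 := hasDerivAt_h hS.smooth i (hr.ode_x t (mem_Ioo_add_one ht) htE)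
    (hr.ode_th t (mem_Ioo_add_one ht) htE) (hr.ref t (mem_Ioo_add_one ht) htE)
  rw [updateRHS_eq] at h1
  refine h1.congr_deriv ?_
  ring

end Tracking

/-! ### Bound on the safety violation -/

section Violation

variable {n p : ℕ} {S : Loop n p}

/-- `∑_{k ≥ i} t^{k-i} / (k-i)! H k`, the response of a chain of integrators. -/
def chainSum (H : Fin n → ℝ) (i : ℕ) (t : ℝ) : ℝ :=
  ∑ k : Fin n, if i ≤ k.val then t ^ (k.val - i) / ((k.val - i).factorial : ℝ) * H k else 0

lemma hasDerivAt_pow_div_factorial (m : ℕ) (t : ℝ) :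
    HasDerivAt (fun t : ℝ => t ^ (m + 1) / ((m + 1).factorial : ℝ)) (t ^ m / (m.factorial : ℝ)) t := by
  refine ((hasDerivAt_pow (m + 1) t).div_const _).congr_deriv ?_
  rw [Nat.factorial_succ]
  have h1 : (m.factorial : ℝ) ≠ 0 := by positivity
  push_cast
  field_simp

lemma hasDerivAt_chainSum (H : Fin n → ℝ) (i : ℕ) (t : ℝ) :
    HasDerivAt (chainSum H i) (chainSum H (i + 1) t) t := by
  refine HasDerivAt.fun_sum fun k _ => ?_
  rcases lt_trichotomy i k.val with h | h | h
  · obtain ⟨m, hm⟩ := Nat.exists_eq_add_of_lt h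
    have h1 : k.val - i = m + 1 := by omega
    have h2 : k.val - (i + 1) = m := by omega
    have h3 : i ≤ k.val := h.le
    have h4 : i + 1 ≤ k.val := h
    simp only [h1, h2, h3, h4, if_true]
    exact (hasDerivAt_pow_div_factorial m t).mul_const _
  · have h3 : ¬ i + 1 ≤ k.val := by omega
    simp only [h, Nat.sub_self, pow_zero]
    simpa using hasDerivAt_const t (H k)
  · have h3 : ¬ i + 1 ≤ k.val := by omega
    have h4 : ¬ i ≤ k.val := by omega
    simp only [h3, h4, if_false]
    exact hasDerivAt_const _ _

lemma chainSum_nonneg {H : Fin n → ℝ} (hH : ∀ k, 0 ≤ H k) (i : ℕ) {t : ℝ} (ht : 0 ≤ t) :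
    0 ≤ chainSum H i t :=
  Finset.sum_nonneg fun k _ => by
    split_ifs
    · have := hH k
      positivity
    · exact le_rfl

lemma chainSum_at_zero (H : Fin n → ℝ) (i : Fin n) : chainSum H i.val 0 = H i := by
  unfold chainSum
  rw [Finset.sum_eq_single i]
  · simp
  · intro k _ hk
    split_ifs with h
    · have : k.val - i.val ≠ 0 := by
        have : k.val ≠ i.val := fun h => hk (Fin.ext h)
        omega
      simp [zero_pow this]
    · rfl
  · simp

lemma chainSum_of_le (H : Fin n → ℝ) {i : ℕ} (hi : n ≤ i) (t : ℝ) : chainSum H i t = 0 :=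
  Finset.sum_eq_zero fun k _ => if_neg (by omega)

lemma chainSum_zero (H : Fin n → ℝ) (t : ℝ) :
    chainSum H 0 t = ∑ k : Fin n, t ^ k.val / (k.val.factorial : ℝ) * H k := by
  simp [chainSum]

/-- These are the comparison functions: Uᵢ' = -cUᵢ + Uᵢ₊₁, the error cascade with equal gains and no
disturbance. -/
lemma hasDerivAt_exp_mul_chainSum (H : Fin n → ℝ) (i : ℕ) (c t : ℝ) :
    HasDerivAt (fun t => Real.exp (-c * t) * chainSum H i t)
      (-c * (Real.exp (-c * t) * chainSum H i t) + Real.exp (-c * t) * chainSum H (i + 1) t) t := by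
  refine ((((hasDerivAt_id t).const_mul (-c)).exp).mul (hasDerivAt_chainSum H i t)).congr_deriv ?_
  simp only [id]
  ring

lemma nonempty_fin (hS : S.Regular) : Nonempty (Fin n) := ⟨⟨0, hS.pos⟩⟩

lemma cMin_le (S : Loop n p) (i : Fin n) : S.cMin ≤ S.c i := ciInf_le (finite_range _).bddBelow i

lemma cMin_pos (hS : S.Regular) : 0 < S.cMin := by
  have := nonempty_fin hS
  obtain ⟨i, hi⟩ := exists_eq_ciInf_of_finite (f := S.c)
  rw [Loop.cMin, ← hi]
  exact hS.c_pos i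

lemma κMin_le (S : Loop n p) (i : Fin n) : S.κMin ≤ S.κ i := ciInf_le (finite_range _).bddBelow i

lemma κMin_pos (hS : S.Regular) : 0 < S.κMin := by
  have := nonempty_fin hS
  obtain ⟨i, hi⟩ := exists_eq_ciInf_of_finite (f := S.κ)
  rw [Loop.κMin, ← hi]
  exact hS.κ_pos i

lemma gMin_le (S : Loop n p) {i : Fin n} (hi : 0 < i.val) : S.gMin ≤ S.g i :=
  ciInf_le (f := fun i : {i : Fin n // 0 < i.val} => S.g i.val) (finite_range _).bddBelow ⟨i, hi⟩

lemma gMin_pos (hS : S.Regular) (hn : 1 < n) : 0 < S.gMin := by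
  have : Nonempty {i : Fin n // 0 < i.val} := ⟨⟨⟨1, hn⟩, one_pos⟩⟩
  obtain ⟨i, hi⟩ := exists_eq_ciInf_of_finite (f := fun i : {i : Fin n // 0 < i.val} => S.g i.val)
  rw [Loop.gMin, ← hi]
  exact hS.g_pos i.val

/-- The sum form covers c = 1 uniformly and makes `tailBound` satisfy a one-step recursion. -/
lemma geomFactor_eq (hS : S.Regular) :
    S.geomFactor = ∑ k ∈ Finset.range n, S.cMin⁻¹ ^ k := by
  have hc := cMin_pos hS
  unfold Loop.geomFactor
  split_ifs with h1
  · simp [h1]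
  · have h2 : S.cMin⁻¹ ≠ 1 := by simpa using h1
    have h3 : S.cMin - 1 ≠ 0 := sub_ne_zero.mpr h1
    have h4 : S.cMin⁻¹ - 1 ≠ 0 := sub_ne_zero.mpr h2
    rw [geom_sum_eq h2, div_eq_div_iff (by positivity) h4]
    obtain ⟨m, rfl⟩ := Nat.exists_eq_succ_of_ne_zero hS.pos.ne'
    simp only [Nat.succ_eq_add_one, Nat.add_sub_cancel, inv_pow]
    field_simp
    ring

/-- The bound on one error coordinate due to the parameter error, of norm `e` initially. -/
def Loop.stepBound (S : Loop n p) (γ e : ℝ) : ℝ :=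
  (1 / Real.sqrt (S.cMin * S.κMin) +
    (if n = 1 then 0 else Real.sqrt (γ / (S.σ * S.gMin)))) / 2 * e

lemma stepBound_nonneg (S : Loop n p) (γ : ℝ) {e : ℝ} (he : 0 ≤ e) : 0 ≤ S.stepBound γ e := by
  unfold Loop.stepBound
  split_ifs <;> positivity

/-- The bound on the error coordinates from number `i` on. -/
def Loop.tailBound (S : Loop n p) (γ e : ℝ) (i : ℕ) : ℝ :=
  S.stepBound γ e * ∑ k ∈ Finset.range (n - i), S.cMin⁻¹ ^ k

lemma tailBound_nonneg (hS : S.Regular) (γ : ℝ) {e : ℝ} (he : 0 ≤ e) (i : ℕ) :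
    0 ≤ S.tailBound γ e i :=
  mul_nonneg (stepBound_nonneg S γ he) (Finset.sum_nonneg fun k _ => by
    have := cMin_pos hS
    positivity)

lemma tailBound_eq (S : Loop n p) (γ e : ℝ) (i : Fin n) :
    S.tailBound γ e i = S.stepBound γ e + S.tailBound γ e (i.val + 1) / S.cMin := by
  have h : n - i.val = n - (i.val + 1) + 1 := by omega
  rw [Loop.tailBound, h, geom_sum_succ, Loop.tailBound]
  ring

lemma tailBound_zero (hS : S.Regular) (γ e : ℝ) : S.tailBound γ e 0 = S.violationBound γ e := by
  rw [Loop.tailBound, Loop.violationBound, geomFactor_eq hS, Loop.stepBound, Nat.sub_zero]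
  ring

/-- With e(0) = 0 the initial value of V is γ⁻¹|θ̃(0)|², and G = γ² for Γ = γI. The two energies are
then |θ̃(0)|²/4 times γ/(σgᵢ) and 1/(cᵢκᵢ), and a² + b² ≤ (a + b)² for a, b ≥ 0. The first term is
absent at the first index, where α₀ = 0 does not involve θ̂. -/
lemma step_energy_le (hS : S.Regular) {γ e : ℝ} (hγ : 0 < γ) (he : 0 ≤ e) (i : Fin n) :
    S.adaptWeight (γ ^ 2) i * (γ⁻¹ * e ^ 2) + e ^ 2 / (2 * S.κ i) / (2 * S.c i) ≤
      S.stepBound γ e ^ 2 := by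
  have hc := cMin_pos hS
  have hκ := κMin_pos hS
  have hci := hS.c_pos i
  have hκi := hS.κ_pos i
  have hσ := hS.σ_pos
  set A := 1 / Real.sqrt (S.cMin * S.κMin) with hA
  set b : ℝ := if n = 1 then 0 else Real.sqrt (γ / (S.σ * S.gMin)) with hb
  have hA0 : 0 ≤ A := by positivity
  have hb0 : 0 ≤ b := by rw [hb]; split_ifs <;> positivity
  have hA2 : A ^ 2 = 1 / (S.cMin * S.κMin) := by
    rw [hA, div_pow, Real.sq_sqrt (by positivity), one_pow]
  have h1 : e ^ 2 / (2 * S.κ i) / (2 * S.c i) ≤ (A / 2 * e) ^ 2 := by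
    calc e ^ 2 / (2 * S.κ i) / (2 * S.c i) = e ^ 2 / 4 * (1 / (S.c i * S.κ i)) := by
          field_simp; ring
      _ ≤ e ^ 2 / 4 * (1 / (S.cMin * S.κMin)) := by
          have := cMin_le S i
          have := κMin_le S i
          gcongr
      _ = (A / 2 * e) ^ 2 := by rw [← hA2]; ring
  have h2 : S.adaptWeight (γ ^ 2) i * (γ⁻¹ * e ^ 2) ≤ (b / 2 * e) ^ 2 := by
    unfold Loop.adaptWeight
    split_ifs with hi
    · rw [zero_mul]; positivity
    · have hn : n ≠ 1 := by omega
      have hg := gMin_pos hS (by omega)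
      have hgi := gMin_le S (Nat.pos_of_ne_zero hi)
      have hg0 := hS.g_pos i
      have hb2 : b ^ 2 = γ / (S.σ * S.gMin) := by
        rw [hb, if_neg hn, Real.sq_sqrt (by positivity)]
      calc γ ^ 2 / (4 * S.σ * S.g i) * (γ⁻¹ * e ^ 2) = e ^ 2 / 4 * (γ / (S.σ * S.g i)) := by
            field_simp
        _ ≤ e ^ 2 / 4 * (γ / (S.σ * S.gMin)) := by gcongr
        _ = (b / 2 * e) ^ 2 := by rw [← hb2]; ring
  have h3 : S.stepBound γ e = A / 2 * e + b / 2 * e := by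
    rw [Loop.stepBound, ← hA, ← hb]; ring
  rw [h3]
  have h4 : 0 ≤ A / 2 * e * (b / 2 * e) := by positivity
  nlinarith

/-- The gain condition makes all initial error coordinates nonnegative. -/
lemma initial_nonneg (hS : S.Regular) {z : Args n p} (hgain : S.GainChoice z)
    (h0 : 0 ≤ S.h ⟨0, hS.pos⟩ z) (i : Fin n) : 0 ≤ S.h i z := by
  obtain ⟨k, hk⟩ := i
  induction k with
  | zero => exact h0
  | succ k ih =>
    have hk' : k < n := Nat.lt_of_succ_lt hk
    have hh := ih hk'
    obtain ⟨g1, g2⟩ := hgain ⟨k, hk'⟩ hk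
    -- The next coordinate is the bracket plus sₖhₖ, and the gain condition bounds the bracket below
    -- by -cₖhₖ ≥ -sₖhₖ.
    have hnext : S.h ⟨k + 1, hk⟩ z = S.bracket ⟨k, hk'⟩ hk z +
        S.sStep (S.prev ⟨k, hk'⟩) ⟨k, hk'⟩ z * S.h ⟨k, hk'⟩ z := by
      have h1 : S.h ⟨k + 1, hk⟩ z = z.1 ⟨k + 1, hk⟩ -
          S.alpha (k + 1) (⟨k, hk'⟩ : Fin n).isLt z - z.2.2 (⟨k, hk'⟩ : Fin n).succ := rfl
      have h2 := alpha_succ (S := S) ⟨k, hk'⟩ z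
      rw [h1, h2, Loop.bracket]
      ring
    rw [hnext]
    rcases hh.eq_or_lt with heq | hlt
    · rw [← heq, mul_zero, add_zero]
      exact g2 heq.symm
    · have h3 := (le_max_left _ _).trans (g1 hlt.ne')
      have h4 := le_sStep hS (S.prev ⟨k, hk'⟩) ⟨k, hk'⟩ z
      have h5 : -S.bracket ⟨k, hk'⟩ hk z ≤ S.c ⟨k, hk'⟩ * S.h ⟨k, hk'⟩ z := by
        rw [← div_le_iff₀ hlt]
        refine le_trans (le_of_eq ?_) h3
        rw [Loop.cLow]
        field_simp
      have h6 := mul_le_mul_of_nonneg_right h4 hlt.le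
      linarith

section Scalar

variable {E : Set ℝ} {γ : ℝ} {x xh : ℝ → Fin n → ℝ} {th : ℝ → Fin p → ℝ}

lemma lyapunov_of_scalar (hγ : 0 < γ) (hΓ : S.Γ = γ • (1 : Matrix (Fin p) (Fin p) ℝ))
    (x xh : Fin n → ℝ) (th : Fin p → ℝ) :
    S.lyapunov x xh th = (x - xh) ⬝ᵥ S.P *ᵥ (x - xh) + γ⁻¹ * ((S.θ - th) ⬝ᵥ (S.θ - th)) := by
  have hinv : S.Γ⁻¹ = γ⁻¹ • (1 : Matrix (Fin p) (Fin p) ℝ) := by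
    refine Matrix.inv_eq_left_inv ?_
    rw [hΓ, smul_mul_smul_comm, one_mul, inv_mul_cancel₀ hγ.ne', one_smul]
  rw [Loop.lyapunov, hinv, Matrix.smul_mulVec, Matrix.one_mulVec, dotProduct_smul, smul_eq_mul]

/-- As x̂(0) = x(0), the Lyapunov function starts with its parameter part alone, and for Γ = γI that
part is a multiple of |θ̃|². -/
lemma Loop.Run.parameter_error_le (hS : S.Regular) (hγ : 0 < γ)
    (hΓ : S.Γ = γ • (1 : Matrix (Fin p) (Fin p) ℝ)) {b : ℝ} (h : S.Run E 0 b x xh th)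
    (h0 : xh 0 = x 0) {t : ℝ} (ht : t ∈ Icc 0 b) :
    (S.θ - th t) ⬝ᵥ (S.θ - th t) ≤ eucNorm (S.θ - th 0) ^ 2 := by
  have h1 := h.lyapunov_le hS ht
  rw [lyapunov_of_scalar hγ hΓ, lyapunov_of_scalar hγ hΓ, h0, sub_self, zero_dotProduct,
    zero_add] at h1
  have h2 := posDef_dotProduct_nonneg hS.P_posDef (x t - xh t)
  rw [eucNorm_sq]
  have h3 : γ⁻¹ * ((S.θ - th t) ⬝ᵥ (S.θ - th t)) ≤ γ⁻¹ * ((S.θ - th 0) ⬝ᵥ (S.θ - th 0)) := by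
    linarith
  exact le_of_mul_le_mul_left h3 (inv_pos.mpr hγ)

/-- One step with the initial excess over the comparison function nonpositive. -/
lemma Loop.Run.error_step_scalar (hS : S.Regular) (hγ : 0 < γ)
    (hΓ : S.Γ = γ • (1 : Matrix (Fin p) (Fin p) ℝ)) {b : ℝ} (h : S.Run E 0 b x xh th)
    (h0 : xh 0 = x 0) (hb : 0 ≤ b) (i : Fin n) {M ε : ℝ} (hε : ε ^ 2 = 1) (hM : 0 ≤ M)
    {U U' : ℝ → ℝ} (hU : ∀ t, HasDerivAt U (U' t) t) (hU0 : ∀ t ∈ Ioo 0 b, 0 ≤ U t)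
    (hinit : ε * S.h i (S.args x th 0) ≤ U 0)
    (hnext : ∀ t ∈ Ioo 0 b, ε * S.hNext i (S.args x th t) ≤ U' t + S.c i * U t + M) :
    ε * S.h i (S.args x th b) ≤
      U b + (S.stepBound γ (eucNorm (S.θ - th 0)) + M / S.cMin) := by
  have hc := cMin_pos hS
  have hci := hS.c_pos i
  have hUc : Continuous U := continuous_iff_continuousAt.mpr fun t => (hU t).continuousAt
  have key := h.error_step hS hb i (G := γ ^ 2) (τ := eucNorm (S.θ - th 0) ^ 2) (M := M) (ε := ε)
    -- Defining Uₙ as U' + cᵢU turns any differentiable U into an admissible comparison function for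
    -- the gain cᵢ.
    (U := U) (Un := fun t => U' t + S.c i * U t) (sq_nonneg _)
    (fun q => by
      rw [hΓ, Matrix.smul_mulVec, Matrix.one_mulVec, smul_dotProduct, dotProduct_smul, smul_eq_mul,
        smul_eq_mul]
      exact le_of_eq (by ring))
    (fun t ht => h.parameter_error_le hS hγ hΓ h0 ht) hε hM hUc.continuousOn
    (fun t _ => (hU t).congr_deriv (by ring)) hU0 hnext
  have hMc : 0 ≤ M / S.c i := by positivity
  rw [max_eq_right (by linarith), lyapunov_of_scalar hγ hΓ, h0, sub_self, zero_dotProduct,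
    zero_add, ← eucNorm_sq] at key
  have h1 := Real.sqrt_le_sqrt (step_energy_le hS hγ (eucNorm_nonneg (S.θ - th 0)) i)
  rw [Real.sqrt_sq (stepBound_nonneg S γ (eucNorm_nonneg _))] at h1
  have h2 : M / S.c i ≤ M / S.cMin := by
    have := cMin_le S i
    gcongr
  rw [show (0 : ℝ) ^ 2 + S.adaptWeight (γ ^ 2) i * (γ⁻¹ * eucNorm (S.θ - th 0) ^ 2) =
    S.adaptWeight (γ ^ 2) i * (γ⁻¹ * eucNorm (S.θ - th 0) ^ 2) by ring] at key
  linarith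

/-- From below the comparison function is zero, from above the chain response. Both start on the
correct side of hᵢ(0) because hᵢ(0) ≥ 0, so no initial excess enters the square root. -/
lemma error_bounds (hS : S.Regular) (hγ : 0 < γ)
    (hΓ : S.Γ = γ • (1 : Matrix (Fin p) (Fin p) ℝ)) (h : ∀ b, S.Run E 0 b x xh th)
    (h0 : xh 0 = x 0) (hH : ∀ i, 0 ≤ S.h i (S.args x th 0)) (i : Fin n) :
    ∀ t, 0 ≤ t →
      -S.tailBound γ (eucNorm (S.θ - th 0)) i ≤ S.h i (S.args x th t) ∧
      S.h i (S.args x th t) ≤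
        Real.exp (-S.cMin * t) * chainSum (fun k => S.h k (S.args x th 0)) i.val t +
          S.tailBound γ (eucNorm (S.θ - th 0)) i := by
  set e := eucNorm (S.θ - th 0) with he
  set H : Fin n → ℝ := fun k => S.h k (S.args x th 0) with hHdef
  have he0 : 0 ≤ e := eucNorm_nonneg _
  refine backward_induction (Q := fun i => ∀ t, 0 ≤ t →
      -S.tailBound γ e i ≤ S.h i (S.args x th t) ∧ S.h i (S.args x th t) ≤
        Real.exp (-S.cMin * t) * chainSum H i.val t + S.tailBound γ e i) (fun i ih => ?_) i
  have hnext : ∀ t, 0 ≤ t → -S.tailBound γ e (i.val + 1) ≤ S.hNext i (S.args x th t) ∧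
      S.hNext i (S.args x th t) ≤ Real.exp (-S.cMin * t) * chainSum H (i.val + 1) t +
        S.tailBound γ e (i.val + 1) := by
    intro t ht
    unfold Loop.hNext
    split_ifs with hi
    · exact ih hi t ht
    · have h1 := tailBound_nonneg hS γ he0 (i.val + 1)
      rw [chainSum_of_le H (by omega)]
      constructor <;> simp [h1]
  intro t ht
  have hM := tailBound_nonneg hS γ he0 (i.val + 1)
  rw [tailBound_eq S γ e i]
  constructor
  · have key := (h t).error_step_scalar hS hγ hΓ h0 ht i (ε := -1) (M := S.tailBound γ e (i.val + 1))
      (U := fun _ => 0) (U' := fun _ => 0) (by norm_num) hM (fun t => hasDerivAt_const t 0)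
      (fun _ _ => le_rfl) (by have := hH i; linarith) (fun τ hτ => by
        have := (hnext τ hτ.1.le).1
        linarith)
    rw [← he] at key
    linarith
  · have key := (h t).error_step_scalar hS hγ hΓ h0 ht i (ε := 1) (M := S.tailBound γ e (i.val + 1))
      (U := fun t => Real.exp (-S.cMin * t) * chainSum H i.val t) (by norm_num) hM
      (fun t => hasDerivAt_exp_mul_chainSum H i.val S.cMin t)
      (fun τ hτ => mul_nonneg (Real.exp_pos _).le (chainSum_nonneg hH _ hτ.1.le))
      (by simp [chainSum_at_zero, hHdef]) (fun τ hτ => by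
        have h1 := (hnext τ hτ.1.le).2
        have h2 := mul_nonneg (Real.exp_pos (-S.cMin * τ)).le (chainSum_nonneg hH i.val hτ.1.le)
        -- The chain decays at the smallest gain c, so U' + cᵢU = Uᵢ₊₁ + (cᵢ - c)U ≥ Uᵢ₊₁.
        have h3 := mul_nonneg (sub_nonneg.mpr (cMin_le S i)) h2
        linarith)
    rw [← he] at key
    linarith

end Scalar

lemma h_zero (hn : 0 < n) (x : ℝ → Fin n → ℝ) (th : ℝ → Fin p → ℝ) (t : ℝ) :
    S.h ⟨0, hn⟩ (S.args x th t) = x t ⟨0, hn⟩ - S.r t := by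
  have h1 : S.h ⟨0, hn⟩ (S.args x th t) = x t ⟨0, hn⟩ - 0 - refDeriv S.r 0 t := rfl
  rw [h1, refDeriv, iteratedDerivWithin_zero, sub_zero]

theorem violation_bound (hS : S.Regular) {γ : ℝ} (hγ : 0 < γ)
    (hΓ : S.Γ = γ • (1 : Matrix (Fin p) (Fin p) ℝ)) {x xh : ℝ → Fin n → ℝ} {th : ℝ → Fin p → ℝ}
    (hsol : S.IsSolution (Ici 0) x xh th) (hgain : S.GainChoice (S.args x th 0))
    (hsafe : 0 ≤ x 0 ⟨0, hS.pos⟩ - S.r 0) (h0 : xh 0 = x 0) {t : ℝ} (ht : 0 ≤ t) :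
    -S.violationBound γ (eucNorm (S.θ - th 0)) ≤ x t ⟨0, hS.pos⟩ - S.r t ∧
      x t ⟨0, hS.pos⟩ - S.r t ≤ Real.exp (-S.cMin * t) *
          (∑ i : Fin n, t ^ i.val / (i.val.factorial : ℝ) * S.h i (S.args x th 0)) +
        S.violationBound γ (eucNorm (S.θ - th 0)) := by
  obtain ⟨E, hE⟩ := hsol.exists_run hS
  rw [← h_zero hS.pos x th 0] at hsafe
  have key := error_bounds hS hγ hΓ (fun b => hE 0 b le_rfl Icc_subset_Ici_self) h0
    (initial_nonneg hS hgain hsafe) ⟨0, hS.pos⟩ t ht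
  rw [h_zero, chainSum_zero, tailBound_zero hS] at key
  exact key

end Violation

end XPassive

end

theorem theorem3 {n p : ℕ} (hn : 0 < n) (S : XPassive.Loop n p)
    (hφ : ∀ i, ContDiff ℝ ∞ (S.φ i))
    (hr : XPassive.AdmissibleReference n S.r)
    (hc : ∀ i, 0 < S.c i) (hκ : ∀ i, 0 < S.κ i) (hg : ∀ i, 0 < S.g i) (hσ : 0 < S.σ)
    (hP : S.P.PosDef) (hLyap : S.A₀ᵀ * S.P + S.P * S.A₀ = -1)
    (hΓ : S.Γ.PosDef) :
    -- every initial condition has a solution for all later times, and it is the only one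
    (∀ t₀ : ℝ, 0 ≤ t₀ → ∀ (x₀ xh₀ : Fin n → ℝ) (th₀ : Fin p → ℝ),
      ∃ (x xh : ℝ → Fin n → ℝ) (th : ℝ → Fin p → ℝ),
        S.IsSolution (Ici t₀) x xh th ∧ x t₀ = x₀ ∧ xh t₀ = xh₀ ∧ th t₀ = th₀ ∧
        ∀ (T : ℝ) (x' xh' : ℝ → Fin n → ℝ) (th' : ℝ → Fin p → ℝ),
          S.IsSolution (Ico t₀ T) x' xh' th' → x' t₀ = x₀ → xh' t₀ = xh₀ → th' t₀ = th₀ →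
          EqOn x' x (Ico t₀ T) ∧ EqOn xh' xh (Ico t₀ T) ∧ EqOn th' th (Ico t₀ T)) ∧
    -- all signals are globally uniformly bounded
    (∀ R : ℝ, ∃ B : ℝ, ∀ t₀ : ℝ, 0 ≤ t₀ →
      ∀ (x xh : ℝ → Fin n → ℝ) (th : ℝ → Fin p → ℝ),
        S.IsSolution (Ici t₀) x xh th →
        XPassive.eucNorm (x t₀) ≤ R → XPassive.eucNorm (xh t₀) ≤ R →
        XPassive.eucNorm (th t₀) ≤ R →
        ∀ t, t₀ ≤ t →
          XPassive.eucNorm (x t) ≤ B ∧ XPassive.eucNorm (xh t) ≤ B ∧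
          XPassive.eucNorm (th t) ≤ B ∧
          XPassive.eucNorm (fun i => S.h i (S.args x th t)) ≤ B ∧
          XPassive.eucNorm (S.updateRHS (x t) (xh t)) ≤ B ∧
          |S.uBar (S.args x th t)| ≤ B) ∧
    -- asymptotic tracking
    (∀ t₀ : ℝ, 0 ≤ t₀ → ∀ (x xh : ℝ → Fin n → ℝ) (th : ℝ → Fin p → ℝ),
      S.IsSolution (Ici t₀) x xh th →
      ∀ i, Tendsto (fun t => S.h i (S.args x th t)) atTop (𝓝 0)) ∧
    -- bound on the safety violation
    (∀ γ : ℝ, 0 < γ → S.Γ = γ • (1 : Matrix (Fin p) (Fin p) ℝ) →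
      ∀ (x xh : ℝ → Fin n → ℝ) (th : ℝ → Fin p → ℝ),
        S.IsSolution (Ici 0) x xh th →
        S.GainChoice (S.args x th 0) →
        0 ≤ x 0 ⟨0, hn⟩ - S.r 0 →
        xh 0 = x 0 →
        ∀ t, 0 ≤ t →
          -S.violationBound γ (XPassive.eucNorm (S.θ - th 0)) ≤ x t ⟨0, hn⟩ - S.r t ∧
          x t ⟨0, hn⟩ - S.r t ≤
            Real.exp (-S.cMin * t) *
                (∑ i : Fin n, t ^ i.val / (i.val.factorial : ℝ) * S.h i (S.args x th 0)) +
              S.violationBound γ (XPassive.eucNorm (S.θ - th 0))) := by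
  have hS : S.Regular := ⟨hn, hφ, hr, hc, hκ, hg, hσ, hP, hLyap, hΓ⟩
  refine ⟨fun t₀ ht₀ x₀ xh₀ th₀ => XPassive.existence_uniqueness hS t₀ ht₀ x₀ xh₀ th₀,
    XPassive.globally_bounded hS, fun t₀ ht₀ x xh th hsol i => ?_,
    fun γ hγ hΓγ x xh th hsol hgain hsafe h0 t ht =>
      XPassive.violation_bound hS hγ hΓγ hsol hgain hsafe h0 ht⟩
  obtain ⟨E, B, hrun⟩ := hsol.exists_boundedRun hS ht₀
  exact hrun.tendsto_h hS i
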